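/- Let $G$ be a finite tree (edges unoriented, i.e. bioriented) with vertex set $V$. Let $\beta$ be the largest eigenvalue of its adjacency matrix and $\mu=(\mu_v)_{v\in V}$ the Perron–Frobenius eigenvector, normalised so that its smallest component is $1$. Assume $\beta<2$ (equivalently, $G$ is one of the Dynkin diagrams $A_n$, $D_n$, $E_6$, $E_7$, $E_8$). Let $\mathcal P$ be the complex vector space whose basis is the set of elementary paths of finite length, i.e. successions $(v_0,\dots,v_n)$, $n\ge 0$, of nearest neighbours in $G$, with the scalar product for which this basis is orthonormal. Let $\star$ be the concatenation product (zero on elementary paths $\xi,\rho$ when $\xi$ does not end where $\rho$ starts), let $*$ be the antilinear involution that reverses elementary paths, and let $\mathcal P_{vw}$ be the span of the elementary paths from $v$ to $w$. For $i\ge 0$ the Jones projection $e_i$ is the length-preserving operator $$e_i(v_0\cdots v_n)=\frac1\beta\,\delta_{v_i v_{i+2}}\sum_{v'_{i+1}}\sqrt{\frac{\mu_{v_{i+1}}\mu_{v'_{i+1}}}{\mu_{v_i}\mu_{v_{i+2}}}}\;(v_0\cdots v_i\,v'_{i+1}\,v_{i+2}\cdots v_n)\quad (i+2\le n),\qquad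 e_i(v_0\cdots v_n)=0\quad(i+2>n),$$ the sum being over the nearest neighbours $v'_{i+1}$ of $v_i$. A *family of symmetry operators* consists of a finite set $I$ of labels, an initial vertex $\alpha_i$ and a final vertex $\alpha_f$ for every $\alpha\in I$, an involution $\alpha\mapsto\tilde\alpha$ of $I$ that exchanges initial and final vertices, and linear operators $T_{\alpha\beta}:\mathcal P\to\mathcal P$ $(\alpha,\beta\in I)$ mapping $\mathcal P_{\alpha_i\beta_i}$ to $\mathcal P_{\alpha_f\beta_f}$ and vanishing on all other $\mathcal P_{vw}$, such that 1. $T_{\alpha\beta}$ maps combinations of paths of length $n$ to combinations of paths of length $n$; 2. $T_{\alpha\beta}(\xi\star\rho)=\sum_{\gamma\in I}T_{\alpha\gamma}(\xi)\star T_{\gamma\beta}(\rho)$; 3. $T_{\alpha\beta}^\dagger=T_{\tilde\alpha\tilde\beta}$; 4. $T_{\alpha\beta}(\xi^*)=(T_{\beta\alpha}(\xi))^*$; 5. $[T_{\alpha\beta},e_i]=0$ for all $i$; 6. (normalisation) if $T_{\alpha\beta}(v)=\sum_w t_{w}\,w$ on the path $v$ of length $0$, then $T_{\alpha\beta}(c_v)=\sum_w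 t_w\,c_w$, where $c_v=\sum_{u}\sqrt{\mu_u/\mu_v}\,(v\,u\,v)$, the sum being over the nearest neighbours $u$ of $v$. (For $I=V\times V$ and $\widetilde{(v,w)}=(w,v)$ the labels are pairs of vertices; composites of operators are labelled by longer successions of vertices.) Let $A\subset \mathrm{End}(\mathcal P)$ be the linear span of all operators occurring in such families. Let $\mathcal E=\{\xi\in\mathcal P: e_i\xi=0\ \forall i\}$ be the space of essential paths and $\mathrm{End}^{gr}(\mathcal E)$ the space of its length-preserving linear endomorphisms. Then $A$ and $\mathrm{End}^{gr}(\mathcal E)$ are isomorphic as vector spaces. More precisely, every element of $A$ maps $\mathcal E$ to itself, and the restriction map $S\mapsto S|_{\mathcal E}$ is a linear isomorphism $A\to \mathrm{End}^{gr}(\mathcal E)$. -/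

import Mathlib

open scoped ComplexConjugate

noncomputable section

namespace FaceModel

universe u

variable {V : Type u} [Fintype V] [DecidableEq V]

/-- `β` is the largest eigenvalue of the adjacency matrix of `G`, and `μ` is the corresponding
eigenvector, normalised so that its smallest component is `1`. -/
structure IsPerronFrobenius (G : SimpleGraph V) [DecidableRel G.Adj] (β : ℝ) (μ : V → ℝ) :
    Prop where
  eigenvector : (G.adjMatrix ℝ).mulVec μ = β • μ
  largest : ∀ c : ℝ, Module.End.HasEigenvalue (Matrix.toLin' (G.adjMatrix ℝ)) c → c ≤ β
  one_le : ∀ v, 1 ≤ μ v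
  exists_eq_one : ∃ v, μ v = 1

/-- Elementary paths of length `n`: successions `v₀ v₁ ⋯ vₙ` of nearest neighbours. -/
abbrev PathN (G : SimpleGraph V) (n : ℕ) : Type u :=
  {p : Fin (n + 1) → V // ∀ i : Fin n, G.Adj (p i.castSucc) (p i.succ)}

/-- Elementary paths of arbitrary finite length. -/
abbrev ElemPath (G : SimpleGraph V) : Type u := Σ n : ℕ, PathN G n

namespace ElemPath

variable {G : SimpleGraph V}

/-- The length of an elementary path. -/
def len (ξ : ElemPath G) : ℕ := ξ.1

/-- The starting vertex. -/
def source (ξ : ElemPath G) : V := ξ.2.1 0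

/-- The ending vertex. -/
def target (ξ : ElemPath G) : V := ξ.2.1 (Fin.last ξ.1)

/-- The path of length zero at a vertex. -/
def vertex (G : SimpleGraph V) (v : V) : ElemPath G := ⟨0, fun _ => v, fun i => i.elim0⟩

/-- The reversed path. -/
def reverse (ξ : ElemPath G) : ElemPath G :=
  ⟨ξ.1, fun i => ξ.2.1 i.rev, fun i => by
    have h := (ξ.2.2 i.rev).symm
    simp only [Fin.rev_castSucc, Fin.rev_succ]
    exact h⟩

/-- The path `ξ` followed by the path `η`, where `η` starts at the end of `ξ`. -/
def append (ξ η : ElemPath G) (h : ξ.target = η.source) : ElemPath G :=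
  ⟨ξ.1 + η.1,
    fun k => if hk : (k : ℕ) ≤ ξ.1 then ξ.2.1 ⟨k, by omega⟩
      else η.2.1 ⟨(k : ℕ) - ξ.1, by omega⟩, by
    intro i
    have key : ∀ (x y : ℕ) (hx : x < η.1 + 1) (hy : y < η.1 + 1), x + 1 = y →
        G.Adj (η.2.1 ⟨x, hx⟩) (η.2.1 ⟨y, hy⟩) := by
      intro x y hx hy hxy
      subst hxy
      exact η.2.2 ⟨x, by omega⟩
    rcases lt_trichotomy (i : ℕ) ξ.1 with hi | hi | hi
    · have h1 : (i : ℕ) ≤ ξ.1 := by omega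
      have h2 : (i : ℕ) + 1 ≤ ξ.1 := by omega
      simp only [Fin.val_castSucc, Fin.val_succ, h1, h2, dite_true]
      exact ξ.2.2 ⟨i, hi⟩
    · have h1 : (i : ℕ) ≤ ξ.1 := by omega
      have h2 : ¬ (i : ℕ) + 1 ≤ ξ.1 := by omega
      simp only [Fin.val_castSucc, Fin.val_succ, h1, h2, dite_true, dite_false]
      have e : ξ.2.1 ⟨(i : ℕ), by omega⟩ = η.2.1 0 := by
        have : (⟨(i : ℕ), by omega⟩ : Fin (ξ.1 + 1)) = Fin.last ξ.1 := Fin.ext hi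
        rw [this]
        exact h
      rw [e]
      exact key 0 _ (by omega) (by omega) (by omega)
    · have h1 : ¬ (i : ℕ) ≤ ξ.1 := by omega
      have h2 : ¬ (i : ℕ) + 1 ≤ ξ.1 := by omega
      simp only [Fin.val_castSucc, Fin.val_succ, h1, h2, dite_false]
      exact key _ _ (by omega) (by omega) (by omega)⟩

end ElemPath

/-- The space of paths `𝒫`: complex linear combinations of elementary paths. -/
abbrev PathSpace (G : SimpleGraph V) : Type u := ElemPath G →₀ ℂ

/-- An elementary path as an element of the space of paths. -/
def basisPath {G : SimpleGraph V} (ξ : ElemPath G) : PathSpace G := Finsupp.single ξ 1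

/-- The scalar product for which the elementary paths are orthonormal. -/
def pathInner {G : SimpleGraph V} (f g : PathSpace G) : ℂ := f.sum fun ξ c => conj c * g ξ

/-- The space of paths of length `n`. -/
def lengthSpace (G : SimpleGraph V) (n : ℕ) : Submodule ℂ (PathSpace G) :=
  Finsupp.supported ℂ ℂ {ξ | ξ.len = n}

/-- The space of paths from `v` to `w`. -/
def endpointSpace (G : SimpleGraph V) (v w : V) : Submodule ℂ (PathSpace G) :=
  Finsupp.supported ℂ ℂ {ξ | ξ.source = v ∧ ξ.target = w}

/-- The concatenation product `⋆`, extended bilinearly; it is zero on two elementary paths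
the first of which does not end where the second one starts. -/
def concat (G : SimpleGraph V) : PathSpace G →ₗ[ℂ] PathSpace G →ₗ[ℂ] PathSpace G :=
  Finsupp.linearCombination ℂ fun ξ : ElemPath G =>
    Finsupp.linearCombination ℂ fun η : ElemPath G =>
      if h : ξ.target = η.source then basisPath (ξ.append η h) else (0 : PathSpace G)

/-- The involution `*`: reversal of elementary paths and complex conjugation of coefficients. -/
def pathStar {G : SimpleGraph V} (f : PathSpace G) : PathSpace G :=
  f.sum fun ξ c => Finsupp.single ξ.reverse (conj c)

/-- The Jones projection `eᵢ`. On `v₀ ⋯ vₙ` it is zero unless `i + 2 ≤ n` and `vᵢ = vᵢ₊₂`, in which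
case it is the sum over the elementary paths `η` of length `n` which differ from `v₀ ⋯ vₙ` at
position `i + 1` at most, with coefficients `β⁻¹ √(μ(vᵢ₊₁) μ(ηᵢ₊₁) / (μ(vᵢ) μ(vᵢ₊₂)))`. -/
def jones (G : SimpleGraph V) [DecidableRel G.Adj] (β : ℝ) (μ : V → ℝ) (i : ℕ) :
    PathSpace G →ₗ[ℂ] PathSpace G :=
  Finsupp.linearCombination ℂ fun ξ : ElemPath G =>
    if h : i + 2 ≤ ξ.1 then
      ∑ η : PathN G ξ.1,
        if ξ.2.1 ⟨i, by omega⟩ = ξ.2.1 ⟨i + 2, by omega⟩ ∧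
            ∀ j : Fin (ξ.1 + 1), (j : ℕ) ≠ i + 1 → η.1 j = ξ.2.1 j then
          ((1 / β * √(μ (ξ.2.1 ⟨i + 1, by omega⟩) * μ (η.1 ⟨i + 1, by omega⟩) /
            (μ (ξ.2.1 ⟨i, by omega⟩) * μ (ξ.2.1 ⟨i + 2, by omega⟩))) : ℝ) : ℂ) •
            basisPath (⟨ξ.1, η⟩ : ElemPath G)
        else (0 : PathSpace G)
    else 0

/-- The path `v w v`, for nearest neighbours `v` and `w`. -/
def backForth {G : SimpleGraph V} {v w : V} (h : G.Adj v w) : ElemPath G :=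
  ⟨2, ![v, w, v], by
    intro i
    fin_cases i
    · exact h
    · exact h.symm⟩

/-- The creation operator applied to the path of length zero at `v`: the sum of
`√(μ(w) / μ(v))` times `v w v` over the nearest neighbours `w` of `v`. -/
def creation (G : SimpleGraph V) [DecidableRel G.Adj] (μ : V → ℝ) (v : V) : PathSpace G :=
  ∑ w : V, if h : G.Adj v w then ((√(μ w / μ v) : ℝ) : ℂ) • basisPath (backForth h) else 0

/-- A finite family of symmetry operators `T a b`. Every label `a` has an initial vertex
`init a`, a final vertex `fin a` and a flipped label `flip a`. For the elementary families the
labels are the pairs `a = (aᵢ, a_f)` of vertices, and `flip` exchanges the two; for families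
obtained by composition of operators they are longer successions of vertices. -/
structure SymmetryFamily (G : SimpleGraph V) [DecidableRel G.Adj] (β : ℝ) (μ : V → ℝ)
    (ι : Type) [Fintype ι] where
  init : ι → V
  fin : ι → V
  flip : ι → ι
  flip_flip : ∀ a, flip (flip a) = a
  init_flip : ∀ a, init (flip a) = fin a
  fin_flip : ∀ a, fin (flip a) = init a
  /-- The operators. -/
  T : ι → ι → Module.End ℂ (PathSpace G)
  /-- `T a b` maps the paths from `init a` to `init b` to paths from `fin a` to `fin b`. -/
  mapsTo : ∀ a b, ∀ f ∈ endpointSpace G (init a) (init b),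
    T a b f ∈ endpointSpace G (fin a) (fin b)
  /-- `T a b` vanishes on paths with other end points. -/
  eq_zero : ∀ a b v w, (v, w) ≠ (init a, init b) → ∀ f ∈ endpointSpace G v w, T a b f = 0
  /-- Length is preserved. -/
  length : ∀ a b n, ∀ f ∈ lengthSpace G n, T a b f ∈ lengthSpace G n
  /-- Continuity. -/
  continuity : ∀ a b f g, T a b (concat G f g) = ∑ c, concat G (T a c f) (T c b g)
  /-- Hermiticity: the adjoint of `T a b` is `T (flip a) (flip b)`. -/
  hermitian : ∀ a b f g, pathInner (T a b f) g = pathInner f (T (flip a) (flip b) g)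
  /-- The involution of the concatenation product is preserved. -/
  involution : ∀ a b f, T a b (pathStar f) = pathStar (T b a f)
  /-- Evolution is preserved. -/
  evolution : ∀ a b i f, T a b (jones G β μ i f) = jones G β μ i (T a b f)
  /-- Normalisation. The evolution condition forces `T a b` to map the creation operator at `v`
  to a multiple of a creation operator; the multiple is the one by which `T a b` acts on the
  path of length zero at `v`. -/
  normalised : ∀ a b v, T a b (creation G μ v) =
    ∑ w, (T a b (basisPath (ElemPath.vertex G v))) (ElemPath.vertex G w) • creation G μ w

/-- The space `A`: the linear span of all symmetry operators. -/
def symmetrySpan (G : SimpleGraph V) [DecidableRel G.Adj] (β : ℝ) (μ : V → ℝ) :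
    Submodule ℂ (Module.End ℂ (PathSpace G)) :=
  Submodule.span ℂ {S | ∃ (ι : Type) (_ : Fintype ι) (F : SymmetryFamily G β μ ι) (a b : ι),
    S = F.T a b}

/-- The space `ℰ` of essential paths. -/
def essential (G : SimpleGraph V) [DecidableRel G.Adj] (β : ℝ) (μ : V → ℝ) :
    Submodule ℂ (PathSpace G) :=
  ⨅ i : ℕ, LinearMap.ker (jones G β μ i)

/-- Length preserving endomorphisms of a space of paths. -/
def gradedEnd {G : SimpleGraph V} (E : Submodule ℂ (PathSpace G)) :
    Submodule ℂ (Module.End ℂ E) where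
  carrier := {f | ∀ n, ∀ ξ : E, (ξ : PathSpace G) ∈ lengthSpace G n →
    (f ξ : PathSpace G) ∈ lengthSpace G n}
  add_mem' := fun {f g} hf hg n ξ hξ => by
    simpa using Submodule.add_mem _ (hf n ξ hξ) (hg n ξ hξ)
  zero_mem' := fun n ξ _ => by simp
  smul_mem' := fun c f hf n ξ hξ => by
    simpa using Submodule.smul_mem _ c (hf n ξ hξ)

end FaceModel

end

/-! Write P_n for the orthogonal projection of the paths of length n onto the essential ones. It is
the Jones–Wenzl projection, with kernel `jw` given by Wenzl's recursion: put an edge in front of P_n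
and subtract a cup–cap term with coefficient 1 / `ratio β n`, where `ratio β n` plays the role of
the quotient [n+1]/[n] of quantum integers. Because `β < 2`, this ratio becomes nonpositive after
finitely many steps. The partial trace of P_{N+1} is `ratio β (N + 1)` times P_N, so at the first N
for which this ratio is nonpositive, positivity forces P_{N+1} = 0
(`IsPerronFrobenius.exists_isTop`). Essential paths therefore have length at most N.

Surjectivity requires enough symmetry operators, and one explicit family suffices. Its labels index
the pairs of paths of equal length at most N, that is, matrices act on ⊕ P_n ⊗ P_n. A pair of edges
acts by a cell: put the two edges in front of the two paths and project (prolongation), plus the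
transposed prolongation for the reversed edges (annihilation). Multiplying cells along a pair of
paths gives a transport matrix, whose entry at the labels a, b is the coefficient of the first path
in the image of the second under T_{ab}. Multiplicativity of transport is continuity, transposition
is the involution, and exchange of the two paths is hermiticity. Evolution and normalisation come
from `IsTop.sum_cell_mul_cell`: cells carry creation to creation. In its proof double prolongations
vanish, while annihilation after prolongation and prolongation after annihilation add up to the two
sides of Wenzl's recursion.

Contracting the second label with a suitable vector of length zero leaves, on essential paths, only
the pure prolongations. The resulting operators act on ℰ as nonzero multiples of rank-one operators
between projected paths (`IsTop.cyclicOp_apply`), and these span the length preserving endomorphisms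
(`IsTop.exists_restriction`).

Injectivity is a positivity argument (`symmetry_eq_zero`). Let S in A vanish on ℰ. Normalisation and
continuity let S pass through an inserted creation element, so S(e_i ξ) is determined by S on a
shorter path. By induction on length, e_i S ξ = S e_i ξ = 0, hence S ξ is essential. The adjoint S†
also lies in A and preserves ℰ, so S S† S ξ = 0, and two uses of definiteness of the scalar product
give S ξ = 0. -/

noncomputable section

namespace FaceModel

set_option linter.unusedSectionVars false

/-! ### Sums over words in the vertices -/

section Words

variable {V : Type*} [Fintype V] [DecidableEq V]

/-- The lists of length `n` with entries in `V`. -/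
def words (V : Type*) [Fintype V] [DecidableEq V] : ℕ → Finset (List V)
  | 0 => {[]}
  | n + 1 => (Finset.univ ×ˢ words V n).image fun p => p.1 :: p.2

theorem mem_words {n : ℕ} {l : List V} : l ∈ words V n ↔ l.length = n := by
  induction n generalizing l with
  | zero => simp [words]
  | succ n ih =>
    cases l with
    | nil => simp [words]
    | cons a l => simp [words, ih]

theorem sum_words_zero {E : Type*} [AddCommMonoid E] (g : List V → E) :
    ∑ l ∈ words V 0, g l = g [] := by
  simp [words]

theorem sum_words_succ {E : Type*} [AddCommMonoid E] (n : ℕ) (g : List V → E) :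
    ∑ l ∈ words V (n + 1), g l = ∑ a, ∑ l ∈ words V n, g (a :: l) := by
  rw [words, Finset.sum_image, Finset.sum_product]
  rintro ⟨a, l⟩ _ ⟨b, m⟩ _ h
  simpa using h

theorem sum_words_add {E : Type*} [AddCommMonoid E] (m n : ℕ) (g : List V → E) :
    ∑ l ∈ words V (m + n), g l = ∑ l ∈ words V m, ∑ k ∈ words V n, g (l ++ k) := by
  induction m generalizing g with
  | zero => simp [sum_words_zero]
  | succ m ih =>
    rw [show m + 1 + n = (m + n) + 1 by omega, sum_words_succ, sum_words_succ]
    exact Finset.sum_congr rfl fun a _ => by rw [ih]; rfl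

/-- A sum over words in which only those with a given first letter contribute. -/
theorem sum_words_succ_of_head {E : Type*} [AddCommMonoid E] (n : ℕ) (u : V) (g : List V → E)
    (h : ∀ a l, a ≠ u → g (a :: l) = 0) :
    ∑ l ∈ words V (n + 1), g l = ∑ l ∈ words V n, g (u :: l) := by
  rw [sum_words_succ, Finset.sum_eq_single u]
  · intro b _ hb
    exact Finset.sum_eq_zero fun l _ => h b l hb
  · simp

theorem sum_words_succ_head {E : Type*} [AddCommMonoid E] (n : ℕ) (u : V) (g : List V → E) :
    (∑ l ∈ words V (n + 1), if l.head? = some u then g l else 0) =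
      ∑ l ∈ words V n, g (u :: l) := by
  rw [sum_words_succ_of_head n u]
  · simp
  · intro a l h
    simp [h]

end Words

/-! ### Quotients of quantum integers -/

/-- The continued fraction `β - 1 / (β - 1 / (β - ⋯))`; for `β = 2 cos θ` the value at `n` is
`sin ((n + 1) θ) / sin (n θ)`. -/
def ratio (β : ℝ) : ℕ → ℝ
  | 0 => 0
  | n + 1 => β - (ratio β n)⁻¹

/-- As long as the terms are positive, x + 1/x ≥ 2 makes each step of the continued fraction lose at
least 2 - β, so positivity cannot last. This is where `β < 2` enters. The value N = 0 is allowed and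
occurs when β ≤ 0, as for a single vertex. -/
theorem exists_ratio_nonpos {β : ℝ} (hβ : β < 2) :
    ∃ N, (∀ k, 0 < k → k ≤ N → 0 < ratio β k) ∧ ratio β (N + 1) ≤ 0 := by
  have h : ∃ N, ratio β (N + 1) ≤ 0 := by
    by_contra! h
    have key : ∀ n : ℕ, ratio β (n + 1) ≤ β - n * (2 - β) := by
      intro n
      induction n with
      | zero => simp [ratio]
      | succ n ih =>
        have hp := h n
        have h1 : 2 ≤ ratio β (n + 1) + (ratio β (n + 1))⁻¹ := by
          have := mul_inv_cancel₀ hp.ne'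
          have h2 := inv_pos.2 hp
          nlinarith [sq_nonneg (ratio β (n + 1) - (ratio β (n + 1))⁻¹)]
        rw [ratio]
        push_cast
        linarith
    obtain ⟨n, hn⟩ := exists_nat_gt (β / (2 - β))
    rw [div_lt_iff₀ (by linarith)] at hn
    linarith [key n, h n]
  classical
  refine ⟨Nat.find h, fun k hk hkN => ?_, Nat.find_spec h⟩
  obtain ⟨j, rfl⟩ : ∃ j, k = j + 1 := ⟨k - 1, by omega⟩
  exact not_le.1 (Nat.find_min h (by omega))


/-! ### The Jones–Wenzl kernel and essential functions -/

section JonesWenzl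

variable {V : Type*} [Fintype V] [DecidableEq V] (G : SimpleGraph V) [DecidableRel G.Adj]
  (β : ℝ) (μ : V → ℝ)

theorem IsPerronFrobenius.pos {G : SimpleGraph V} [DecidableRel G.Adj] {β : ℝ} {μ : V → ℝ}
    (h : IsPerronFrobenius G β μ) (v : V) : 0 < μ v :=
  one_pos.trans_le (h.one_le v)

theorem IsPerronFrobenius.sum_adj {G : SimpleGraph V} [DecidableRel G.Adj] {β : ℝ} {μ : V → ℝ}
    (h : IsPerronFrobenius G β μ) (v : V) : (∑ w, if G.Adj v w then μ w else 0) = β * μ v := by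
  have := congrFun h.eigenvector v
  simpa [Matrix.mulVec, dotProduct, SimpleGraph.adjMatrix_apply] using this

/-- The kernel of the Jones-Wenzl projection onto the essential paths of length `n`, in terms of
the words formed by the vertices of a path. -/
def jw : ℕ → List V → List V → ℝ
  | 0, p, q => if p = q ∧ p.length = 1 then 1 else 0
  | n + 1, u :: a :: p, v :: b :: q =>
    if u = v ∧ G.Adj u a ∧ G.Adj u b then
      jw n (a :: p) (b :: q) - (ratio β n)⁻¹ * (√(μ a) * √(μ b) / μ u) *
        ∑ r ∈ words V n, if r.head? = some u then
          jw n (a :: p) (a :: r) * jw n (b :: r) (b :: q) else 0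
    else 0
  | _ + 1, _, _ => 0

theorem jw_succ (n : ℕ) (u v a b : V) (p q : List V) :
    jw G β μ (n + 1) (u :: a :: p) (v :: b :: q) =
    if u = v ∧ G.Adj u a ∧ G.Adj u b then
      jw G β μ n (a :: p) (b :: q) - (ratio β n)⁻¹ * (√(μ a) * √(μ b) / μ u) *
        ∑ r ∈ words V n, if r.head? = some u then
          jw G β μ n (a :: p) (a :: r) * jw G β μ n (b :: r) (b :: q) else 0
    else 0 := by
  rw [jw]

theorem jw_comm (n : ℕ) (p q : List V) : jw G β μ n p q = jw G β μ n q p := by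
  induction n generalizing p q with
  | zero =>
    simp only [jw]
    refine if_congr ?_ rfl rfl
    constructor <;> (rintro ⟨rfl, h⟩; exact ⟨rfl, h⟩)
  | succ n ih =>
    rcases p with _ | ⟨u, _ | ⟨a, p⟩⟩ <;> rcases q with _ | ⟨v, _ | ⟨b, q⟩⟩ <;>
      try simp only [jw]
    by_cases huv : u = v
    · subst huv
      rw [ih (a :: p) (b :: q), mul_comm √(μ a) √(μ b)]
      refine if_congr (by tauto) ?_ rfl
      congr 2
      refine Finset.sum_congr rfl fun r _ => ?_
      rw [ih (a :: p), ih (b :: r), mul_comm]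
    · rw [if_neg (fun h => huv h.1), if_neg (fun h => huv h.1.symm)]

/-- The kernel ignores words that are not paths of the right length, so later sums may run over all
words instead of elementary paths. -/
theorem jw_ne_zero {n : ℕ} {p q : List V} (h : jw G β μ n p q ≠ 0) :
    p.length = n + 1 ∧ p.IsChain G.Adj ∧ p.head? = q.head? := by
  induction n generalizing p q with
  | zero =>
    simp only [jw, ne_eq, ite_eq_right_iff, one_ne_zero, imp_false, not_not] at h
    obtain ⟨rfl, h⟩ := h
    obtain ⟨a, rfl⟩ := List.length_eq_one_iff.1 h
    simp
  | succ n ih =>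
    rcases p with _ | ⟨u, _ | ⟨a, p⟩⟩ <;> rcases q with _ | ⟨v, _ | ⟨b, q⟩⟩ <;>
      try (simp [jw] at h; done)
    rw [jw_succ] at h
    split_ifs at h with huv
    · obtain ⟨rfl, h1, h2⟩ := huv
      have : ∃ s, jw G β μ n (a :: p) s ≠ 0 := by
        by_contra! h3
        simp [h3] at h
      obtain ⟨s, hs⟩ := this
      obtain ⟨h3, h4, -⟩ := ih hs
      exact ⟨by simpa using h3, List.isChain_cons_cons.2 ⟨h1, h4⟩, rfl⟩
    · exact absurd rfl h

theorem jw_ne_zero_right {n : ℕ} {p q : List V} (h : jw G β μ n p q ≠ 0) :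
    q.length = n + 1 ∧ q.IsChain G.Adj ∧ q.head? = p.head? :=
  jw_ne_zero G β μ (jw_comm G β μ n p q ▸ h)

theorem jw_eq_zero_of_head {n : ℕ} {a b : V} (p q : List V) (h : a ≠ b) :
    jw G β μ n (a :: p) (b :: q) = 0 := by
  by_contra h1
  have := (jw_ne_zero G β μ h1).2.2
  simp [h] at this

/-- A function on words which is supported on paths and killed by all annihilation operators. -/
structure IsEssential {E : Type*} [AddCommGroup E] [Module ℝ E] (G : SimpleGraph V) (μ : V → ℝ)
    (x : List V → E) : Prop where
  chain : ∀ l, ¬ l.IsChain G.Adj → x l = 0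
  cap : ∀ (k : List V) (v : V) (l : List V), ∑ u, √(μ u) • x (k ++ v :: u :: v :: l) = 0

variable {G μ} in
theorem IsEssential.cons {E : Type*} [AddCommGroup E] [Module ℝ E] {x : List V → E}
    (h : IsEssential G μ x) (s : V) : IsEssential G μ fun l => x (s :: l) where
  chain l hl := h.chain _ fun h' => hl h'.tail
  cap k := h.cap (s :: k)

variable {G μ} in
/-- The Jones-Wenzl projection fixes the essential functions. -/
theorem IsEssential.sum_jw {E : Type*} [AddCommGroup E] [Module ℝ E] {x : List V → E}
    (h : IsEssential G μ x) (n : ℕ) (p : List V) (hp : p.length = n + 1) :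
    ∑ q ∈ words V (n + 1), jw G β μ n p q • x q = x p := by
  induction n generalizing x p with
  | zero =>
    rw [Finset.sum_eq_single p]
    · simp [jw, hp]
    · intro q _ hq
      simp [jw, hq.symm]
    · intro h'
      exact absurd (mem_words.2 hp) h'
  | succ n ih =>
    rcases p with _ | ⟨u, _ | ⟨a, p⟩⟩
    · simp at hp
    · simp at hp
    rw [sum_words_succ_of_head _ u]
    swap
    · intro v l hv
      rw [jw_eq_zero_of_head G β μ _ _ hv.symm, zero_smul]
    by_cases hua : G.Adj u a
    swap
    · rw [h.chain (u :: a :: p) (by simp [List.isChain_cons_cons, hua]), sum_words_succ]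
      refine Finset.sum_eq_zero fun b _ => Finset.sum_eq_zero fun q _ => ?_
      rw [jw_succ, if_neg (by tauto), zero_smul]
    -- Wenzl's recursion applied to x: the first term is the shorter projection behind the fixed
    -- letter u, and the second contains a cap on the first two edges. If b is not a neighbour of u,
    -- the recursion does not apply, but there x vanishes.
    have h1 : ∀ b q, jw G β μ (n + 1) (u :: a :: p) (u :: b :: q) • x (u :: b :: q) =
        jw G β μ n (a :: p) (b :: q) • x (u :: b :: q) -
          ∑ r ∈ words V n, ((ratio β n)⁻¹ * (√(μ a) / μ u) *
            (if r.head? = some u then jw G β μ n (a :: p) (a :: r) else 0)) •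
            √(μ b) • jw G β μ n (b :: r) (b :: q) • x (u :: b :: q) := by
      intro b q
      by_cases hub : G.Adj u b
      · rw [jw_succ, if_pos ⟨rfl, hua, hub⟩, sub_smul, Finset.mul_sum, Finset.sum_smul]
        congr 1
        refine Finset.sum_congr rfl fun r _ => ?_
        split_ifs
        · simp only [smul_smul]
          congr 1
          ring
        · simp
      · rw [h.chain (u :: b :: q) (by simp [List.isChain_cons_cons, hub])]
        simp
    rw [sum_words_succ]
    simp only [h1, Finset.sum_sub_distrib]
    have hx := h.cons u
    have h2 := ih hx (a :: p) (by simpa using hp)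
    rw [sum_words_succ] at h2
    rw [h2, sub_eq_self]
    have h3 : ∀ b, ∀ r ∈ words V n,
        ∑ q ∈ words V n, jw G β μ n (b :: r) (b :: q) • x (u :: b :: q) = x (u :: b :: r) := by
      intro b r hr
      have := ih hx (b :: r) (by simpa [mem_words] using hr)
      rwa [sum_words_succ_of_head _ b] at this
      intro c l hc
      rw [jw_eq_zero_of_head G β μ _ _ hc.symm, zero_smul]
    have h4 : ∀ b, ∑ q ∈ words V n, ∑ r ∈ words V n, ((ratio β n)⁻¹ * (√(μ a) / μ u) *
            (if r.head? = some u then jw G β μ n (a :: p) (a :: r) else 0)) •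
            √(μ b) • jw G β μ n (b :: r) (b :: q) • x (u :: b :: q) =
        ∑ r ∈ words V n, ((ratio β n)⁻¹ * (√(μ a) / μ u) *
            (if r.head? = some u then jw G β μ n (a :: p) (a :: r) else 0)) •
            √(μ b) • x (u :: b :: r) := by
      intro b
      rw [Finset.sum_comm]
      refine Finset.sum_congr rfl fun r hr => ?_
      rw [← Finset.smul_sum, ← Finset.smul_sum, h3 b r hr]
    simp only [h4]
    -- The shorter projection has been absorbed into x, so the sum over b is now the annihilation of
    -- x at its first corner `u b u`.
    rw [Finset.sum_comm]
    refine Finset.sum_eq_zero fun r _ => ?_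
    rw [← Finset.smul_sum]
    by_cases hr : r.head? = some u
    · obtain ⟨r', rfl⟩ : ∃ r', r = u :: r' := by
        cases r with
        | nil => simp at hr
        | cons c r => exact ⟨r, by simpa using hr⟩
      have := h.cap [] u r'
      simp only [List.nil_append] at this
      rw [this, smul_zero]
    · simp [hr]

end JonesWenzl

/-! ### Idempotence, partial trace and essentiality of the Jones–Wenzl kernel -/

section JonesWenzlRelations

variable {V : Type*} [Fintype V] [DecidableEq V] {G : SimpleGraph V} [DecidableRel G.Adj]
  {β : ℝ} {μ : V → ℝ}

/-- Idempotence: the columns are essential, and the projection fixes essential functions. -/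
theorem jw_mul_jw_of_isEssential {n : ℕ} (h : ∀ q, IsEssential G μ fun p => jw G β μ n p q)
    (p q : List V) :
    ∑ r ∈ words V (n + 1), jw G β μ n p r * jw G β μ n r q = jw G β μ n p q := by
  by_cases hp : p.length = n + 1
  · simpa using (h q).sum_jw β n p hp
  · have : ∀ r, jw G β μ n p r = 0 := fun r => by
      by_contra h'
      exact hp (jw_ne_zero G β μ h').1
    simp [this]

/-- This is P_{n+1}(1 ⊗ P_n) = P_{n+1}: removing the first letter from an essential function leaves
an essential function, which the shorter projection fixes. -/
theorem jw_succ_mul_jw_of_isEssential {n : ℕ}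
    (h : ∀ q, IsEssential G μ fun p => jw G β μ (n + 1) p q) (p q : List V) (u : V) :
    ∑ r ∈ words V (n + 1), jw G β μ (n + 1) p (u :: r) * jw G β μ n r q =
      jw G β μ (n + 1) p (u :: q) := by
  by_cases hq : q.length = n + 1
  · have := ((h p).cons u).sum_jw β n q hq
    simp only [smul_eq_mul] at this
    rw [jw_comm, ← this]
    exact Finset.sum_congr rfl fun r _ => by
      rw [jw_comm G β μ (n + 1) p, jw_comm G β μ n r, mul_comm]
  · have : ∀ r, jw G β μ n r q = 0 := fun r => by
      by_contra h'
      exact hq (jw_ne_zero_right G β μ h').1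
    have h2 : jw G β μ (n + 1) p (u :: q) = 0 := by
      by_contra h'
      have := (jw_ne_zero_right G β μ h').1
      simp at this
      omega
    simp [this, h2]

/-- A fixed-head form of the multiplication rule. -/
theorem sum_jw_cons_mul {n : ℕ} (f : List V → ℝ) (a : V) (p : List V) :
    ∑ r ∈ words V (n + 1), jw G β μ n (a :: p) r * f r =
      ∑ r ∈ words V n, jw G β μ n (a :: p) (a :: r) * f (a :: r) := by
  rw [sum_words_succ_of_head _ a]
  intro b l hb
  rw [jw_eq_zero_of_head G β μ _ _ hb.symm, zero_mul]

/-- The partial trace of the Jones-Wenzl projection over its first vertex. -/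
theorem sum_jw_cons_of_isEssential (hμ : IsPerronFrobenius G β μ) {n : ℕ}
    (h : ∀ q, IsEssential G μ fun p => jw G β μ n p q) (v : V) (p q : List V) :
    ∑ w, μ w / μ v * jw G β μ (n + 1) (w :: v :: p) (w :: v :: q) =
      ratio β (n + 1) * jw G β μ n (v :: p) (v :: q) := by
  have hv := (hμ.pos v).ne'
  have h1 : ∀ w, μ w / μ v * jw G β μ (n + 1) (w :: v :: p) (w :: v :: q) =
      (if G.Adj v w then μ w else 0) * (jw G β μ n (v :: p) (v :: q) / μ v) -
      (ratio β n)⁻¹ * ∑ r ∈ words V n, if r.head? = some w ∧ G.Adj w v then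
          jw G β μ n (v :: p) (v :: r) * jw G β μ n (v :: r) (v :: q) else 0 := by
    intro w
    have hw := (hμ.pos w).ne'
    rw [jw_succ]
    by_cases hvw : G.Adj w v
    · rw [if_pos ⟨rfl, hvw, hvw⟩, if_pos hvw.symm, Real.mul_self_sqrt (hμ.pos v).le]
      simp only [hvw, and_true]
      field_simp
    · simp [hvw, G.adj_comm v w]
  simp only [h1, Finset.sum_sub_distrib, ← Finset.sum_mul, ← Finset.mul_sum]
  rw [hμ.sum_adj, Finset.sum_comm]
  -- Summing over w releases the condition on the head of r, and the cup–cap term becomes P_n P_n =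
  -- P_n. For n = 0 there is no such term, in agreement with the conventions `ratio β 0 = 0` and 0⁻¹
  -- = 0.
  have h2 : (ratio β n)⁻¹ * ∑ r ∈ words V n, ∑ w, (if r.head? = some w ∧ G.Adj w v then
          jw G β μ n (v :: p) (v :: r) * jw G β μ n (v :: r) (v :: q) else 0) =
      (ratio β n)⁻¹ * jw G β μ n (v :: p) (v :: q) := by
    cases n with
    | zero => simp [ratio]
    | succ n =>
      rw [← jw_mul_jw_of_isEssential h, sum_jw_cons_mul]
      congr 1
      refine Finset.sum_congr rfl fun r hr => ?_
      rw [mem_words] at hr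
      cases r with
      | nil => simp at hr
      | cons a r =>
        rw [Finset.sum_eq_single a]
        · by_cases hav : G.Adj a v
          · simp [hav]
          · have : jw G β μ (n + 1) (v :: p) (v :: a :: r) = 0 := by
              by_contra h'
              have := (jw_ne_zero_right G β μ h').2.1
              rw [List.isChain_cons_cons] at this
              exact hav this.1.symm
            simp [this]
        · intro b _ hb
          simp [hb.symm]
        · simp
  rw [h2, ratio]
  field_simp

/-- A cap away from the first corner acts inside the shorter projection, which is essential by
induction. A cap at the first corner turns the cup–cap term into a partial trace; the coefficient in
Wenzl's recursion is exactly the one for which this cancels the first term. Only the ratios strictly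
below n are inverted, so P_{N+1} is still covered when `ratio β (N + 1)` is nonpositive. -/
theorem isEssential_jw (hμ : IsPerronFrobenius G β μ) (n : ℕ)
    (hn : ∀ k, 0 < k → k < n → ratio β k ≠ 0) (q : List V) :
    IsEssential G μ fun p => jw G β μ n p q := by
  induction n using Nat.strong_induction_on generalizing q with
  | _ n ih =>
  have hchain : ∀ l, ¬ l.IsChain G.Adj → jw G β μ n l q = 0 := fun l hl => by
    by_contra h'
    exact hl (jw_ne_zero G β μ h').2.1
  refine ⟨hchain, ?_⟩
  intro k v l
  rcases n with _ | n
  · refine Finset.sum_eq_zero fun u _ => ?_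
    have : jw G β μ 0 (k ++ v :: u :: v :: l) q = 0 := by
      by_contra h'
      have := (jw_ne_zero G β μ h').1
      simp at this
      omega
    rw [this, smul_zero]
  have ih' : ∀ q, IsEssential G μ fun p => jw G β μ n p q :=
    ih n (by omega) fun k hk hkn => hn k hk (by omega)
  rcases q with _ | ⟨v', _ | ⟨b, q⟩⟩
  · refine Finset.sum_eq_zero fun u _ => ?_
    rw [jw_comm]
    rcases k with _ | ⟨s, k⟩ <;> simp [jw]
  · refine Finset.sum_eq_zero fun u _ => ?_
    have : jw G β μ (n + 1) (k ++ v :: u :: v :: l) [v'] = 0 := by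
      by_contra h'
      have := (jw_ne_zero_right G β μ h').1
      simp at this
    rw [this, smul_zero]
  -- A cap beyond the first edge touches only the left argument `c :: f u` of a shorter kernel, and
  -- does so in both terms of the recursion.
  have hcons : ∀ (s c : V) (f : V → List V), (∀ q, ∑ u, √(μ u) * jw G β μ n (c :: f u) q = 0) →
      ∑ u, √(μ u) * jw G β μ (n + 1) (s :: c :: f u) (v' :: b :: q) = 0 := by
    intro s c f hf
    simp only [jw_succ]
    by_cases hc : s = v' ∧ G.Adj s c ∧ G.Adj s b
    · simp only [if_pos hc]
      simp only [mul_sub, Finset.sum_sub_distrib, hf, zero_sub, neg_eq_zero]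
      have : ∀ u, √(μ u) * ((ratio β n)⁻¹ * (√(μ c) * √(μ b) / μ s) *
          ∑ r ∈ words V n, if r.head? = some s then
            jw G β μ n (c :: f u) (c :: r) * jw G β μ n (b :: r) (b :: q) else 0) =
          (ratio β n)⁻¹ * (√(μ c) * √(μ b) / μ s) *
          ∑ r ∈ words V n, (if r.head? = some s then jw G β μ n (b :: r) (b :: q) else 0) *
            (√(μ u) * jw G β μ n (c :: f u) (c :: r)) := by
        intro u
        rw [mul_left_comm, Finset.mul_sum]
        congr 1
        refine Finset.sum_congr rfl fun r _ => ?_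
        split_ifs <;> ring
      simp only [this]
      rw [← Finset.mul_sum, Finset.sum_comm]
      simp only [← Finset.mul_sum, hf, mul_zero, Finset.sum_const_zero]
    · simp [if_neg hc]
  rcases k with _ | ⟨s, _ | ⟨c, k⟩⟩
  · simp only [List.nil_append, smul_eq_mul]
    by_cases hc : v = v' ∧ G.Adj v b
    swap
    · refine Finset.sum_eq_zero fun u _ => ?_
      rw [jw_succ, if_neg (by tauto), mul_zero]
    obtain ⟨rfl, hvb⟩ := hc
    rcases n with _ | n
    · refine Finset.sum_eq_zero fun u _ => ?_
      have : jw G β μ (0 + 1) (v :: u :: v :: l) (v :: b :: q) = 0 := by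
        by_contra h'
        have := (jw_ne_zero G β μ h').1
        simp at this
      rw [this, mul_zero]
    -- The weight of the cap and the square root in the recursion multiply to `μ u`, so the sum over
    -- u in the second term is a partial trace.
    have hterm : ∀ u, √(μ u) * jw G β μ (n + 1 + 1) (v :: u :: v :: l) (v :: b :: q) =
        √(μ u) * jw G β μ (n + 1) (u :: v :: l) (b :: q) -
        (ratio β (n + 1))⁻¹ * √(μ b) * ∑ r ∈ words V n,
          μ u / μ v * jw G β μ (n + 1) (u :: v :: l) (u :: v :: r) *
            jw G β μ (n + 1) (b :: v :: r) (b :: q) := by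
      intro u
      rw [jw_succ]
      by_cases hvu : G.Adj v u
      · rw [if_pos ⟨rfl, hvu, hvb⟩, sum_words_succ_head, mul_sub]
        congr 1
        simp only [Finset.mul_sum]
        refine Finset.sum_congr rfl fun r _ => ?_
        have := Real.mul_self_sqrt (hμ.pos u).le
        linear_combination (ratio β (n + 1))⁻¹ * √(μ b) / μ v *
          jw G β μ (n + 1) (u :: v :: l) (u :: v :: r) *
            jw G β μ (n + 1) (b :: v :: r) (b :: q) * this
      · have : ∀ q, jw G β μ (n + 1) (u :: v :: l) q = 0 := by
          intro q
          by_contra h'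
          have := (jw_ne_zero G β μ h').2.1
          rw [List.isChain_cons_cons] at this
          exact hvu this.1.symm
        simp [hvu, this]
    simp only [hterm, Finset.sum_sub_distrib, ← Finset.mul_sum]
    rw [Finset.sum_comm]
    simp only [← Finset.sum_mul]
    have h1 := ih n (by omega) fun k hk hkn => hn k hk (by omega)
    simp only [sum_jw_cons_of_isEssential hμ h1, mul_assoc, ← Finset.mul_sum]
    rw [inv_mul_eq_div, Finset.sum_eq_single b]
    -- In the first term only u = b survives. The partial trace has left a P_n, which the remaining
    -- P_{n+1} absorbs.
    · have h2 := jw_succ_mul_jw_of_isEssential (fun q => ih' q) (b :: q) (v :: l) b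
      have h3 : ∑ r ∈ words V n, jw G β μ n (v :: l) (v :: r) *
          jw G β μ (n + 1) (b :: v :: r) (b :: q) =
          jw G β μ (n + 1) (b :: v :: l) (b :: q) := by
        rw [← sum_jw_cons_mul (fun r => jw G β μ (n + 1) (b :: r) (b :: q)), jw_comm, ← h2]
        refine Finset.sum_congr rfl fun r _ => ?_
        rw [jw_comm G β μ n, jw_comm G β μ (n + 1), mul_comm]
      rw [h3]
      have := hn (n + 1) (by omega) (by omega)
      field_simp
      ring
    · intro u _ hu
      rw [jw_eq_zero_of_head G β μ _ _ hu, mul_zero]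
    · simp
  · exact hcons s v (fun u => u :: v :: l) fun q => by simpa using (ih' q).cap [] v l
  · exact hcons s c (fun u => k ++ v :: u :: v :: l) fun q => by
      simpa using (ih' q).cap (c :: k) v l

end JonesWenzlRelations

/-! ### Cells, and the largest length of an essential path -/

section Cells

variable {V : Type*} [Fintype V] [DecidableEq V]

/-- Pairs of words of length `n + 1` for some `n ≤ N`. -/
abbrev Label (V : Type*) [Fintype V] [DecidableEq V] (N : ℕ) :=
  Σ n : Fin (N + 1), {p : List V // p ∈ words V (n + 1)} × {p : List V // p ∈ words V (n + 1)}

theorem sum_label {E : Type*} [AddCommMonoid E] (N : ℕ) (f : ℕ → List V → List V → E) :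
    ∑ c : Label V N, f c.1 c.2.1.1 c.2.2.1 =
      ∑ n ∈ Finset.range (N + 1), ∑ p ∈ words V (n + 1), ∑ q ∈ words V (n + 1), f n p q := by
  rw [Fintype.sum_sigma, ← Fin.sum_univ_eq_sum_range (fun n => ∑ p ∈ words V (n + 1),
    ∑ q ∈ words V (n + 1), f n p q)]
  refine Finset.sum_congr rfl fun n _ => ?_
  rw [Fintype.sum_prod_type, ← Finset.sum_coe_sort (words V (n + 1))]
  refine Finset.sum_congr rfl fun p _ => ?_
  rw [← Finset.sum_coe_sort (words V (n + 1))]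

theorem sum_label_eq {E : Type*} [AddCommMonoid E] {N m : ℕ} (hm : m ≤ N)
    (f : ℕ → List V → List V → E) (hf : ∀ n p q, n ≠ m → f n p q = 0) :
    ∑ c : Label V N, f c.1 c.2.1.1 c.2.2.1 =
      ∑ p ∈ words V (m + 1), ∑ q ∈ words V (m + 1), f m p q := by
  rw [sum_label, Finset.sum_eq_single m]
  · intro n _ hn
    exact Finset.sum_eq_zero fun p _ => Finset.sum_eq_zero fun q _ => hf n p q hn
  · intro h
    exact absurd (Finset.mem_range.2 (by omega)) h

/-- Exchange of the two words of a label. -/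
def Label.swap {N : ℕ} (a : Label V N) : Label V N := ⟨a.1, a.2.2, a.2.1⟩

variable (G : SimpleGraph V) [DecidableRel G.Adj] (β : ℝ) (μ : V → ℝ)

/-- The matrix entries of the action of a pair of edges `(w w', v v')` on pairs of essential paths
by prolongation. -/
def rise (w w' v v' : V) (n : ℕ) (p p' q q' : List V) : ℝ :=
  if q.head? = some w' ∧ q'.head? = some v' then
    √(ratio β n)⁻¹ * (√√(μ w) * √√(μ v) / (√√(μ w') * √√(μ v'))) *
      (jw G β μ n p (w :: q) * jw G β μ n p' (v :: q'))
  else 0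

/-- The cell of a pair of edges `(w w', v v')`: a matrix indexed by pairs of paths, the sum of a
prolongation and of an annihilation. -/
def cell (N : ℕ) (w w' v v' : V) : Matrix (Label V N) (Label V N) ℝ := fun a b =>
  rise G β μ w w' v v' a.1 a.2.1.1 a.2.2.1 b.2.1.1 b.2.2.1 +
    rise G β μ w' w v' v b.1 b.2.1.1 b.2.2.1 a.2.1.1 a.2.2.1

/-- The projection onto pairs of essential paths with given starting vertices. -/
def corner (N : ℕ) (w v : V) : Matrix (Label V N) (Label V N) ℝ := fun a b =>
  if a.2.1.1.head? = some w ∧ a.2.2.1.head? = some v then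
    jw G β μ a.1 a.2.1.1 b.2.1.1 * jw G β μ a.1 a.2.2.1 b.2.2.1
  else 0

/-- The hypotheses on `N` under which `N` is the largest length of an essential path. -/
structure IsTop (N : ℕ) : Prop where
  ratio_pos : ∀ k, 0 < k → k ≤ N → 0 < ratio β k
  jw_eq_zero : ∀ p q, jw G β μ (N + 1) p q = 0

variable {G β μ}

/-- A symmetric idempotent has nonnegative diagonal entries, being sums of squares of rows. For the
first N with `ratio β (N + 1) ≤ 0`, the partial trace formula makes a positively weighted sum of
diagonal entries of P_{N+1} nonpositive. So the diagonal of P_{N+1} vanishes, and with it every row.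
-/
theorem IsPerronFrobenius.exists_isTop (hμ : IsPerronFrobenius G β μ) (hβ : β < 2) :
    ∃ N, IsTop G β μ N := by
  obtain ⟨N, hN, hN'⟩ := exists_ratio_nonpos hβ
  refine ⟨N, hN, ?_⟩
  have h1 : ∀ q, IsEssential G μ fun p => jw G β μ N p q :=
    isEssential_jw hμ N fun k hk hkN => (hN k hk hkN.le).ne'
  have h2 : ∀ q, IsEssential G μ fun p => jw G β μ (N + 1) p q :=
    isEssential_jw hμ (N + 1) fun k hk hkN => (hN k hk (by omega)).ne'
  have nonneg : ∀ n, (∀ q, IsEssential G μ fun p => jw G β μ n p q) → ∀ p,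
      0 ≤ jw G β μ n p p := by
    intro n h p
    rw [← jw_mul_jw_of_isEssential h]
    exact Finset.sum_nonneg fun r _ => by rw [jw_comm G β μ n r]; exact mul_self_nonneg _
  have diag : ∀ p, jw G β μ (N + 1) p p = 0 := by
    intro p
    by_contra hp
    rcases p with _ | ⟨u, _ | ⟨v, p⟩⟩
    · simp [jw] at hp
    · simp [jw] at hp
    have h3 := sum_jw_cons_of_isEssential hμ h1 v p p
    have h4 : ∑ w, μ w / μ v * jw G β μ (N + 1) (w :: v :: p) (w :: v :: p) ≤ 0 := by
      rw [h3]
      exact mul_nonpos_of_nonpos_of_nonneg hN' (nonneg N h1 _)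
    have h5 : ∀ w ∈ Finset.univ,
        0 ≤ μ w / μ v * jw G β μ (N + 1) (w :: v :: p) (w :: v :: p) := fun w _ =>
      mul_nonneg (div_nonneg (hμ.pos w).le (hμ.pos v).le) (nonneg _ h2 _)
    have h6 := (Finset.sum_eq_zero_iff_of_nonneg h5).1 (le_antisymm h4 (Finset.sum_nonneg h5)) u
      (Finset.mem_univ _)
    rcases mul_eq_zero.1 h6 with h7 | h7
    · exact (div_pos (hμ.pos u) (hμ.pos v)).ne' h7
    · exact hp h7
  intro p q
  have h3 := jw_mul_jw_of_isEssential h2 p p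
  rw [diag] at h3
  by_contra hpq
  have hq := (jw_ne_zero_right G β μ hpq).1
  have h4 := (Finset.sum_eq_zero_iff_of_nonneg (fun r _ => by
    rw [jw_comm G β μ (N + 1) r]; exact mul_self_nonneg _)).1 h3 q (mem_words.2 hq)
  rw [jw_comm G β μ (N + 1) q, mul_self_eq_zero] at h4
  exact hpq h4

theorem IsTop.isEssential {N n : ℕ} (hN : IsTop G β μ N) (hμ : IsPerronFrobenius G β μ)
    (hn : n ≤ N + 1) (q : List V) : IsEssential G μ fun p => jw G β μ n p q :=
  isEssential_jw hμ n (fun k hk hkn => (hN.ratio_pos k hk (by omega)).ne') q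

theorem IsTop.inv_sqrt_mul_self {N n : ℕ} (hN : IsTop G β μ N) (hn : n ≤ N) :
    √(ratio β n)⁻¹ * √(ratio β n)⁻¹ = (ratio β n)⁻¹ := by
  apply Real.mul_self_sqrt
  rcases Nat.eq_zero_or_pos n with rfl | h
  · simp [ratio]
  · exact (inv_pos.2 (hN.ratio_pos n h hn)).le

theorem mul_div_scale {s t x y z a b : ℝ} (hy : y ≠ 0) :
    s * (x / y) * a * (t * (y / z) * b) = s * t * (x / z) * (a * b) := by
  rw [← div_mul_div_cancel₀ (a := x) (c := z) hy]
  ring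

/-- Prolongation by the creation operator vanishes. -/
theorem IsTop.sum_rise_mul_rise {N : ℕ} (hN : IsTop G β μ N) (hμ : IsPerronFrobenius G β μ)
    (w u w' v : V) (a b : Label V N) :
    ∑ u', √(μ u') / √(μ v) * ∑ c : Label V N,
      rise G β μ w u v u' a.1 a.2.1.1 a.2.2.1 c.2.1.1 c.2.2.1 *
        rise G β μ u w' u' v c.1 c.2.1.1 c.2.2.1 b.2.1.1 b.2.2.1 = 0 := by
  obtain ⟨⟨n, hn⟩, ⟨p, hp⟩, ⟨p', hp'⟩⟩ := a
  obtain ⟨⟨m, hm⟩, ⟨q, hq⟩, ⟨q', hq'⟩⟩ := b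
  simp only [mem_words] at hp hp' hq hq'
  by_cases hnm : n = m + 2
  swap
  · refine Finset.sum_eq_zero fun u' _ => ?_
    rw [Finset.sum_eq_zero, mul_zero]
    rintro ⟨⟨k, hk⟩, ⟨r, hr⟩, ⟨r', hr'⟩⟩ -
    simp only [mem_words] at hr hr'
    by_contra h
    simp only [rise, mul_eq_zero, ite_eq_right_iff, not_or, not_forall] at h
    obtain ⟨⟨-, -, h1, -⟩, ⟨-, -, h2, -⟩⟩ := h
    have h3 := (jw_ne_zero_right G β μ h1).1
    have h4 := (jw_ne_zero_right G β μ h2).1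
    simp at h3 h4
    omega
  subst hnm
  by_cases hh : q.head? = some w' ∧ q'.head? = some v
  swap
  · simp [rise, hh]
  obtain ⟨q', rfl⟩ : ∃ t, q' = v :: t := by
    cases q' with
    | nil => simp at hh
    | cons c t => exact ⟨t, by simpa using hh.2⟩
  -- The fourth roots at the intermediate vertices u and u' cancel. In the second path the
  -- intermediate projection is absorbed, leaving the column of p' at the corner `v u' v`.
  have hterm : ∀ u', ∑ c : Label V N,
      rise G β μ w u v u' (m + 2) p p' c.2.1.1 c.2.2.1 *
        rise G β μ u w' u' v c.1 c.2.1.1 c.2.2.1 q (v :: q') =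
      √(ratio β (m + 2))⁻¹ * √(ratio β (m + 1))⁻¹ *
        (√√(μ w) * √√(μ v) / (√√(μ w') * √√(μ v))) *
        (∑ r ∈ words V (m + 2), jw G β μ (m + 2) p (w :: r) * jw G β μ (m + 1) r (u :: q)) *
        jw G β μ (m + 2) p' (v :: u' :: v :: q') := by
    intro u'
    rw [sum_label_eq (by omega : m + 1 ≤ N) (fun n r r' =>
      rise G β μ w u v u' (m + 2) p p' r r' * rise G β μ u w' u' v n r r' q (v :: q'))]
    · rw [← jw_succ_mul_jw_of_isEssential (fun q => hN.isEssential hμ (by omega) q) p'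
        (u' :: v :: q') v, mul_assoc, Finset.sum_mul_sum, Finset.mul_sum]
      refine Finset.sum_congr rfl fun r _ => ?_
      rw [Finset.mul_sum]
      refine Finset.sum_congr rfl fun r' _ => ?_
      have hu : √√(μ u) ≠ 0 := (Real.sqrt_pos.2 (Real.sqrt_pos.2 (hμ.pos u))).ne'
      have hu' : √√(μ u') ≠ 0 := (Real.sqrt_pos.2 (Real.sqrt_pos.2 (hμ.pos u'))).ne'
      rw [rise, rise, if_pos hh]
      split_ifs with h
      · exact (mul_div_scale (mul_ne_zero hu hu')).trans (by ring)
      · rcases not_and_or.1 h with h | h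
        · have : jw G β μ (m + 1) r (u :: q) = 0 := by
            by_contra h'
            exact h (jw_ne_zero G β μ h').2.2
          simp [this]
        · have : jw G β μ (m + 1) r' (u' :: v :: q') = 0 := by
            by_contra h'
            exact h (jw_ne_zero G β μ h').2.2
          simp [this]
    · intro k r r' hk
      by_contra h
      simp only [rise, mul_eq_zero, ite_eq_right_iff, not_or, not_forall] at h
      obtain ⟨-, ⟨-, -, h2, -⟩⟩ := h
      have h4 := (jw_ne_zero_right G β μ h2).1
      simp at h4 hq
      omega
  simp only [hterm]
  -- The factor of the first path does not depend on u', so the whole sum is an annihilation of an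
  -- essential function.
  have h := (hN.isEssential hμ (by omega : m + 2 ≤ N + 1) p').cap [] v q'
  simp only [List.nil_append, smul_eq_mul] at h
  have h' : ∑ u', √(μ u') * jw G β μ (m + 2) p' (v :: u' :: v :: q') = 0 := by
    simpa only [jw_comm G β μ (m + 2) p'] using h
  have hsum : ∀ c d : ℝ, ∑ u', √(μ u') / d * (c * jw G β μ (m + 2) p' (v :: u' :: v :: q')) =
      c / d * ∑ u', √(μ u') * jw G β μ (m + 2) p' (v :: u' :: v :: q') := by
    intro c d
    rw [Finset.mul_sum]
    exact Finset.sum_congr rfl fun u' _ => by ring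
  rw [hsum, h', mul_zero]

end Cells

/-! ### The exchange relation: cells carry creation to creation -/

section CellRelations

variable {V : Type*} [Fintype V] [DecidableEq V] {G : SimpleGraph V} [DecidableRel G.Adj]
  {β : ℝ} {μ : V → ℝ} {N : ℕ}

/-- Prolongation followed by annihilation passes through length m + 1, where it meets P_{m+1} in
each of the two paths. Truncating the labels at N costs nothing: for m = N there is no intermediate
label on the left, and P_{N+1} = 0 on the right. -/
theorem IsTop.fall_mul_rise (hN : IsTop G β μ N) {m : ℕ} (hm : m ≤ N) (w u w' u' v v' : V)
    {p p' q q' : List V} (hp : p.length = m + 1) :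
    ∑ c : Label V N, rise G β μ u w' u' v' c.1 c.2.1.1 c.2.2.1 p p' *
        rise G β μ u w u' v c.1 c.2.1.1 c.2.2.1 q q' =
      if (p.head? = some w' ∧ p'.head? = some v') ∧ (q.head? = some w ∧ q'.head? = some v) then
        (ratio β (m + 1))⁻¹ * (√√(μ u) * √√(μ u') / (√√(μ w') * √√(μ v')) *
          (√√(μ u) * √√(μ u') / (√√(μ w) * √√(μ v)))) *
          ((∑ r ∈ words V (m + 2), jw G β μ (m + 1) r (u :: p) * jw G β μ (m + 1) r (u :: q)) *
            ∑ r ∈ words V (m + 2), jw G β μ (m + 1) r (u' :: p') * jw G β μ (m + 1) r (u' :: q'))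
      else 0 := by
  split_ifs with h
  swap
  · refine Finset.sum_eq_zero fun c _ => ?_
    rw [rise, rise]
    by_cases h1 : p.head? = some w' ∧ p'.head? = some v'
    · rw [if_neg fun h2 => h ⟨h1, h2⟩, mul_zero]
    · rw [if_neg h1, zero_mul]
  rcases Nat.lt_or_ge m N with hmN | hmN
  · rw [sum_label_eq (by omega : m + 1 ≤ N) (fun n r r' =>
      rise G β μ u w' u' v' n r r' p p' * rise G β μ u w u' v n r r' q q')]
    · rw [Finset.sum_mul_sum, Finset.mul_sum]
      refine Finset.sum_congr rfl fun r _ => ?_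
      rw [Finset.mul_sum]
      refine Finset.sum_congr rfl fun r' _ => ?_
      obtain ⟨s, hs, hs'⟩ : ∃ s, √(ratio β (m + 1))⁻¹ = s ∧ (ratio β (m + 1))⁻¹ = s * s :=
        ⟨_, rfl, (hN.inv_sqrt_mul_self (by omega)).symm⟩
      rw [rise, rise, if_pos h.1, if_pos h.2, hs, hs']
      ring
    · intro k r r' hk
      have : jw G β μ k r (u :: p) = 0 := by
        by_contra h'
        have := (jw_ne_zero_right G β μ h').1
        simp at this
        omega
      rw [rise, this]
      simp
  · obtain rfl : m = N := by omega
    simp only [hN.jw_eq_zero, mul_zero, Finset.sum_const_zero]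
    refine Finset.sum_eq_zero fun c _ => ?_
    have : jw G β μ c.1 c.2.1.1 (u :: p) = 0 := by
      by_contra h'
      have := (jw_ne_zero_right G β μ h').1
      have := c.1.2
      simp at *
      omega
    rw [rise, this]
    simp

/-- Annihilation followed by prolongation passes through length m - 1 and produces, in each of the
two paths, the sum in the cup–cap term of Wenzl's recursion. For m = 0 both sides vanish, as the
empty word has no head. -/
theorem IsTop.rise_mul_fall (hN : IsTop G β μ N) {m k : ℕ} (hm : m ≤ N) (w u w' u' v v' : V)
    {p p' q q' : List V} :
    ∑ c : Label V N, rise G β μ w' u v' u' m p p' c.2.1.1 c.2.2.1 *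
        rise G β μ w u v u' k q q' c.2.1.1 c.2.2.1 =
      if m = k then
        (ratio β m)⁻¹ * (√√(μ w') * √√(μ v') / (√√(μ u) * √√(μ u')) *
          (√√(μ w) * √√(μ v) / (√√(μ u) * √√(μ u')))) *
          ((∑ r ∈ words V m, if r.head? = some u then
              jw G β μ m p (w' :: r) * jw G β μ m q (w :: r) else 0) *
            ∑ r ∈ words V m, if r.head? = some u' then
              jw G β μ m p' (v' :: r) * jw G β μ m q' (v :: r) else 0)
      else 0 := by
  have hz : ∀ (n : ℕ) (p p' : List V) (w v u u' : V) (c : Label V N), (c.1 : ℕ) + 1 ≠ n →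
      rise G β μ w u v u' n p p' c.2.1.1 c.2.2.1 = 0 := by
    rintro n p p' w v u u' ⟨i, ⟨r, hr⟩, r'⟩ hc
    rw [mem_words] at hr
    have : jw G β μ n p (w :: r) = 0 := by
      by_contra h'
      have := (jw_ne_zero_right G β μ h').1
      simp at *
      omega
    simp [rise, this]
  split_ifs with h
  swap
  · refine Finset.sum_eq_zero fun c _ => ?_
    by_cases hc : (c.1 : ℕ) + 1 = m
    · rw [hz k q _ _ _ _ _ c (by omega), mul_zero]
    · rw [hz m p _ _ _ _ _ c (by omega), zero_mul]
  subst h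
  rcases m with _ | m
  · rw [Finset.sum_eq_zero]
    · simp [sum_words_zero]
    · intro c _
      rw [hz 0 p _ _ _ _ _ c (by omega), zero_mul]
  have e : ∑ c : Label V N, rise G β μ w' u v' u' (m + 1) p p' c.2.1.1 c.2.2.1 *
        rise G β μ w u v u' (m + 1) q q' c.2.1.1 c.2.2.1 =
      ∑ c : Label V N, if (c.1 : ℕ) = m then rise G β μ w' u v' u' (m + 1) p p' c.2.1.1 c.2.2.1 *
        rise G β μ w u v u' (m + 1) q q' c.2.1.1 c.2.2.1 else 0 := by
    refine Finset.sum_congr rfl fun c _ => ?_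
    split_ifs with hc
    · rfl
    · rw [hz (m + 1) p _ _ _ _ _ c (by omega), zero_mul]
  rw [e, sum_label_eq (by omega : m ≤ N) (fun n r r' => if n = m then
    rise G β μ w' u v' u' (m + 1) p p' r r' * rise G β μ w u v u' (m + 1) q q' r r' else 0)
    fun n _ _ hn => if_neg hn]
  simp only [if_true]
  rw [Finset.sum_mul_sum, Finset.mul_sum]
  refine Finset.sum_congr rfl fun r _ => ?_
  rw [Finset.mul_sum]
  refine Finset.sum_congr rfl fun r' _ => ?_
  obtain ⟨s, hs, hs'⟩ : ∃ s, √(ratio β (m + 1))⁻¹ = s ∧ (ratio β (m + 1))⁻¹ = s * s :=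
    ⟨_, rfl, (hN.inv_sqrt_mul_self hm).symm⟩
  rw [rise, rise, hs, hs']
  by_cases h1 : r.head? = some u <;> by_cases h2 : r'.head? = some u'
  · rw [if_pos ⟨h1, h2⟩, if_pos ⟨h1, h2⟩, if_pos h1, if_pos h2]
    ring
  · rw [if_neg (fun h => h2 h.2), if_neg h2]
    ring
  · rw [if_neg (fun h => h1 h.1), if_neg h1]
    ring
  · rw [if_neg (fun h => h1 h.1), if_neg h1]
    ring

/-- Wenzl's recursion read backwards, in the shape in which `IsTop.fall_mul_rise` and
`IsTop.rise_mul_fall` produce its two terms. Without the adjacencies that the recursion asks for,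
the cup–cap sum is zero anyway. -/
theorem jw_succ_add (u w w' : V) (m : ℕ) (p q : List V) :
    jw G β μ (m + 1) (u :: w' :: p) (u :: w :: q) + (ratio β m)⁻¹ * (√(μ w') * √(μ w) / μ u) *
        ∑ r ∈ words V m, (if r.head? = some u then
          jw G β μ m (w' :: p) (w' :: r) * jw G β μ m (w :: q) (w :: r) else 0) =
      if w' = w ∧ G.Adj w u then jw G β μ m (w' :: p) (w :: q) else 0 := by
  rw [jw_succ]
  have e : ∀ r, jw G β μ m (w :: q) (w :: r) = jw G β μ m (w :: r) (w :: q) :=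
    fun r => jw_comm _ _ _ _ _ _
  simp only [e]
  by_cases h : G.Adj u w' ∧ G.Adj u w
  · rw [if_pos ⟨trivial, h⟩, sub_add_cancel]
    by_cases h' : w' = w
    · rw [if_pos ⟨h', h.2.symm⟩]
    · rw [if_neg (fun h => h' h.1), jw_eq_zero_of_head G β μ _ _ h']
  · rw [if_neg (fun h' => h h'.2), if_neg, zero_add]
    · rw [Finset.sum_eq_zero, mul_zero]
      intro r _
      split_ifs with hr
      · obtain ⟨r, rfl⟩ : ∃ t, r = u :: t := by
          cases r with
          | nil => simp at hr
          | cons c t => exact ⟨t, by simpa using hr⟩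
        by_contra h'
        rw [mul_eq_zero, not_or] at h'
        have h1 := (jw_ne_zero_right G β μ h'.1).2.1
        have h2 := (jw_ne_zero G β μ h'.2).2.1
        rw [List.isChain_cons_cons] at h1 h2
        exact h ⟨h1.1.symm, h2.1.symm⟩
      · rfl
    · rintro ⟨rfl, h'⟩
      exact h ⟨h'.symm, h'.symm⟩

theorem mul_div_mul_div {u t x y v u₂ t₂ v₂ : ℝ} (hu : u * u = u₂) (ht : t * t = t₂)
    (hv : v * v = v₂) : u * t / (x * v) * (u * t / (y * v)) = u₂ / (x * y) * (t₂ / v₂) := by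
  subst hu ht hv
  rw [div_mul_div_comm, div_mul_div_comm]
  congr 1 <;> ring

theorem mul_div_mul_div' {u t x y v u₂ t₂ v₂ : ℝ} (hv : v * v = v₂) (hu : u * u = u₂)
    (ht : t * t = t₂) : x * v / (u * t) * (y * v / (u * t)) = x * y / u₂ * (v₂ / t₂) := by
  subst hu ht hv
  rw [div_mul_div_comm, div_mul_div_comm]
  congr 1 <;> ring

theorem div_mul_div_sq {x y u x₂ y₂ u₂ : ℝ} (hx : x * x = x₂) (hy : y * y = y₂)
    (hu : u * u = u₂) (x0 : x ≠ 0) (y0 : y ≠ 0) (u0 : u ≠ 0) :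
    u / (x * y) * (x₂ * y₂ / u₂) = x * y / u := by
  subst hx hy hu
  field_simp

/-- The cells map the creation operator to the creation operator. -/
theorem IsTop.sum_cell_mul_cell (hN : IsTop G β μ N) (hμ : IsPerronFrobenius G β μ)
    (w u w' v : V) :
    ∑ u', (√(μ u') / √(μ v)) • (cell G β μ N w' u v u' * cell G β μ N u w u' v) =
      if w' = w ∧ G.Adj w u then (√(μ u) / √(μ w)) • corner G β μ N w v else 0 := by
  have sq : ∀ x, √√(μ x) * √√(μ x) = √(μ x) := fun x => Real.mul_self_sqrt (Real.sqrt_nonneg _)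
  have sq' : ∀ x, √(μ x) * √(μ x) = μ x := fun x => Real.mul_self_sqrt (hμ.pos x).le
  have ne : ∀ x, √√(μ x) ≠ 0 := fun x => (Real.sqrt_pos.2 (Real.sqrt_pos.2 (hμ.pos x))).ne'
  have ne' : ∀ x, √(μ x) ≠ 0 := fun x => (Real.sqrt_pos.2 (hμ.pos x)).ne'
  ext a b
  have split : ∀ u', (cell G β μ N w' u v u' * cell G β μ N u w u' v) a b =
      (∑ c : Label V N, rise G β μ w' u v u' a.1 a.2.1.1 a.2.2.1 c.2.1.1 c.2.2.1 *
        rise G β μ u w u' v c.1 c.2.1.1 c.2.2.1 b.2.1.1 b.2.2.1) +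
      (∑ c : Label V N, rise G β μ u w' u' v c.1 c.2.1.1 c.2.2.1 a.2.1.1 a.2.2.1 *
        rise G β μ u w u' v c.1 c.2.1.1 c.2.2.1 b.2.1.1 b.2.2.1) +
      (∑ c : Label V N, rise G β μ w' u v u' a.1 a.2.1.1 a.2.2.1 c.2.1.1 c.2.2.1 *
        rise G β μ w u v u' b.1 b.2.1.1 b.2.2.1 c.2.1.1 c.2.2.1) +
      (∑ c : Label V N, rise G β μ w u v u' b.1 b.2.1.1 b.2.2.1 c.2.1.1 c.2.2.1 *
        rise G β μ u w' u' v c.1 c.2.1.1 c.2.2.1 a.2.1.1 a.2.2.1) := by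
    intro u'
    rw [Matrix.mul_apply, ← Finset.sum_add_distrib, ← Finset.sum_add_distrib,
      ← Finset.sum_add_distrib]
    refine Finset.sum_congr rfl fun c _ => ?_
    rw [cell, cell]
    ring
  simp only [Matrix.sum_apply, Matrix.smul_apply, smul_eq_mul, split, mul_add,
    Finset.sum_add_distrib]
  -- Two prolongations in a row vanish; two annihilations are the same statement with the labels a
  -- and b exchanged.
  rw [hN.sum_rise_mul_rise hμ w' u w v a b, hN.sum_rise_mul_rise hμ w u w' v b a, zero_add,
    add_zero]
  obtain ⟨⟨n, hn⟩, ⟨p, hp⟩, ⟨p', hp'⟩⟩ := a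
  obtain ⟨⟨m, hm⟩, ⟨q, hq⟩, ⟨q', hq'⟩⟩ := b
  rw [mem_words] at hp hp' hq hq'
  simp only at hp hp' hq hq'
  have hn' : n ≤ N := by omega
  simp only [hN.fall_mul_rise hn' _ _ _ _ _ _ hp, hN.rise_mul_fall hn']
  obtain ⟨x, p, rfl⟩ : ∃ x t, p = x :: t := by
    cases p with
    | nil => simp at hp
    | cons c t => exact ⟨c, t, rfl⟩
  obtain ⟨x', p', rfl⟩ : ∃ x t, p' = x :: t := by
    cases p' with
    | nil => simp at hp'
    | cons c t => exact ⟨c, t, rfl⟩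
  obtain ⟨y, q, rfl⟩ : ∃ x t, q = x :: t := by
    cases q with
    | nil => simp at hq
    | cons c t => exact ⟨c, t, rfl⟩
  obtain ⟨y', q', rfl⟩ : ∃ x t, q' = x :: t := by
    cases q' with
    | nil => simp at hq'
    | cons c t => exact ⟨c, t, rfl⟩
  have hlen : ∀ (k : ℕ) (a b : V) (p q : List V), p.length ≠ q.length →
      jw G β μ k (a :: p) (b :: q) = 0 := by
    intro k a b p q hpq
    by_contra h
    have h1 := (jw_ne_zero G β μ h).1
    have h2 := (jw_ne_zero_right G β μ h).1
    simp only [List.length_cons] at h1 h2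
    omega
  by_cases hh : x' = v ∧ y' = v
  swap
  · have h1 : ∀ r, jw G β μ n (x' :: p') (v :: r) * jw G β μ n (y' :: q') (v :: r) = 0 := by
      intro r
      by_cases hx : x' = v
      · rw [jw_eq_zero_of_head G β μ q' r (fun h => hh ⟨hx, h⟩), mul_zero]
      · rw [jw_eq_zero_of_head G β μ p' r hx, zero_mul]
    have h2 : corner G β μ N w v ⟨⟨n, hn⟩, ⟨x :: p, mem_words.2 hp⟩, ⟨x' :: p', mem_words.2 hp'⟩⟩
        ⟨⟨m, hm⟩, ⟨y :: q, mem_words.2 hq⟩, ⟨y' :: q', mem_words.2 hq'⟩⟩ = 0 := by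
      simp only [corner, List.head?_cons, Option.some.injEq]
      split_ifs with h
      · rw [jw_eq_zero_of_head G β μ p' q' (fun h' => hh ⟨h.2, h'.symm.trans h.2⟩), mul_zero]
      · rfl
    simp only [List.head?_cons, Option.some.injEq, h1]
    rw [Finset.sum_eq_zero, Finset.sum_eq_zero]
    · split_ifs
      · rw [Matrix.smul_apply, h2, smul_zero, add_zero]
      · simp
    · intro u' _
      simp
    · intro u' _
      rw [if_neg (fun h => hh ⟨h.1.2, h.2.2⟩), mul_zero]
  obtain ⟨hx', hy'⟩ := hh
  subst hx'
  subst hy'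
  by_cases hw : x = w' ∧ y = w
  swap
  · have h1 : ∀ r, jw G β μ n (x :: p) (w' :: r) * jw G β μ n (y :: q) (w :: r) = 0 := by
      intro r
      by_cases hx : x = w'
      · rw [jw_eq_zero_of_head G β μ q r (fun h => hw ⟨hx, h⟩), mul_zero]
      · rw [jw_eq_zero_of_head G β μ p r hx, zero_mul]
    simp only [List.head?_cons, Option.some.injEq, h1]
    rw [Finset.sum_eq_zero, Finset.sum_eq_zero]
    · split_ifs with h3
      · obtain ⟨rfl, h3⟩ := h3
        simp only [Matrix.smul_apply, corner, List.head?_cons, Option.some.injEq]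
        split_ifs with h
        · rw [jw_eq_zero_of_head G β μ p q (fun h' => hw ⟨h.1, h'.symm.trans h.1⟩)]
          simp
        · simp
      · simp
    · intro u' _
      simp
    · intro u' _
      rw [if_neg (fun h => hw ⟨h.1.1, h.2.1⟩), mul_zero]
  obtain ⟨hx, hy⟩ := hw
  subst hx
  subst hy
  have hess : ∀ q, IsEssential G μ fun p => jw G β μ (n + 1) p q :=
    fun q => hN.isEssential hμ (by omega) q
  have hess' : ∀ q, IsEssential G μ fun p => jw G β μ n p q :=
    fun q => hN.isEssential hμ (by omega) q
  have hmul : ∀ p q, ∑ r ∈ words V (n + 2), jw G β μ (n + 1) r p * jw G β μ (n + 1) r q =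
      jw G β μ (n + 1) p q := by
    intro p q
    rw [← jw_mul_jw_of_isEssential hess]
    exact Finset.sum_congr rfl fun r _ => by rw [jw_comm G β μ _ r p]
  simp only [List.head?_cons, and_self, if_true, hmul]
  have hmul' : ∀ p q, ∑ r ∈ words V (n + 1), jw G β μ n p r * jw G β μ n q r =
      jw G β μ n p q := by
    intro p q
    rw [← jw_mul_jw_of_isEssential hess']
    exact Finset.sum_congr rfl fun r _ => by rw [jw_comm G β μ _ q r]
  by_cases hnm : n = m
  swap
  · have hpq : p.length ≠ q.length := by
      simp only [List.length_cons] at hp hq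
      omega
    rw [Finset.sum_eq_zero, Finset.sum_eq_zero]
    · split_ifs
      · simp [corner, hlen n x y p q hpq]
      · simp
    · intro u' _
      rw [if_neg hnm, mul_zero]
    · intro u' _
      rw [hlen (n + 1) u u _ _ (by simpa using hpq), zero_mul, mul_zero, mul_zero]
  subst hnm
  simp only [if_true]
  set A := jw G β μ (n + 1) (u :: x :: p) (u :: y :: q) with hA
  set Z := ∑ r ∈ words V n, if r.head? = some u then
    jw G β μ n (x :: p) (x :: r) * jw G β μ n (y :: q) (y :: r) else 0 with hZ
  set J := jw G β μ n (y' :: p') (y' :: q') with hJ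
  -- The sum over u' is the partial trace of P_{n+1} in the second path, and its value `ratio β (n +
  -- 1)` cancels the normalisation of the cells. At n = N this ratio may be zero and cannot be
  -- cancelled, but there A = 0.
  have e1 : ∑ u', √(μ u') / √(μ y') * ((ratio β (n + 1))⁻¹ *
      (√√(μ u) * √√(μ u') / (√√(μ x) * √√(μ y')) *
        (√√(μ u) * √√(μ u') / (√√(μ y) * √√(μ y')))) *
      (A * jw G β μ (n + 1) (u' :: y' :: p') (u' :: y' :: q'))) =
      √(μ u) / (√√(μ x) * √√(μ y)) * A * J := by
    have : ∀ u', √(μ u') / √(μ y') * ((ratio β (n + 1))⁻¹ *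
      (√√(μ u) * √√(μ u') / (√√(μ x) * √√(μ y')) *
        (√√(μ u) * √√(μ u') / (√√(μ y) * √√(μ y')))) *
      (A * jw G β μ (n + 1) (u' :: y' :: p') (u' :: y' :: q'))) =
      (ratio β (n + 1))⁻¹ * (√(μ u) / (√√(μ x) * √√(μ y))) * A * (μ u' / μ y' *
        jw G β μ (n + 1) (u' :: y' :: p') (u' :: y' :: q')) := by
      intro u'
      have h1 : √√(μ u) * √√(μ u') / (√√(μ x) * √√(μ y')) *
        (√√(μ u) * √√(μ u') / (√√(μ y) * √√(μ y'))) =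
        √(μ u) / (√√(μ x) * √√(μ y)) * (√(μ u') / √(μ y')) :=
        mul_div_mul_div (sq u) (sq u') (sq y')
      have h3 : √(μ u') / √(μ y') * (√(μ u') / √(μ y')) = μ u' / μ y' := by
        rw [div_mul_div_comm, sq', sq']
      rw [h1, ← h3]
      ring
    rw [Finset.sum_congr rfl fun u' _ => this u', ← Finset.mul_sum,
      sum_jw_cons_of_isEssential hμ hess']
    rcases Nat.lt_or_ge n N with hnN | hnN
    · have := (hN.ratio_pos (n + 1) (by omega) (by omega)).ne'
      rw [← hJ]
      field_simp
    · obtain rfl : n = N := by omega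
      rw [hA, hN.jw_eq_zero]
      ring
  -- In the second path the weights depending on u' cancel, and the sum over u' leaves P_n P_n =
  -- P_n. The first path keeps the cup–cap sum Z.
  have e2 : ∑ u', √(μ u') / √(μ y') * ((ratio β n)⁻¹ *
      (√√(μ x) * √√(μ y') / (√√(μ u) * √√(μ u')) *
        (√√(μ y) * √√(μ y') / (√√(μ u) * √√(μ u')))) *
      (Z * ∑ r ∈ words V n, if r.head? = some u' then
        jw G β μ n (y' :: p') (y' :: r) * jw G β μ n (y' :: q') (y' :: r) else 0)) =
      (ratio β n)⁻¹ * (√√(μ x) * √√(μ y) / √(μ u)) * Z * J := by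
    have : ∀ u', √(μ u') / √(μ y') * ((ratio β n)⁻¹ *
      (√√(μ x) * √√(μ y') / (√√(μ u) * √√(μ u')) *
        (√√(μ y) * √√(μ y') / (√√(μ u) * √√(μ u')))) *
      (Z * ∑ r ∈ words V n, if r.head? = some u' then
        jw G β μ n (y' :: p') (y' :: r) * jw G β μ n (y' :: q') (y' :: r) else 0)) =
      (ratio β n)⁻¹ * (√√(μ x) * √√(μ y) / √(μ u)) * Z *
        (∑ r ∈ words V n, if r.head? = some u' then
        jw G β μ n (y' :: p') (y' :: r) * jw G β μ n (y' :: q') (y' :: r) else 0) := by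
      intro u'
      have h1 : √(μ u') / √(μ y') * (√√(μ x) * √√(μ y') / (√√(μ u) * √√(μ u')) *
        (√√(μ y) * √√(μ y') / (√√(μ u) * √√(μ u')))) =
        √√(μ x) * √√(μ y) / √(μ u) := by
        have h2 : √√(μ x) * √√(μ y') / (√√(μ u) * √√(μ u')) *
          (√√(μ y) * √√(μ y') / (√√(μ u) * √√(μ u'))) =
          √√(μ x) * √√(μ y) / √(μ u) * (√(μ y') / √(μ u')) :=
          mul_div_mul_div' (sq y') (sq u) (sq u')
        rw [h2, mul_comm, mul_assoc, div_mul_div_cancel₀ (ne' u'), div_self (ne' y'), mul_one]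
      rw [← h1]
      ring
    rw [Finset.sum_congr rfl fun u' _ => this u', ← Finset.mul_sum, Finset.sum_comm]
    rcases n with _ | n
    · simp [ratio]
    · congr 1
      rw [hJ, ← hmul' (y' :: p'), sum_jw_cons_mul]
      refine Finset.sum_congr rfl fun r hr => ?_
      rw [mem_words] at hr
      obtain ⟨c, r, rfl⟩ : ∃ x t, r = x :: t := by
        cases r with
        | nil => simp at hr
        | cons c t => exact ⟨c, t, rfl⟩
      simp
  rw [e1, e2]
  -- Up to a common factor, the two contributions are P_{n+1} and the cup–cap term of the first
  -- path; together they make 1 ⊗ P_n.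
  have e3 := jw_succ_add (G := G) (β := β) (μ := μ) u y x n p q
  rw [← hA, ← hZ] at e3
  have h4 : √(μ u) / (√√(μ x) * √√(μ y)) * ((ratio β n)⁻¹ * (√(μ x) * √(μ y) / μ u) * Z) =
      (ratio β n)⁻¹ * (√√(μ x) * √√(μ y) / √(μ u)) * Z := by
    have : √(μ u) / (√√(μ x) * √√(μ y)) * (√(μ x) * √(μ y) / μ u) =
        √√(μ x) * √√(μ y) / √(μ u) := by
      exact div_mul_div_sq (sq x) (sq y) (sq' u) (ne x) (ne y) (ne' u)
    rw [← this]
    ring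
  rw [← h4, ← add_mul, ← mul_add, e3]
  split_ifs with h
  · obtain ⟨rfl, h⟩ := h
    rw [sq, Matrix.smul_apply, corner]
    simp only [List.head?_cons, and_self, if_true, smul_eq_mul]
    rw [mul_assoc]
  · simp

end CellRelations

/-! ### Transport matrices along pairs of paths -/

section Transport

variable {V : Type*} [Fintype V] [DecidableEq V]

theorem sum_label_words {E : Type*} [AddCommMonoid E] {N m : ℕ} (hm : m ≤ N)
    (f : List V → List V → E) (hf : ∀ p q, p.length ≠ m + 1 → f p q = 0) :
    ∑ c : Label V N, f c.2.1.1 c.2.2.1 =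
      ∑ p ∈ words V (m + 1), ∑ q ∈ words V (m + 1), f p q := by
  have e : ∑ c : Label V N, f c.2.1.1 c.2.2.1 =
      ∑ c : Label V N, if (c.1 : ℕ) = m then f c.2.1.1 c.2.2.1 else 0 := by
    refine Finset.sum_congr rfl fun c _ => ?_
    split_ifs with hc
    · rfl
    · have := mem_words.1 c.2.1.2
      exact hf _ _ (by omega)
  rw [e, sum_label_eq hm (fun n p q => if n = m then f p q else 0) fun n _ _ hn => if_neg hn]
  simp

variable {G : SimpleGraph V} [DecidableRel G.Adj] {β : ℝ} {μ : V → ℝ} {N : ℕ}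

theorem jw_eq_zero_of_length {n : ℕ} {p q : List V} (h : p.length ≠ n + 1) :
    jw G β μ n p q = 0 := by
  by_contra h'
  exact h (jw_ne_zero G β μ h').1

theorem Label.length_fst (a : Label V N) : a.2.1.1.length = a.1 + 1 := mem_words.1 a.2.1.2

theorem Label.length_snd (a : Label V N) : a.2.2.1.length = a.1 + 1 := mem_words.1 a.2.2.2

theorem Label.le (a : Label V N) : (a.1 : ℕ) ≤ N := Nat.lt_succ_iff.1 a.1.2

theorem cell_transpose (w w' v v' : V) :
    (cell G β μ N w w' v v').transpose = cell G β μ N w' w v' v := by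
  ext a b
  rw [Matrix.transpose_apply, cell, cell, add_comm]

theorem corner_transpose (w v : V) :
    (corner G β μ N w v).transpose = corner G β μ N w v := by
  ext a b
  rw [Matrix.transpose_apply, corner, corner, jw_comm G β μ b.1 b.2.1.1,
    jw_comm G β μ b.1 b.2.2.1]
  by_cases hab : (a.1 : ℕ) = b.1
  · simp only [hab]
    by_cases h1 : jw G β μ b.1 a.2.1.1 b.2.1.1 = 0
    · simp [h1]
    by_cases h2 : jw G β μ b.1 a.2.2.1 b.2.2.1 = 0
    · simp [h2]
    rw [(jw_ne_zero G β μ h1).2.2, (jw_ne_zero G β μ h2).2.2]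
  · rw [jw_eq_zero_of_length (n := b.1) (p := a.2.1.1) (by rw [a.length_fst]; omega),
      jw_comm G β μ a.1, jw_eq_zero_of_length (n := a.1) (p := b.2.1.1)
      (by rw [b.length_fst]; omega)]
    simp

theorem cell_swap (w w' v v' : V) :
    (cell G β μ N w w' v v').submatrix Label.swap Label.swap = cell G β μ N v v' w w' := by
  have h : ∀ (w w' v v' : V) (n : ℕ) (p p' q q' : List V),
      rise G β μ w w' v v' n p p' q q' = rise G β μ v v' w w' n p' p q' q := by
    intro w w' v v' n p p' q q'
    rw [rise, rise]
    refine if_congr and_comm ?_ rfl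
    rw [mul_comm √√(μ w), mul_comm √√(μ w'), mul_comm (jw _ _ _ _ _ _)]
  ext a b
  rw [Matrix.submatrix_apply, cell, cell]
  exact congrArg₂ _ (h _ _ _ _ _ _ _ _ _) (h _ _ _ _ _ _ _ _ _)

theorem corner_swap (w v : V) :
    (corner G β μ N w v).submatrix Label.swap Label.swap = corner G β μ N v w := by
  ext a b
  rw [Matrix.submatrix_apply, corner, corner]
  exact if_congr and_comm (mul_comm _ _) rfl

theorem Label.swap_swap (a : Label V N) : a.swap.swap = a := rfl

/-- The exchange of the two words as a permutation of the labels. -/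
def Label.swapEquiv : Label V N ≃ Label V N := ⟨Label.swap, Label.swap, swap_swap, swap_swap⟩

theorem mul_swap (A B : Matrix (Label V N) (Label V N) ℝ) :
    (A * B).submatrix Label.swap Label.swap =
      A.submatrix Label.swap Label.swap * B.submatrix Label.swap Label.swap :=
  (Matrix.submatrix_mul_equiv A B Label.swap Label.swapEquiv Label.swap).symm

theorem cell_eq_zero_left {w w' : V} (h : ¬ G.Adj w w') (v v' : V) :
    cell G β μ N w w' v v' = 0 := by
  have key : ∀ {w w' : V}, ¬ G.Adj w w' → ∀ (v v' : V) (n : ℕ) (p p' q q' : List V),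
      rise G β μ w w' v v' n p p' q q' = 0 := by
    intro w w' h v v' n p p' q q'
    rw [rise]
    split_ifs with hq
    · have : jw G β μ n p (w :: q) = 0 := by
        by_contra h'
        have h1 := (jw_ne_zero_right G β μ h').2.1
        cases q with
        | nil => simp at hq
        | cons c q =>
          simp only [List.head?_cons, Option.some.injEq] at hq
          rw [List.isChain_cons_cons, hq.1] at h1
          exact h h1.1
      rw [this, zero_mul, mul_zero]
    · rfl
  ext a b
  rw [cell, key h, key (fun h' => h h'.symm), add_zero]
  rfl

theorem cell_eq_zero_right (w w' : V) {v v' : V} (h : ¬ G.Adj v v') :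
    cell G β μ N w w' v v' = 0 := by
  rw [← cell_swap, cell_eq_zero_left h]
  rfl

theorem IsTop.corner_mul_corner (hN : IsTop G β μ N) (hμ : IsPerronFrobenius G β μ)
    (w v w' v' : V) : corner G β μ N w v * corner G β μ N w' v' =
      if w = w' ∧ v = v' then corner G β μ N w v else 0 := by
  ext a b
  have hess : ∀ q, IsEssential G μ fun p => jw G β μ a.1 p q :=
    fun q => hN.isEssential hμ (by have := a.le; omega) q
  rw [Matrix.mul_apply]
  have e : ∀ c : Label V N, corner G β μ N w v a c * corner G β μ N w' v' c b =
      if (w = w' ∧ v = v') ∧ (a.2.1.1.head? = some w ∧ a.2.2.1.head? = some v) then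
        (jw G β μ a.1 a.2.1.1 c.2.1.1 * jw G β μ a.1 c.2.1.1 b.2.1.1) *
          (jw G β μ a.1 a.2.2.1 c.2.2.1 * jw G β μ a.1 c.2.2.1 b.2.2.1) else 0 := by
    intro c
    rw [corner, corner]
    by_cases h1 : jw G β μ a.1 a.2.1.1 c.2.1.1 = 0
    · simp [h1]
    by_cases h2 : jw G β μ a.1 a.2.2.1 c.2.2.1 = 0
    · simp [h2]
    have hc : (c.1 : ℕ) = a.1 := by
      have := (jw_ne_zero_right G β μ h1).1
      rw [c.length_fst] at this
      omega
    simp only [hc]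
    rw [← (jw_ne_zero G β μ h1).2.2, ← (jw_ne_zero G β μ h2).2.2]
    by_cases h3 : a.2.1.1.head? = some w ∧ a.2.2.1.head? = some v
    · rw [h3.1, h3.2]
      simp only [Option.some.injEq, and_self, and_true, if_true]
      split_ifs <;> ring
    · simp [h3]
  rw [Finset.sum_congr rfl fun c _ => e c]
  by_cases h : (w = w' ∧ v = v') ∧ (a.2.1.1.head? = some w ∧ a.2.2.1.head? = some v)
  · simp only [if_pos h, if_pos h.1]
    rw [sum_label_words a.le (fun r r' => (jw G β μ a.1 a.2.1.1 r * jw G β μ a.1 r b.2.1.1) *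
          (jw G β μ a.1 a.2.2.1 r' * jw G β μ a.1 r' b.2.2.1)), ← Finset.sum_mul_sum,
      jw_mul_jw_of_isEssential hess, jw_mul_jw_of_isEssential hess, corner, if_pos h.2]
    intro p q hp
    rw [jw_eq_zero_of_length hp]
    ring
  · simp only [if_neg h]
    rw [Finset.sum_const_zero]
    split_ifs with h1
    · rw [corner, if_neg fun h2 => h ⟨h1, h2⟩]
    · rfl

/-- For the prolongation this is idempotence of P_n; for the annihilation it is the absorption
P_{n+1}(1 ⊗ P_n) = P_{n+1}. The corners thereby act as units at the vertices of a product of cells.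
-/
theorem IsTop.corner_mul_cell (hN : IsTop G β μ N) (hμ : IsPerronFrobenius G β μ)
    (w w' v v' : V) :
    corner G β μ N w v * cell G β μ N w w' v v' = cell G β μ N w w' v v' := by
  ext a b
  have hess : ∀ q, IsEssential G μ fun p => jw G β μ a.1 p q :=
    fun q => hN.isEssential hμ (by have := a.le; omega) q
  have hess' : ∀ q, IsEssential G μ fun p => jw G β μ (a.1 + 1) p q :=
    fun q => hN.isEssential hμ (by have := a.le; omega) q
  rw [Matrix.mul_apply]
  simp only [cell, mul_add, Finset.sum_add_distrib]
  congr 1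
  · have e : ∀ c : Label V N, corner G β μ N w v a c *
        rise G β μ w w' v v' c.1 c.2.1.1 c.2.2.1 b.2.1.1 b.2.2.1 =
      if b.2.1.1.head? = some w' ∧ b.2.2.1.head? = some v' then
        √(ratio β a.1)⁻¹ * (√√(μ w) * √√(μ v) / (√√(μ w') * √√(μ v'))) *
        ((jw G β μ a.1 a.2.1.1 c.2.1.1 * jw G β μ a.1 c.2.1.1 (w :: b.2.1.1)) *
          (jw G β μ a.1 a.2.2.1 c.2.2.1 * jw G β μ a.1 c.2.2.1 (v :: b.2.2.1))) else 0 := by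
      intro c
      rw [corner, rise]
      by_cases hc : (c.1 : ℕ) = a.1
      swap
      · have : jw G β μ a.1 a.2.1.1 c.2.1.1 = 0 := by
          rw [jw_comm]
          exact jw_eq_zero_of_length (by rw [c.length_fst]; omega)
        simp [this]
      simp only [hc]
      by_cases h1 : jw G β μ a.1 a.2.1.1 c.2.1.1 * jw G β μ a.1 c.2.1.1 (w :: b.2.1.1) = 0
      · rw [h1]
        rcases mul_eq_zero.1 h1 with h1 | h1 <;> simp [h1]
      by_cases h2 : jw G β μ a.1 a.2.2.1 c.2.2.1 * jw G β μ a.1 c.2.2.1 (v :: b.2.2.1) = 0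
      · rw [h2]
        rcases mul_eq_zero.1 h2 with h2 | h2 <;> simp [h2]
      rw [mul_eq_zero, not_or] at h1 h2
      rw [if_pos ⟨(jw_ne_zero G β μ h1.1).2.2.trans (jw_ne_zero G β μ h1.2).2.2,
        (jw_ne_zero G β μ h2.1).2.2.trans (jw_ne_zero G β μ h2.2).2.2⟩]
      split_ifs <;> ring
    rw [Finset.sum_congr rfl fun c _ => e c, rise]
    split_ifs
    · rw [← Finset.mul_sum, sum_label_words a.le (fun r r' =>
        (jw G β μ a.1 a.2.1.1 r * jw G β μ a.1 r (w :: b.2.1.1)) *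
          (jw G β μ a.1 a.2.2.1 r' * jw G β μ a.1 r' (v :: b.2.2.1))), ← Finset.sum_mul_sum,
        jw_mul_jw_of_isEssential hess, jw_mul_jw_of_isEssential hess]
      intro p q hp
      rw [jw_eq_zero_of_length (q := w :: b.2.1.1) hp]
      ring
    · simp
  · have hz : (b.1 : ℕ) ≠ a.1 + 1 → ∀ c : Label V N, (c.1 : ℕ) = a.1 →
        rise G β μ w' w v' v b.1 b.2.1.1 b.2.2.1 c.2.1.1 c.2.2.1 = 0 := by
      intro hb c hc
      rw [rise, jw_comm, jw_eq_zero_of_length]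
      · simp
      · rw [List.length_cons, c.length_fst]
        omega
    have hc : ∀ c : Label V N, (c.1 : ℕ) ≠ a.1 → corner G β μ N w v a c = 0 := by
      intro c hc
      rw [corner, jw_comm, jw_eq_zero_of_length (by rw [c.length_fst]; omega)]
      simp
    by_cases hb : (b.1 : ℕ) = a.1 + 1
    swap
    · rw [hz hb a rfl]
      refine Finset.sum_eq_zero fun c _ => ?_
      by_cases h : (c.1 : ℕ) = a.1
      · rw [hz hb c h, mul_zero]
      · rw [hc c h, zero_mul]
    have e : ∀ c : Label V N, corner G β μ N w v a c *
        rise G β μ w' w v' v b.1 b.2.1.1 b.2.2.1 c.2.1.1 c.2.2.1 =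
      if a.2.1.1.head? = some w ∧ a.2.2.1.head? = some v then
        √(ratio β b.1)⁻¹ * (√√(μ w') * √√(μ v') / (√√(μ w) * √√(μ v))) *
        ((jw G β μ (a.1 + 1) b.2.1.1 (w' :: c.2.1.1) * jw G β μ a.1 c.2.1.1 a.2.1.1) *
          (jw G β μ (a.1 + 1) b.2.2.1 (v' :: c.2.2.1) * jw G β μ a.1 c.2.2.1 a.2.2.1)) else 0 := by
      intro c
      rw [corner, rise, jw_comm G β μ a.1 a.2.1.1, jw_comm G β μ a.1 a.2.2.1]
      simp only [← hb]
      by_cases h1 : jw G β μ a.1 c.2.1.1 a.2.1.1 = 0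
      · simp [h1]
      by_cases h2 : jw G β μ a.1 c.2.2.1 a.2.2.1 = 0
      · simp [h2]
      rw [(jw_ne_zero G β μ h1).2.2, (jw_ne_zero G β μ h2).2.2]
      split_ifs <;> ring
    rw [Finset.sum_congr rfl fun c _ => e c, rise]
    split_ifs
    · rw [← Finset.mul_sum, sum_label_words a.le (fun r r' =>
        (jw G β μ (a.1 + 1) b.2.1.1 (w' :: r) * jw G β μ a.1 r a.2.1.1) *
          (jw G β μ (a.1 + 1) b.2.2.1 (v' :: r') * jw G β μ a.1 r' a.2.2.1)),
        ← Finset.sum_mul_sum, jw_succ_mul_jw_of_isEssential hess',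
        jw_succ_mul_jw_of_isEssential hess']
      · simp only [hb]
      intro p q hp
      rw [jw_eq_zero_of_length (q := a.2.1.1) hp]
      ring
    · simp

theorem IsTop.cell_mul_corner (hN : IsTop G β μ N) (hμ : IsPerronFrobenius G β μ)
    (w w' v v' : V) :
    cell G β μ N w w' v v' * corner G β μ N w' v' = cell G β μ N w w' v v' := by
  have := congrArg Matrix.transpose (hN.corner_mul_cell hμ w' w v' v)
  rwa [Matrix.transpose_mul, cell_transpose, corner_transpose] at this

/-- The second form of the exchange relation for cells. -/
theorem IsTop.sum_cell_mul_cell' (hN : IsTop G β μ N) (hμ : IsPerronFrobenius G β μ)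
    (w v v' u' : V) :
    ∑ u, (√(μ u) / √(μ w)) • (cell G β μ N w u v' u' * cell G β μ N u w u' v) =
      if v' = v ∧ G.Adj v u' then (√(μ u') / √(μ v)) • corner G β μ N w v else 0 := by
  have h := congrArg (fun A => A.submatrix Label.swap Label.swap)
    (hN.sum_cell_mul_cell hμ v u' v' w)
  -- Exchanging the two words of every label interchanges the two edges of a cell and reduces this
  -- relation to the first one.
  have e : ∀ u, (√(μ u) / √(μ w)) • (cell G β μ N w u v' u' * cell G β μ N u w u' v) =
      ((√(μ u) / √(μ w)) • (cell G β μ N v' u' w u * cell G β μ N u' v u w)).submatrix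
        Label.swap Label.swap := by
    intro u
    rw [Matrix.submatrix_smul, Pi.smul_apply, Pi.smul_apply, mul_swap, cell_swap, cell_swap]
  rw [Finset.sum_congr rfl fun u _ => e u]
  have e2 : ∀ f : V → Matrix (Label V N) (Label V N) ℝ,
      ∑ u, (f u).submatrix Label.swap Label.swap =
        (∑ u, f u).submatrix Label.swap Label.swap := by
    intro f
    ext a b
    simp [Matrix.sum_apply]
  rw [e2]
  refine h.trans ?_
  split_ifs
  · rw [← corner_swap v w]
    rfl
  · rfl

variable (G β μ N) in
/-- The transport matrix of a pair of paths of equal length: the product of the cells of its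
edges. -/
def transport : List V → List V → Matrix (Label V N) (Label V N) ℝ
  | [w], [v] => corner G β μ N w v
  | w :: w' :: l, v :: v' :: k => cell G β μ N w w' v v' * transport (w' :: l) (v' :: k)
  | _, _ => 0

theorem transport_singleton (w v : V) : transport G β μ N [w] [v] = corner G β μ N w v := by
  rw [transport]

theorem transport_cons_cons (w w' v v' : V) (l k : List V) :
    transport G β μ N (w :: w' :: l) (v :: v' :: k) =
      cell G β μ N w w' v v' * transport G β μ N (w' :: l) (v' :: k) := by
  rw [transport]

theorem transport_eq_zero_of_length {l k : List V} (h : l.length ≠ k.length) :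
    transport G β μ N l k = 0 := by
  induction l generalizing k with
  | nil => rw [transport] <;> simp
  | cons w l ih =>
    rcases l with _ | ⟨w', l⟩ <;> rcases k with _ | ⟨v, _ | ⟨v', k⟩⟩ <;> try (simp [transport])
    · simp at h
    · rw [ih (by simpa using h), mul_zero]

theorem transport_nil_left (k : List V) : transport G β μ N [] k = 0 := by
  rw [transport] <;> simp

theorem transport_eq_zero_left {l : List V} (h : ¬ l.IsChain G.Adj) (k : List V) :
    transport G β μ N l k = 0 := by
  induction l generalizing k with
  | nil => simp at h
  | cons w l ih =>
    rcases l with _ | ⟨w', l⟩ <;> rcases k with _ | ⟨v, _ | ⟨v', k⟩⟩ <;> try (simp [transport])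
    · simp at h
    · rw [List.isChain_cons_cons, not_and_or] at h
      rcases h with h | h
      · rw [cell_eq_zero_left h, zero_mul]
      · rw [ih h, mul_zero]

theorem transport_swap (l k : List V) :
    (transport G β μ N l k).submatrix Label.swap Label.swap = transport G β μ N k l := by
  induction l generalizing k with
  | nil => rcases k with _ | ⟨v, _ | ⟨v', k⟩⟩ <;> simp [transport, Matrix.submatrix_zero]
  | cons w l ih =>
    rcases l with _ | ⟨w', l⟩ <;> rcases k with _ | ⟨v, _ | ⟨v', k⟩⟩ <;>
      try simp [transport, Matrix.submatrix_zero, corner_swap]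
    rw [mul_swap, cell_swap, ih]

theorem transport_eq_zero_right (l : List V) {k : List V} (h : ¬ k.IsChain G.Adj) :
    transport G β μ N l k = 0 := by
  rw [← transport_swap, transport_eq_zero_left h]
  rfl

theorem IsTop.corner_mul_transport (hN : IsTop G β μ N) (hμ : IsPerronFrobenius G β μ)
    (w v w' v' : V) (l k : List V) :
    corner G β μ N w v * transport G β μ N (w' :: l) (v' :: k) =
      if w = w' ∧ v = v' then transport G β μ N (w' :: l) (v' :: k) else 0 := by
  rcases l with _ | ⟨x, l⟩ <;> rcases k with _ | ⟨y, k⟩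
  · rw [transport_singleton, hN.corner_mul_corner hμ]
    split_ifs with h
    · rw [h.1, h.2]
    · rfl
  · simp [transport]
  · simp [transport]
  · rw [transport_cons_cons, ← mul_assoc, ← hN.corner_mul_cell hμ w' x v' y, ← mul_assoc,
      hN.corner_mul_corner hμ]
    split_ifs with h
    · rw [h.1, h.2]
    · simp

/-- Cutting at a pair of vertices inserts a corner, which the transport starting there absorbs. This
becomes the continuity axiom. -/
theorem IsTop.transport_append (hN : IsTop G β μ N) (hμ : IsPerronFrobenius G β μ)
    (w v : V) {x y : List V} (h : x.length = y.length) (l k : List V) :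
    transport G β μ N (x ++ w :: l) (y ++ v :: k) =
      transport G β μ N (x ++ [w]) (y ++ [v]) * transport G β μ N (w :: l) (v :: k) := by
  induction x generalizing y with
  | nil =>
    obtain rfl : y = [] := List.length_eq_zero_iff.1 h.symm
    simp [transport_singleton, hN.corner_mul_transport hμ]
  | cons s x ih =>
    rcases y with _ | ⟨t, y⟩
    · simp at h
    have h' : x.length = y.length := by simpa using h
    rcases x with _ | ⟨s', x⟩ <;> rcases y with _ | ⟨t', y⟩
    · simp [transport_cons_cons, transport_singleton, hN.corner_mul_transport hμ, mul_assoc]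
    · simp at h'
    · simp at h'
    · have := ih h'
      simp only [List.cons_append] at this ⊢
      rw [transport_cons_cons, transport_cons_cons, this, mul_assoc]

/-- Transposition reverses the order of a product, and transposing a cell reverses its two edges.
This becomes the compatibility with the involution `*`. -/
theorem IsTop.transport_reverse (hN : IsTop G β μ N) (hμ : IsPerronFrobenius G β μ)
    (l k : List V) :
    transport G β μ N l.reverse k.reverse = (transport G β μ N l k).transpose := by
  by_cases h : l.length = k.length
  swap
  · rw [transport_eq_zero_of_length h, transport_eq_zero_of_length (by simpa using h),
      Matrix.transpose_zero]
  induction l generalizing k with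
  | nil => simp [transport_nil_left]
  | cons w l ih =>
    rcases k with _ | ⟨v, k⟩
    · simp at h
    rcases l with _ | ⟨w', l⟩ <;> rcases k with _ | ⟨v', k⟩
    · simp [transport_singleton, corner_transpose]
    · simp at h
    · simp at h
    · have := ih (v' :: k) (by simpa using h)
      rw [transport_cons_cons, Matrix.transpose_mul, ← this, cell_transpose]
      simp only [List.reverse_cons, List.append_assoc, List.cons_append, List.nil_append]
      rw [hN.transport_append hμ w' v' (by simpa using h), transport_cons_cons,
        transport_singleton, hN.cell_mul_corner hμ]

theorem IsTop.transport_mul_corner (hN : IsTop G β μ N) (hμ : IsPerronFrobenius G β μ)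
    (w v w' v' : V) (l k : List V) :
    transport G β μ N (l ++ [w']) (k ++ [v']) * corner G β μ N w v =
      if w = w' ∧ v = v' then transport G β μ N (l ++ [w']) (k ++ [v']) else 0 := by
  have := congrArg Matrix.transpose (hN.corner_mul_transport hμ w v w' v' l.reverse k.reverse)
  rw [Matrix.transpose_mul, corner_transpose, ← hN.transport_reverse hμ] at this
  simp only [List.reverse_cons, List.reverse_reverse] at this
  rw [this]
  split_ifs
  · rw [← hN.transport_reverse hμ]
    simp
  · rfl

/-- Transport matrices of pairs of paths that do not fit together have product zero. -/
theorem IsTop.transport_mul_eq_zero (hN : IsTop G β μ N) (hμ : IsPerronFrobenius G β μ)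
    {w v w' v' : V} (h : ¬ (w = w' ∧ v = v')) (x y l k : List V) :
    transport G β μ N (x ++ [w]) (y ++ [v]) * transport G β μ N (w' :: l) (v' :: k) = 0 := by
  have := hN.transport_mul_corner hμ w v w v x y
  rw [if_pos ⟨rfl, rfl⟩] at this
  rw [← this, mul_assoc, hN.corner_mul_transport hμ, if_neg h, mul_zero]

/-- The corner absorbed at the front tests the first letters of the label. This fixes the initial
and final vertices of the operators. -/
theorem IsTop.transport_ne_zero_head (hN : IsTop G β μ N) (hμ : IsPerronFrobenius G β μ)
    {l k : List V} {a b : Label V N} (h : transport G β μ N l k a b ≠ 0) :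
    l.head? = a.2.1.1.head? ∧ k.head? = a.2.2.1.head? := by
  rcases l with _ | ⟨w, l⟩
  · simp [transport_nil_left] at h
  rcases k with _ | ⟨v, k⟩
  · simp [transport] at h
  have := hN.corner_mul_transport hμ w v w v l k
  rw [if_pos ⟨rfl, rfl⟩] at this
  rw [← this, Matrix.mul_apply] at h
  obtain ⟨c, -, hc⟩ := Finset.exists_ne_zero_of_sum_ne_zero h
  have h1 := left_ne_zero_of_mul hc
  rw [corner] at h1
  split_ifs at h1 with h2
  · exact ⟨h2.1.symm, h2.2.symm⟩
  · exact absurd rfl h1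

theorem IsTop.transport_ne_zero_last (hN : IsTop G β μ N) (hμ : IsPerronFrobenius G β μ)
    {l k : List V} {a b : Label V N} (h : transport G β μ N l k a b ≠ 0) :
    l.getLast? = b.2.1.1.head? ∧ k.getLast? = b.2.2.1.head? := by
  have h1 : transport G β μ N l.reverse k.reverse b a ≠ 0 := by
    rwa [hN.transport_reverse hμ, Matrix.transpose_apply]
  simpa using hN.transport_ne_zero_head hμ h1

end Transport

/-! ### Elementary paths as lists of vertices; Jones projections in coordinates -/

section Bridge

variable {V : Type*} [Fintype V] [DecidableEq V] {G : SimpleGraph V}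

/-- The list of vertices of an elementary path. -/
def pathList (ξ : ElemPath G) : List V := List.ofFn ξ.2.1

theorem length_pathList (ξ : ElemPath G) : (pathList ξ).length = ξ.1 + 1 := by
  simp [pathList]

theorem getElem_pathList (ξ : ElemPath G) (j : ℕ) (hj : j < (pathList ξ).length) :
    (pathList ξ)[j] = ξ.2.1 ⟨j, length_pathList ξ ▸ hj⟩ := by
  simp only [pathList, List.getElem_ofFn]

theorem getElem?_pathList (ξ : ElemPath G) (j : ℕ) (hj : j < ξ.1 + 1) :
    (pathList ξ)[j]? = some (ξ.2.1 ⟨j, hj⟩) := by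
  rw [List.getElem?_eq_getElem (by rwa [length_pathList]), getElem_pathList]

theorem pathList_ne_nil (ξ : ElemPath G) : pathList ξ ≠ [] := by
  intro h
  have := length_pathList ξ
  simp [h] at this

theorem pathList_injective : Function.Injective (pathList : ElemPath G → List V) := by
  rintro ⟨m, p⟩ ⟨n, q⟩ h
  obtain rfl : m = n := by
    have := congrArg List.length h
    simpa [length_pathList] using this
  congr 1
  exact Subtype.ext (List.ofFn_injective h)

theorem isChain_pathList (ξ : ElemPath G) : (pathList ξ).IsChain G.Adj := by
  rw [pathList, List.isChain_ofFn]
  intro i hi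
  exact ξ.2.2 ⟨i, by omega⟩

theorem exists_pathN {n : ℕ} {l : List V} (h : l.IsChain G.Adj) (hl : l.length = n + 1) :
    ∃ η : PathN G n, pathList ⟨n, η⟩ = l := by
  refine ⟨⟨fun i => l.get ⟨i, by omega⟩, ?_⟩, ?_⟩
  · intro i
    exact List.isChain_iff_getElem.1 h i (by simp [hl])
  · refine List.ext_getElem (by simp [pathList, hl]) fun i h1 h2 => ?_
    rw [getElem_pathList]
    rfl

theorem exists_pathList {l : List V} (h : l.IsChain G.Adj) (hl : l ≠ []) :
    ∃ ξ : ElemPath G, pathList ξ = l := by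
  obtain ⟨n, hn⟩ : ∃ n, l.length = n + 1 :=
    ⟨l.length - 1, by have := List.length_pos_iff.2 hl; omega⟩
  obtain ⟨η, hη⟩ := exists_pathN h hn
  exact ⟨_, hη⟩

theorem head?_pathList (ξ : ElemPath G) : (pathList ξ).head? = some ξ.source := by
  simp [pathList, List.ofFn_succ, ElemPath.source]

theorem getLast?_pathList (ξ : ElemPath G) : (pathList ξ).getLast? = some ξ.target := by
  rw [List.getLast?_eq_getElem?, length_pathList]
  exact getElem?_pathList ξ _ (Nat.lt_succ_self _)

theorem pathList_vertex (v : V) : pathList (ElemPath.vertex G v) = [v] := by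
  simp [pathList, ElemPath.vertex]

theorem pathList_reverse (ξ : ElemPath G) : pathList ξ.reverse = (pathList ξ).reverse := by
  refine List.ext_getElem (by simp [length_pathList, ElemPath.reverse]) fun i h1 h2 => ?_
  rw [getElem_pathList, List.getElem_reverse, getElem_pathList]
  refine congrArg ξ.2.1 (Fin.ext ?_)
  simp [Fin.rev, length_pathList]

theorem pathList_backForth {v w : V} (h : G.Adj v w) : pathList (backForth h) = [v, w, v] := by
  simp [pathList, backForth, List.ofFn_succ]

theorem pathList_append (ξ η : ElemPath G) (h : ξ.target = η.source) :
    pathList (ξ.append η h) = pathList ξ ++ (pathList η).tail := by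
  refine List.ext_getElem (by simp [length_pathList, ElemPath.append]; omega) fun i h1 h2 => ?_
  rw [length_pathList] at h1
  have hlen : (pathList ξ).length = ξ.1 + 1 := length_pathList ξ
  by_cases hi : i ≤ ξ.1
  · rw [List.getElem_append_left (by omega), getElem_pathList, getElem_pathList]
    simp only [ElemPath.append, hi, dite_true]
  · rw [List.getElem_append_right (by omega), List.getElem_tail, getElem_pathList,
      getElem_pathList]
    simp only [ElemPath.append, hi, dite_false]
    refine congrArg η.2.1 (Fin.ext ?_)
    simp only [hlen]
    omega

theorem pathList_append_of_eq (ξ η : ElemPath G) (h : ξ.target = η.source) {x y : List V} {w w' : V}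
    (hx : pathList ξ = x ++ [w]) (hy : pathList η = w' :: y) :
    pathList (ξ.append η h) = x ++ w :: y := by
  rw [pathList_append, hx, hy]
  simp

/-- The coefficients of an element of the space of paths, as a function of lists of vertices. -/
def hat : PathSpace G →ₗ[ℂ] List V →₀ ℂ := Finsupp.lmapDomain ℂ ℂ pathList

theorem hat_pathList (f : PathSpace G) (ξ : ElemPath G) : hat f (pathList ξ) = f ξ :=
  Finsupp.mapDomain_apply pathList_injective f ξ

theorem hat_eq_zero_of_not_isChain (f : PathSpace G) {l : List V} (h : ¬ l.IsChain G.Adj) :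
    hat f l = 0 :=
  Finsupp.mapDomain_of_notMem_range f l fun ⟨ξ, hξ⟩ => h (hξ ▸ isChain_pathList ξ)

theorem hat_nil (f : PathSpace G) : hat f [] = 0 :=
  Finsupp.mapDomain_of_notMem_range f [] fun ⟨ξ, hξ⟩ => pathList_ne_nil ξ hξ

theorem hat_injective : Function.Injective (hat : PathSpace G → List V →₀ ℂ) :=
  Finsupp.mapDomain_injective pathList_injective

theorem hat_basisPath (ξ : ElemPath G) (l : List V) :
    hat (basisPath ξ) l = if pathList ξ = l then 1 else 0 := by
  rw [hat, basisPath, Finsupp.lmapDomain_apply, Finsupp.mapDomain_single, Finsupp.single_apply]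

theorem ext_hat {f g : PathSpace G} (h : ∀ l, hat f l = hat g l) : f = g :=
  hat_injective (Finsupp.ext h)

theorem mem_lengthSpace {n : ℕ} {f : PathSpace G} :
    f ∈ lengthSpace G n ↔ ∀ l, l.length ≠ n + 1 → hat f l = 0 := by
  rw [lengthSpace, Finsupp.mem_supported']
  constructor
  · intro h l hl
    by_cases hc : l.IsChain G.Adj
    · rcases eq_or_ne l [] with rfl | hne
      · exact hat_nil f
      · obtain ⟨ξ, rfl⟩ := exists_pathList hc hne
        rw [hat_pathList]
        refine h ξ fun h' => hl ?_
        rw [length_pathList]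
        exact congrArg (· + 1) h'
    · exact hat_eq_zero_of_not_isChain f hc
  · intro h ξ hξ
    rw [← hat_pathList]
    refine h _ fun h' => hξ ?_
    rw [length_pathList] at h'
    exact Nat.succ_injective h'

theorem basisPath_mem_lengthSpace (ξ : ElemPath G) : basisPath ξ ∈ lengthSpace G ξ.1 :=
  Finsupp.single_mem_supported ℂ _ rfl

theorem mem_endpointSpace {v w : V} {f : PathSpace G} :
    f ∈ endpointSpace G v w ↔
      ∀ l, ¬ (l.head? = some v ∧ l.getLast? = some w) → hat f l = 0 := by
  rw [endpointSpace, Finsupp.mem_supported']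
  constructor
  · intro h l hl
    by_cases hc : l.IsChain G.Adj
    · rcases eq_or_ne l [] with rfl | hne
      · exact hat_nil f
      · obtain ⟨ξ, rfl⟩ := exists_pathList hc hne
        rw [hat_pathList]
        refine h ξ fun h' => hl ?_
        rw [head?_pathList, getLast?_pathList, h'.1, h'.2]
        exact ⟨rfl, rfl⟩
    · exact hat_eq_zero_of_not_isChain f hc
  · intro h ξ hξ
    rw [← hat_pathList]
    refine h _ fun h' => hξ ?_
    rw [head?_pathList, getLast?_pathList] at h'
    exact ⟨Option.some.inj h'.1, Option.some.inj h'.2⟩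

/-- Sums over elementary paths are sums over words. -/
theorem sum_pathN [DecidableRel G.Adj] {E : Type*} [AddCommMonoid E] (n : ℕ) (φ : List V → E)
    (hφ : ∀ l, ¬ l.IsChain G.Adj → φ l = 0) :
    ∑ η : PathN G n, φ (pathList ⟨n, η⟩) = ∑ l ∈ words V (n + 1), φ l := by
  have : ∀ η : PathN G n, pathList ⟨n, η⟩ ∈ words V (n + 1) :=
    fun η => mem_words.2 (length_pathList _)
  rw [← Finset.sum_image (s := Finset.univ) (g := fun η : PathN G n => pathList ⟨n, η⟩) (f := φ)]
  · refine Finset.sum_subset (Finset.image_subset_iff.2 fun η _ => this η) fun l hl hl' => ?_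
    refine hφ l fun hc => hl' ?_
    obtain ⟨η, hη⟩ := exists_pathN hc (mem_words.1 hl)
    exact Finset.mem_image.2 ⟨η, Finset.mem_univ _, hη⟩
  · intro η _ η' _ h
    have := pathList_injective h
    simpa using this

theorem getElem?_append_three_iff {x X y Y : List V} {v u v' a b c : V}
    (hx : x.length = X.length) :
    (∀ j, j ≠ x.length + 1 → (x ++ v :: u :: v' :: y)[j]? = (X ++ a :: b :: c :: Y)[j]?) ↔
      x = X ∧ v = a ∧ v' = c ∧ y = Y := by
  induction x generalizing X with
  | nil =>
    obtain rfl : X = [] := List.length_eq_zero_iff.1 hx.symm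
    constructor
    · intro h
      refine ⟨rfl, by simpa using h 0 (by simp), by simpa using h 2 (by simp), ?_⟩
      refine List.ext_getElem? fun i => ?_
      simpa using h (i + 3) (by simp)
    · rintro ⟨-, rfl, rfl, rfl⟩ j hj
      rcases j with _ | _ | j
      · rfl
      · simp at hj
      · rfl
  | cons s x ih =>
    rcases X with _ | ⟨t, X⟩
    · simp at hx
    have ih' := ih (X := X) (by simpa using hx)
    constructor
    · intro h
      obtain ⟨h1, h2⟩ := ih'.1 fun j hj => by simpa using h (j + 1) (by simpa using hj)
      exact ⟨by rw [h1, show s = t by simpa using h 0 (by simp)], h2⟩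
    · rintro ⟨h1, h2⟩ j hj
      rw [List.cons.injEq] at h1
      rcases j with _ | j
      · simp [h1.1]
      · simpa using ih'.2 ⟨h1.2, h2⟩ j (by simpa using hj)

theorem exists_append_three {l : List V} {i : ℕ} (h : i + 3 ≤ l.length) :
    ∃ x a b c y, l = x ++ a :: b :: c :: y ∧ x.length = i := by
  refine ⟨l.take i, l[i], l[i + 1], l[i + 2], l.drop (i + 3), ?_, by simp; omega⟩
  rw [← List.drop_eq_getElem_cons (by omega), ← List.drop_eq_getElem_cons (by omega),
    ← List.drop_eq_getElem_cons (by omega), List.take_append_drop]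

variable [DecidableRel G.Adj] {β : ℝ} {μ : V → ℝ}

theorem hat_jones_eq_zero (f : PathSpace G) {i : ℕ} {l : List V} (h : l.length < i + 3) :
    hat (jones G β μ i f) l = 0 := by
  induction f using Finsupp.induction_linear with
  | zero => simp
  | add f g hf hg => rw [map_add, map_add, Finsupp.add_apply, hf, hg, add_zero]
  | single ξ c =>
    rw [jones, Finsupp.linearCombination_single, map_smul, Finsupp.smul_apply]
    split_ifs with hi
    · rw [map_sum, Finsupp.finsetSum_apply, Finset.sum_eq_zero, smul_zero]
      intro η _
      split_ifs
      · rw [map_smul, Finsupp.smul_apply, hat_basisPath, if_neg, smul_zero]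
        rintro rfl
        rw [length_pathList] at h
        simp only at h
        omega
      · simp
    · simp

/-- Up to 1/β the Jones projection is a cup after a cap: since the neighbours on both sides agree,
its coefficient factors as `√(μ u) * √(μ u') / μ v`. -/
theorem hat_jones (hμ : IsPerronFrobenius G β μ) (f : PathSpace G) (x : List V) (v u v' : V)
    (y : List V) :
    hat (jones G β μ x.length f) (x ++ v :: u :: v' :: y) =
      if v = v' ∧ G.Adj v u then
        ((1 / β * (√(μ u) / μ v) : ℝ) : ℂ) *
          ∑ u', (√(μ u') : ℂ) * hat f (x ++ v :: u' :: v :: y) else 0 := by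
  induction f using Finsupp.induction_linear with
  | zero => simp
  | add f g hf hg =>
    rw [map_add, map_add, Finsupp.add_apply, hf, hg, map_add]
    split_ifs
    · simp [mul_add, Finset.sum_add_distrib]
    · simp
  | single ξ c =>
    rw [show Finsupp.single ξ c = c • basisPath ξ by simp [basisPath], map_smul, map_smul,
      Finsupp.smul_apply, map_smul]
    suffices hs : hat (jones G β μ x.length (basisPath ξ)) (x ++ v :: u :: v' :: y) =
      if v = v' ∧ G.Adj v u then
        ((1 / β * (√(μ u) / μ v) : ℝ) : ℂ) *
          ∑ u', (√(μ u') : ℂ) * hat (basisPath ξ) (x ++ v :: u' :: v :: y) else 0 by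
      rw [hs]
      split_ifs
      · simp only [Finsupp.smul_apply, smul_eq_mul, Finset.mul_sum]
        exact Finset.sum_congr rfl fun u' _ => by ring
      · simp
    simp only [hat_basisPath]
    by_cases hl : (pathList ξ).length = x.length + 3 + y.length
    swap
    · have h1 : ∀ v' u', pathList ξ ≠ x ++ v :: u' :: v' :: y := by
        intro v' u' h
        apply hl
        rw [h]
        simp
        omega
      simp only [h1, if_false, mul_zero, Finset.sum_const_zero, ite_self]
      rw [jones, basisPath, Finsupp.linearCombination_single, one_smul]
      split_ifs with hi
      · rw [map_sum, Finsupp.finsetSum_apply]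
        refine Finset.sum_eq_zero fun η _ => ?_
        split_ifs
        · rw [map_smul, Finsupp.smul_apply, hat_basisPath, if_neg, smul_zero]
          intro h
          have h2 := congrArg List.length h
          rw [length_pathList] at hl h2
          simp at h2
          omega
        · simp
      · simp
    by_cases hc : (x ++ v :: u :: v' :: y).IsChain G.Adj
    swap
    · rw [hat_eq_zero_of_not_isChain _ hc]
      split_ifs with h
      · rw [Finset.sum_eq_zero, mul_zero]
        intro u' _
        rw [if_neg, mul_zero]
        intro h1
        have h2 := isChain_pathList ξ
        rw [h1] at h2
        apply hc
        obtain ⟨rfl, h⟩ := h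
        rw [List.isChain_append_cons_cons, List.isChain_cons_cons] at h2 ⊢
        exact ⟨h2.1, h, h.symm, h2.2.2.2⟩
      · rfl
    have hadj : G.Adj v u := by
      rw [List.isChain_append_cons_cons] at hc
      exact hc.2.1
    rw [length_pathList] at hl
    -- The elementary path with the prescribed vertices is the only summand of `jones` that
    -- contributes to this coefficient.
    obtain ⟨η₀, hη₀⟩ := exists_pathN (n := ξ.1) hc (by rw [hl]; simp; omega)
    obtain ⟨X, a, b, c, Y, hX, hXl⟩ := exists_append_three (l := pathList ξ) (i := x.length)
      (by rw [length_pathList]; omega)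
    have hi : x.length + 2 ≤ ξ.1 := by omega
    have gξ := getElem?_pathList ξ
    have gη : ∀ (j : ℕ) (hj : j < ξ.1 + 1), (pathList ⟨ξ.1, η₀⟩)[j]? = some (η₀.1 ⟨j, hj⟩) :=
      getElem?_pathList ⟨ξ.1, η₀⟩
    rw [← hη₀, hat_pathList, jones, basisPath, Finsupp.linearCombination_single, one_smul,
      dif_pos hi, Finsupp.finsetSum_apply, Finset.sum_eq_single η₀]
    rotate_left
    · intro η _ hη
      split_ifs
      · rw [Finsupp.smul_apply, basisPath, Finsupp.single_apply, if_neg, smul_zero]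
        intro h
        exact hη (by simpa using h)
      · rfl
    · simp
    have ga : ξ.2.1 ⟨x.length, by omega⟩ = a := by
      have := gξ x.length (by omega)
      rw [hX, List.getElem?_append_right (by omega)] at this
      simpa [hXl] using this.symm
    have gb : ξ.2.1 ⟨x.length + 1, by omega⟩ = b := by
      have := gξ (x.length + 1) (by omega)
      rw [hX, List.getElem?_append_right (by omega)] at this
      simpa [hXl] using this.symm
    have gc : ξ.2.1 ⟨x.length + 2, by omega⟩ = c := by
      have := gξ (x.length + 2) (by omega)
      rw [hX, List.getElem?_append_right (by omega)] at this
      simpa [hXl] using this.symm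
    have gu : η₀.1 ⟨x.length + 1, by omega⟩ = u := by
      have := gη (x.length + 1) (by omega)
      rw [hη₀] at this
      simpa using this.symm
    have hcond : (∀ j : Fin (ξ.1 + 1), (j : ℕ) ≠ x.length + 1 → η₀.1 j = ξ.2.1 j) ↔
        x = X ∧ v = a ∧ v' = c ∧ y = Y := by
      rw [← getElem?_append_three_iff (u := u) (b := b) hXl.symm, ← hX, ← hη₀]
      constructor
      · intro h j hj
        by_cases hj' : j < ξ.1 + 1
        · rw [gξ j hj', gη j hj', h ⟨j, hj'⟩ hj]
        · rw [List.getElem?_eq_none, List.getElem?_eq_none]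
          · rw [length_pathList]; omega
          · rw [length_pathList]; simp only; omega
      · intro h j hj
        have := h j hj
        rw [gξ j j.2, gη j j.2] at this
        exact Option.some.inj this
    rw [ga, gb, gc, gu, hX]
    by_cases hcase : a = c ∧ x = X ∧ v = a ∧ v' = c ∧ y = Y
    · rw [if_pos ⟨hcase.1, hcond.2 hcase.2⟩]
      obtain ⟨rfl, rfl, rfl, rfl, rfl⟩ := hcase
      rw [if_pos ⟨rfl, hadj⟩, Finset.sum_eq_single b]
      · rw [if_pos rfl, Finsupp.smul_apply, basisPath, Finsupp.single_eq_same, smul_eq_mul,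
          mul_one, mul_one, ← Complex.ofReal_mul]
        congr 1
        rw [Real.sqrt_div (mul_nonneg (hμ.pos _).le (hμ.pos _).le),
          Real.sqrt_mul_self (hμ.pos _).le, Real.sqrt_mul (hμ.pos _).le]
        ring
      · intro d _ hd
        rw [if_neg, mul_zero]
        intro h
        rw [List.append_cancel_left_eq] at h
        simp only [List.cons.injEq, true_and] at h
        exact hd h.1.symm
      · simp
    · rw [if_neg fun h => hcase ⟨h.1, hcond.1 h.2⟩, Finsupp.coe_zero, Pi.zero_apply]
      split_ifs with h
      · rw [Finset.sum_eq_zero, mul_zero]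
        intro d _
        rw [if_neg, mul_zero]
        intro h1
        obtain ⟨h2, h3⟩ := List.append_inj h1 hXl
        simp only [List.cons.injEq] at h3
        exact hcase ⟨h3.1.trans h3.2.2.1.symm, h2.symm, h3.1.symm, h.1 ▸ h3.2.2.1.symm,
          h3.2.2.2.symm⟩
      · rfl

end Bridge

/-! ### The transport operators: endpoints, length, continuity, hermiticity, involution -/

section Operators

variable {V : Type*} [Fintype V] [DecidableEq V] {G : SimpleGraph V}

theorem single_eq_smul_basisPath (ξ : ElemPath G) (c : ℂ) :
    Finsupp.single ξ c = c • basisPath ξ := by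
  simp [basisPath]

theorem concat_basisPath (ξ ρ : ElemPath G) : concat G (basisPath ξ) (basisPath ρ) =
    if h : ξ.target = ρ.source then basisPath (ξ.append ρ h) else 0 := by
  rw [concat, basisPath, Finsupp.linearCombination_single, one_smul]
  rw [basisPath, Finsupp.linearCombination_single, one_smul]

theorem exists_pathList_eq_append (ξ : ElemPath G) :
    ∃ x, pathList ξ = x ++ [ξ.target] ∧ x.length = ξ.1 := by
  refine ⟨(pathList ξ).dropLast, ?_, by simp [length_pathList]⟩
  have h := getLast?_pathList ξ
  rw [List.getLast?_eq_some_iff] at h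
  obtain ⟨x, hx⟩ := h
  rw [hx]
  simp

theorem exists_pathList_eq_cons (ξ : ElemPath G) :
    ∃ x, pathList ξ = ξ.source :: x ∧ x.length = ξ.1 := by
  have h := head?_pathList ξ
  rw [List.head?_eq_some_iff] at h
  obtain ⟨x, hx⟩ := h
  refine ⟨x, hx, ?_⟩
  have := length_pathList ξ
  rw [hx] at this
  simpa using this

/-- Concatenated paths share their middle vertex, so the two pieces of l overlap in the letter at
position i. -/
theorem hat_concat (f g : PathSpace G) (l : List V) :
    hat (concat G f g) l =
      ∑ i ∈ Finset.range l.length, hat f (l.take (i + 1)) * hat g (l.drop i) := by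
  induction f using Finsupp.induction_linear with
  | zero => simp
  | add f f' hf hf' => simp [hf, hf', add_mul, Finset.sum_add_distrib]
  | single ξ c =>
  induction g using Finsupp.induction_linear with
  | zero => simp
  | add g g' hg hg' =>
    rw [map_add, map_add, Finsupp.add_apply, hg, hg', map_add, ← Finset.sum_add_distrib]
    exact Finset.sum_congr rfl fun i _ => by rw [Finsupp.add_apply, mul_add]
  | single ρ d =>
  rw [single_eq_smul_basisPath, single_eq_smul_basisPath]
  simp only [map_smul, LinearMap.smul_apply, Finsupp.smul_apply, smul_eq_mul]
  suffices h : hat (concat G (basisPath ξ) (basisPath ρ)) l = ∑ i ∈ Finset.range l.length,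
      hat (basisPath ξ) (l.take (i + 1)) * hat (basisPath ρ) (l.drop i) by
    rw [h, Finset.mul_sum, Finset.mul_sum]
    exact Finset.sum_congr rfl fun i _ => by ring
  have hξ := length_pathList ξ
  obtain ⟨x, hx, hxl⟩ := exists_pathList_eq_append ξ
  obtain ⟨y, hy, hyl⟩ := exists_pathList_eq_cons ρ
  simp only [hat_basisPath]
  have hz : ∀ i ∈ Finset.range l.length, i ≠ ξ.1 →
      ((if pathList ξ = l.take (i + 1) then 1 else 0) *
        (if pathList ρ = l.drop i then 1 else 0) : ℂ) = 0 := by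
    intro i hi hi'
    rw [if_neg, zero_mul]
    intro h
    rw [h, List.length_take] at hξ
    rw [Finset.mem_range] at hi
    omega
  rw [concat_basisPath]
  by_cases hl : ξ.1 < l.length
  swap
  · rw [Finset.sum_eq_zero fun i hi => hz i hi (by rw [Finset.mem_range] at hi; omega)]
    split_ifs with h
    · rw [hat_basisPath, if_neg]
      rintro rfl
      rw [length_pathList] at hl
      simp only [ElemPath.append] at hl
      omega
    · simp
  rw [Finset.sum_eq_single ξ.1 hz fun h => absurd (Finset.mem_range.2 hl) h]
  obtain ⟨z, w, t, rfl, hzl⟩ : ∃ z w t, l = z ++ w :: t ∧ z.length = ξ.1 :=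
    ⟨l.take ξ.1, l[ξ.1], l.drop (ξ.1 + 1), by
      rw [← List.drop_eq_getElem_cons, List.take_append_drop], by simp; omega⟩
  have h1 : (z ++ w :: t).take (ξ.1 + 1) = z ++ [w] := by
    rw [← hzl]
    simp [List.take_append]
  have h2 : (z ++ w :: t).drop ξ.1 = w :: t := by
    rw [← hzl]
    simp
  rw [h1, h2, hx, hy]
  by_cases h4 : x ++ [ξ.target] = z ++ [w] ∧ ρ.source :: y = w :: t
  · rw [if_pos h4.1, if_pos h4.2, mul_one]
    obtain ⟨h5, h6⟩ := h4
    rw [List.cons.injEq] at h6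
    obtain ⟨h7, h8⟩ := List.append_inj h5 (by omega)
    rw [List.cons.injEq] at h8
    rw [dif_pos (h8.1.trans h6.1.symm), hat_basisPath,
      pathList_append_of_eq ξ ρ (h8.1.trans h6.1.symm) hx hy, if_pos]
    rw [h7, h8.1, h6.2]
  · have h5 : ((if x ++ [ξ.target] = z ++ [w] then 1 else 0) *
        (if ρ.source :: y = w :: t then 1 else 0) : ℂ) = 0 := by
      rcases not_and_or.1 h4 with h | h <;> simp [h]
    rw [h5]
    split_ifs with h
    · rw [hat_basisPath, pathList_append_of_eq ξ ρ h hx hy, if_neg]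
      intro h6
      obtain ⟨h7, h8⟩ := List.append_inj h6 (by omega)
      rw [List.cons.injEq] at h8
      exact h4 ⟨by rw [h7, h8.1], by rw [← h, h8.1, h8.2]⟩
    · simp

theorem pathInner_add_left (f f' g : PathSpace G) :
    pathInner (f + f') g = pathInner f g + pathInner f' g := by
  rw [pathInner, Finsupp.sum_add_index']
  · rfl
  · simp
  · intro a b c
    rw [map_add, add_mul]

theorem pathInner_single_left (ξ : ElemPath G) (c : ℂ) (g : PathSpace G) :
    pathInner (Finsupp.single ξ c) g = conj c * g ξ := by
  rw [pathInner, Finsupp.sum_single_index (by simp)]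

theorem pathInner_zero_left (g : PathSpace G) : pathInner (0 : PathSpace G) g = 0 := by
  simp [pathInner]

theorem pathInner_smul_left (c : ℂ) (f g : PathSpace G) :
    pathInner (c • f) g = conj c * pathInner f g := by
  induction f using Finsupp.induction_linear with
  | zero => simp [pathInner_zero_left]
  | add f f' hf hf' => rw [smul_add, pathInner_add_left, hf, hf', pathInner_add_left, mul_add]
  | single ξ d =>
    rw [Finsupp.smul_single, pathInner_single_left, pathInner_single_left, smul_eq_mul, map_mul,
      mul_assoc]

theorem pathInner_sum_left {ι : Type*} (s : Finset ι) (f : ι → PathSpace G) (g : PathSpace G) :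
    pathInner (∑ i ∈ s, f i) g = ∑ i ∈ s, pathInner (f i) g := by
  classical
  induction s using Finset.induction_on with
  | empty => simp [pathInner_zero_left]
  | insert i s hi ih => rw [Finset.sum_insert hi, pathInner_add_left, ih, Finset.sum_insert hi]

theorem hat_pathStar (f : PathSpace G) (l : List V) :
    hat (pathStar f) l = conj (hat f l.reverse) := by
  induction f using Finsupp.induction_linear with
  | zero => simp [pathStar]
  | add f f' hf hf' =>
    rw [pathStar, Finsupp.sum_add_index', map_add, Finsupp.add_apply, map_add, Finsupp.add_apply,
      map_add, ← hf, ← hf']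
    · rfl
    · simp
    · intro a b c
      rw [map_add, Finsupp.single_add]
  | single ξ c =>
    rw [pathStar, Finsupp.sum_single_index (by simp), single_eq_smul_basisPath,
      single_eq_smul_basisPath, map_smul, map_smul, Finsupp.smul_apply, Finsupp.smul_apply,
      hat_basisPath, hat_basisPath, pathList_reverse]
    by_cases h : (pathList ξ).reverse = l
    · rw [if_pos h, if_pos (by rw [← h, List.reverse_reverse])]
      simp
    · rw [if_neg h, if_neg (fun h' => h (by rw [h', List.reverse_reverse]))]
      simp

variable [DecidableRel G.Adj] {β : ℝ} {μ : V → ℝ} {N : ℕ}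

variable (G β μ N) in
/-- The operator on the space of paths given by an entry of the transport matrices. -/
def transportOp (a b : Label V N) : Module.End ℂ (PathSpace G) :=
  Finsupp.linearCombination ℂ fun ξ : ElemPath G =>
    ∑ η : PathN G ξ.1, (transport G β μ N (pathList ⟨ξ.1, η⟩) (pathList ξ) a b : ℂ) •
      basisPath (⟨ξ.1, η⟩ : ElemPath G)

theorem transportOp_basisPath (a b : Label V N) (ξ : ElemPath G) :
    transportOp G β μ N a b (basisPath ξ) =
      ∑ η : PathN G ξ.1, (transport G β μ N (pathList ⟨ξ.1, η⟩) (pathList ξ) a b : ℂ) •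
        basisPath (⟨ξ.1, η⟩ : ElemPath G) := by
  rw [transportOp, basisPath, Finsupp.linearCombination_single, one_smul]

theorem hat_transportOp_basisPath (a b : Label V N) (ξ : ElemPath G) (l : List V) :
    hat (transportOp G β μ N a b (basisPath ξ)) l =
      (transport G β μ N l (pathList ξ) a b : ℂ) := by
  have hsum : hat (transportOp G β μ N a b (basisPath ξ)) l = ∑ k ∈ words V (ξ.1 + 1),
      if k = l then (transport G β μ N k (pathList ξ) a b : ℂ) else 0 := by
    rw [transportOp_basisPath, map_sum, Finsupp.finsetSum_apply, ← sum_pathN (G := G) ξ.1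
      (fun k => if k = l then (transport G β μ N k (pathList ξ) a b : ℂ) else 0)]
    · refine Finset.sum_congr rfl fun η _ => ?_
      rw [map_smul, Finsupp.smul_apply, hat_basisPath]
      simp
    · intro k hk
      rw [transport_eq_zero_left hk]
      simp
  rw [hsum, Finset.sum_ite_eq']
  split_ifs with h
  · rfl
  · rw [transport_eq_zero_of_length]
    · simp
    · rw [length_pathList]
      exact fun h' => h (mem_words.2 h')

theorem hat_transportOp (a b : Label V N) (f : PathSpace G) (l : List V) :
    hat (transportOp G β μ N a b f) l =
      ∑ k ∈ words V l.length, (transport G β μ N l k a b : ℂ) * hat f k := by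
  induction f using Finsupp.induction_linear with
  | zero => simp
  | add f f' hf hf' =>
    simp only [map_add, Finsupp.add_apply, hf, hf', mul_add, Finset.sum_add_distrib]
  | single ξ c =>
    simp only [single_eq_smul_basisPath, map_smul, Finsupp.smul_apply,
      hat_transportOp_basisPath, hat_basisPath, smul_eq_mul]
    rw [Finset.sum_congr rfl (g := fun k => if pathList ξ = k then
      c * (transport G β μ N l k a b : ℂ) else 0), Finset.sum_ite_eq]
    · split_ifs with h
      · rfl
      · rw [transport_eq_zero_of_length]
        · simp
        · exact fun h' => h (mem_words.2 h'.symm)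
    · intro k _
      split_ifs <;> ring

theorem transportOp_apply (a b : Label V N) (f : PathSpace G) (ξ : ElemPath G) :
    transportOp G β μ N a b f ξ =
      ∑ k ∈ words V (ξ.1 + 1), (transport G β μ N (pathList ξ) k a b : ℂ) * hat f k := by
  rw [← hat_pathList, hat_transportOp, length_pathList]

theorem Label.ne_nil_fst (a : Label V N) : a.2.1.1 ≠ [] := by
  intro h
  have := a.length_fst
  simp [h] at this

theorem Label.ne_nil_snd (a : Label V N) : a.2.2.1 ≠ [] := by
  intro h
  have := a.length_snd
  simp [h] at this

/-- The first vertex of the first word of a label. -/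
def Label.final (a : Label V N) : V := a.2.1.1.head a.ne_nil_fst

/-- The first vertex of the second word of a label. -/
def Label.initial (a : Label V N) : V := a.2.2.1.head a.ne_nil_snd

theorem Label.head?_fst (a : Label V N) : a.2.1.1.head? = some a.final :=
  List.head?_eq_some_head a.ne_nil_fst

theorem Label.head?_snd (a : Label V N) : a.2.2.1.head? = some a.initial :=
  List.head?_eq_some_head a.ne_nil_snd

theorem transportOp_mem_endpointSpace (hN : IsTop G β μ N) (hμ : IsPerronFrobenius G β μ)
    (a b : Label V N) (f : PathSpace G) :
    transportOp G β μ N a b f ∈ endpointSpace G a.final b.final := by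
  rw [mem_endpointSpace]
  intro l hl
  rw [hat_transportOp]
  refine Finset.sum_eq_zero fun k _ => ?_
  by_cases h : transport G β μ N l k a b = 0
  · simp [h]
  · refine absurd ⟨?_, ?_⟩ hl
    · rw [(hN.transport_ne_zero_head hμ h).1, a.head?_fst]
    · rw [(hN.transport_ne_zero_last hμ h).1, b.head?_fst]

theorem transportOp_eq_zero (hN : IsTop G β μ N) (hμ : IsPerronFrobenius G β μ)
    (a b : Label V N) {v w : V} (h : (v, w) ≠ (a.initial, b.initial)) {f : PathSpace G}
    (hf : f ∈ endpointSpace G v w) : transportOp G β μ N a b f = 0 := by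
  rw [mem_endpointSpace] at hf
  refine ext_hat fun l => ?_
  rw [hat_transportOp, map_zero, Finsupp.coe_zero, Pi.zero_apply]
  refine Finset.sum_eq_zero fun k _ => ?_
  by_cases h' : transport G β μ N l k a b = 0
  · simp [h']
  · rw [hf k, mul_zero]
    rintro ⟨h1, h2⟩
    rw [(hN.transport_ne_zero_head hμ h').2, a.head?_snd] at h1
    rw [(hN.transport_ne_zero_last hμ h').2, b.head?_snd] at h2
    exact h (by rw [Option.some.inj h1, Option.some.inj h2])

theorem transportOp_mem_lengthSpace (a b : Label V N) {n : ℕ} {f : PathSpace G}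
    (hf : f ∈ lengthSpace G n) : transportOp G β μ N a b f ∈ lengthSpace G n := by
  rw [mem_lengthSpace] at hf ⊢
  intro l hl
  rw [hat_transportOp]
  refine Finset.sum_eq_zero fun k hk => ?_
  rw [hf k (by rwa [mem_words.1 hk]), mul_zero]

/-- On elementary paths only the cut at the length of the first one survives. If the ends fit
together this is `IsTop.transport_append`; otherwise orthogonality of the corners makes the product
zero. -/
theorem transportOp_concat (hN : IsTop G β μ N) (hμ : IsPerronFrobenius G β μ)
    (a b : Label V N) (f g : PathSpace G) :
    transportOp G β μ N a b (concat G f g) =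
      ∑ c, concat G (transportOp G β μ N a c f) (transportOp G β μ N c b g) := by
  induction f using Finsupp.induction_linear with
  | zero => simp
  | add f f' hf hf' => simp only [map_add, LinearMap.add_apply, hf, hf', Finset.sum_add_distrib]
  | single ξ c =>
  induction g using Finsupp.induction_linear with
  | zero => simp
  | add g g' hg hg' => simp only [map_add, hg, hg', Finset.sum_add_distrib]
  | single ρ d =>
  simp only [single_eq_smul_basisPath, map_smul, LinearMap.smul_apply, ← Finset.smul_sum]
  congr 2
  refine ext_hat fun l => ?_
  have hrhs : hat (∑ c, concat G (transportOp G β μ N a c (basisPath ξ))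
      (transportOp G β μ N c b (basisPath ρ))) l = ∑ i ∈ Finset.range l.length,
      (((transport G β μ N (l.take (i + 1)) (pathList ξ) *
        transport G β μ N (l.drop i) (pathList ρ)) a b : ℝ) : ℂ) := by
    simp only [map_sum, Finsupp.finsetSum_apply, hat_concat, hat_transportOp_basisPath]
    rw [Finset.sum_comm]
    refine Finset.sum_congr rfl fun i _ => ?_
    rw [Matrix.mul_apply]
    push_cast
    rfl
  rw [hrhs]
  obtain ⟨x, hx, hxl⟩ := exists_pathList_eq_append ξ
  obtain ⟨y, hy, hyl⟩ := exists_pathList_eq_cons ρ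
  have hz : ∀ i ∈ Finset.range l.length, i ≠ ξ.1 →
      (((transport G β μ N (l.take (i + 1)) (pathList ξ) *
        transport G β μ N (l.drop i) (pathList ρ)) a b : ℝ) : ℂ) = 0 := by
    intro i hi hi'
    rw [transport_eq_zero_of_length]
    · simp
    · rw [Finset.mem_range] at hi
      rw [length_pathList, List.length_take]
      omega
  rw [concat_basisPath]
  by_cases hl : ξ.1 < l.length
  swap
  · rw [Finset.sum_eq_zero fun i hi => hz i hi (by rw [Finset.mem_range] at hi; omega)]
    split_ifs with h
    · rw [hat_transportOp_basisPath, transport_eq_zero_of_length]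
      · simp
      · rw [pathList_append_of_eq ξ ρ h hx hy]
        simp
        omega
    · simp
  rw [Finset.sum_eq_single ξ.1 hz fun h => absurd (Finset.mem_range.2 hl) h]
  obtain ⟨z, w, t, rfl, hzl⟩ : ∃ z w t, l = z ++ w :: t ∧ z.length = ξ.1 :=
    ⟨l.take ξ.1, l[ξ.1], l.drop (ξ.1 + 1), by
      rw [← List.drop_eq_getElem_cons, List.take_append_drop], by simp; omega⟩
  have h1 : (z ++ w :: t).take (ξ.1 + 1) = z ++ [w] := by
    rw [← hzl]
    simp [List.take_append]
  have h2 : (z ++ w :: t).drop ξ.1 = w :: t := by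
    rw [← hzl]
    simp
  rw [h1, h2, hx, hy]
  split_ifs with h
  · rw [hat_transportOp_basisPath, pathList_append_of_eq ξ ρ h hx hy,
      hN.transport_append hμ _ _ (hzl.trans hxl.symm), h]
  · rw [hN.transport_mul_eq_zero hμ fun h' => h h'.2]
    simp

/-- The coefficients are real, so taking the adjoint exchanges the two paths of a transport matrix,
which amounts to exchanging the two words of each label. -/
theorem pathInner_transportOp (a b : Label V N) (f g : PathSpace G) :
    pathInner (transportOp G β μ N a b f) g =
      pathInner f (transportOp G β μ N a.swap b.swap g) := by
  induction f using Finsupp.induction_linear with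
  | zero => simp [pathInner_zero_left]
  | add f f' hf hf' => rw [map_add, pathInner_add_left, hf, hf', pathInner_add_left]
  | single ξ c =>
    rw [pathInner_single_left, single_eq_smul_basisPath, map_smul, pathInner_smul_left,
      transportOp_basisPath, pathInner_sum_left, transportOp_apply]
    congr 1
    rw [← sum_pathN (G := G) ξ.1 (fun k =>
      (transport G β μ N (pathList ξ) k a.swap b.swap : ℂ) * hat g k)]
    · refine Finset.sum_congr rfl fun η _ => ?_
      rw [pathInner_smul_left, basisPath, pathInner_single_left, hat_pathList,
        ← transport_swap (pathList ξ)]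
      simp
    · intro k hk
      rw [hat_eq_zero_of_not_isChain g hk, mul_zero]

theorem transportOp_pathStar (hN : IsTop G β μ N) (hμ : IsPerronFrobenius G β μ)
    (a b : Label V N) (f : PathSpace G) :
    transportOp G β μ N a b (pathStar f) = pathStar (transportOp G β μ N b a f) := by
  refine ext_hat fun l => ?_
  rw [hat_transportOp, hat_pathStar, hat_transportOp, map_sum]
  refine Finset.sum_nbij' List.reverse List.reverse ?_ ?_ ?_ ?_ ?_
  · intro k hk
    simpa [mem_words] using hk
  · intro k hk
    simpa [mem_words] using hk
  · simp
  · simp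
  · intro k _
    rw [hat_pathStar, hN.transport_reverse hμ, Matrix.transpose_apply, map_mul, Complex.conj_ofReal]

end Operators

/-! ### Evolution and normalisation; the transport family -/

section Evolution

variable {V : Type*} [Fintype V] [DecidableEq V] {G : SimpleGraph V} [DecidableRel G.Adj]
  {β : ℝ} {μ : V → ℝ} {N : ℕ}

theorem IsTop.transport_append_three (hN : IsTop G β μ N) (hμ : IsPerronFrobenius G β μ)
    {x x' : List V} (hx : x.length = x'.length) (v u w a b c : V) (y y' : List V) :
    transport G β μ N (x ++ v :: u :: w :: y) (x' ++ a :: b :: c :: y') =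
      transport G β μ N (x ++ [v]) (x' ++ [a]) * (cell G β μ N v u a b * cell G β μ N u w b c) *
        transport G β μ N (w :: y) (c :: y') := by
  rw [hN.transport_append hμ _ _ hx, transport_cons_cons, transport_cons_cons]
  simp only [mul_assoc]

theorem sum_smul_mul_mul {ι κ : Type*} [Fintype ι] [Fintype κ] (f : κ → ℝ)
    (A C : Matrix ι ι ℝ) (B : κ → Matrix ι ι ℝ) :
    ∑ k, f k • (A * B k * C) = A * (∑ k, f k • B k) * C := by
  rw [Finset.mul_sum, Finset.sum_mul]
  exact Finset.sum_congr rfl fun k _ => by rw [mul_smul_comm, smul_mul_assoc]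

theorem IsTop.corner_mul_transport_self (hN : IsTop G β μ N) (hμ : IsPerronFrobenius G β μ)
    (w v : V) (l k : List V) :
    corner G β μ N w v * transport G β μ N (w :: l) (v :: k) =
      transport G β μ N (w :: l) (v :: k) := by
  rw [hN.corner_mul_transport hμ, if_pos ⟨rfl, rfl⟩]

/-- A cup in the input path comes out as a cup in the output path: the first exchange relation,
inserted between the transports of the remaining pieces. -/
theorem IsTop.sum_transport_right (hN : IsTop G β μ N) (hμ : IsPerronFrobenius G β μ)
    {x x' : List V} (hx : x.length = x'.length) (v u w a : V) (y y' : List V) :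
    ∑ b, (√(μ b) / √(μ a)) •
        transport G β μ N (x ++ v :: u :: w :: y) (x' ++ a :: b :: a :: y') =
      if v = w ∧ G.Adj v u then
        (√(μ u) / √(μ v)) • transport G β μ N (x ++ v :: y) (x' ++ a :: y') else 0 := by
  simp only [hN.transport_append_three hμ hx]
  rw [sum_smul_mul_mul, hN.sum_cell_mul_cell hμ]
  by_cases h : v = w ∧ G.Adj v u
  · obtain ⟨rfl, h⟩ := h
    rw [if_pos ⟨rfl, h⟩, if_pos ⟨rfl, h⟩, mul_smul_comm, smul_mul_assoc, mul_assoc,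
      hN.corner_mul_transport_self hμ, hN.transport_append hμ v a hx y y']
  · rw [if_neg h, if_neg, mul_zero, zero_mul]
    rintro ⟨rfl, h'⟩
    exact h ⟨rfl, h'⟩

/-- The dual statement: a cap on the output path equals a cap on the input path, by the second
exchange relation. -/
theorem IsTop.sum_transport_left (hN : IsTop G β μ N) (hμ : IsPerronFrobenius G β μ)
    {x x' : List V} (hx : x.length = x'.length) (v a b c : V) (y y' : List V) :
    ∑ u, (√(μ u) / √(μ v)) •
        transport G β μ N (x ++ v :: u :: v :: y) (x' ++ a :: b :: c :: y') =
      if a = c ∧ G.Adj a b then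
        (√(μ b) / √(μ a)) • transport G β μ N (x ++ v :: y) (x' ++ a :: y') else 0 := by
  simp only [hN.transport_append_three hμ hx]
  rw [sum_smul_mul_mul, hN.sum_cell_mul_cell' hμ]
  by_cases h : a = c ∧ G.Adj a b
  · obtain ⟨rfl, h⟩ := h
    rw [if_pos ⟨rfl, h⟩, if_pos ⟨rfl, h⟩, mul_smul_comm, smul_mul_assoc, mul_assoc,
      hN.corner_mul_transport_self hμ, hN.transport_append hμ v a hx y y']
  · rw [if_neg h, if_neg, mul_zero, zero_mul]
    rintro ⟨rfl, h'⟩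
    exact h ⟨rfl, h'⟩

theorem sum_words_three {E : Type*} [AddCommMonoid E] (n m : ℕ) (g : List V → E) :
    ∑ l ∈ words V (n + (m + 3)), g l = ∑ x ∈ words V n, ∑ a, ∑ b, ∑ c, ∑ y ∈ words V m,
      g (x ++ a :: b :: c :: y) := by
  rw [sum_words_add]
  simp only [sum_words_succ]

/-- A Jones projection is 1/β times a cup after a cap, and transport commutes with each. Both sides
therefore reduce to a cap on f, then transport, then a cup; the sum S in the proof is the common
part before the cup. -/
theorem transportOp_jones (hN : IsTop G β μ N) (hμ : IsPerronFrobenius G β μ)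
    (a₀ b₀ : Label V N) (i : ℕ) (f : PathSpace G) :
    transportOp G β μ N a₀ b₀ (jones G β μ i f) =
      jones G β μ i (transportOp G β μ N a₀ b₀ f) := by
  refine ext_hat fun l => ?_
  by_cases hl : l.length < i + 3
  · rw [hat_jones_eq_zero _ hl, hat_transportOp]
    refine Finset.sum_eq_zero fun k hk => ?_
    rw [hat_jones_eq_zero _ (by rwa [mem_words.1 hk]), mul_zero]
  obtain ⟨x, v, u, w, y, rfl, rfl⟩ := exists_append_three (not_lt.1 hl)
  have hne : ∀ x, (√(μ x) : ℂ) ≠ 0 := fun x => by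
    rw [Complex.ofReal_ne_zero]
    exact (Real.sqrt_pos.2 (hμ.pos x)).ne'
  have hsq : ∀ x, (μ x : ℂ) = √(μ x) * √(μ x) := fun x => by
    rw [← Complex.ofReal_mul, Real.mul_self_sqrt (hμ.pos x).le]
  have hlen : ∀ v u w : V, (x ++ v :: u :: w :: y).length = x.length + (y.length + 3) := by
    intro v u w
    simp
  rw [hat_jones hμ, hat_transportOp, hlen, sum_words_three]
  simp only [hat_transportOp, hlen, sum_words_three]
  set S : ℂ := ∑ x' ∈ words V x.length, ∑ a, ∑ y' ∈ words V y.length, ∑ b,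
    (transport G β μ N (x ++ v :: y) (x' ++ a :: y') a₀ b₀ : ℂ) *
      (√(μ b) / √(μ a) * hat f (x' ++ a :: b :: a :: y')) with hS
  have hleft : ∀ x' ∈ words V x.length,
      ∑ a, ∑ b, ∑ c, ∑ y' ∈ words V y.length,
        (transport G β μ N (x ++ v :: u :: w :: y) (x' ++ a :: b :: c :: y') a₀ b₀ : ℂ) *
          hat (jones G β μ x.length f) (x' ++ a :: b :: c :: y') =
      if v = w ∧ G.Adj v u then (1 / β : ℂ) * (√(μ u) / √(μ v)) *
        ∑ a, ∑ y' ∈ words V y.length, ∑ b,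
          (transport G β μ N (x ++ v :: y) (x' ++ a :: y') a₀ b₀ : ℂ) *
            (√(μ b) / √(μ a) * hat f (x' ++ a :: b :: a :: y')) else 0 := by
    intro x' hx'
    rw [mem_words] at hx'
    have e1 : ∀ a b c y', (transport G β μ N (x ++ v :: u :: w :: y)
          (x' ++ a :: b :: c :: y') a₀ b₀ : ℂ) *
          hat (jones G β μ x.length f) (x' ++ a :: b :: c :: y') =
        if c = a then (((√(μ b) / √(μ a)) • transport G β μ N (x ++ v :: u :: w :: y)
          (x' ++ a :: b :: a :: y')) a₀ b₀ : ℝ) * ((1 / β : ℂ) *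
          ∑ u', (√(μ u') / √(μ a) : ℂ) * hat f (x' ++ a :: u' :: a :: y')) else 0 := by
      intro a b c y'
      rw [← hx', hat_jones hμ]
      by_cases hca : c = a
      · subst hca
        rw [if_pos rfl]
        by_cases hab : G.Adj c b
        · rw [if_pos ⟨rfl, hab⟩, Matrix.smul_apply]
          have : ∑ u', (√(μ u') / √(μ c) : ℂ) * hat f (x' ++ c :: u' :: c :: y') =
              (√(μ c) : ℂ)⁻¹ * ∑ u', (√(μ u') : ℂ) * hat f (x' ++ c :: u' :: c :: y') := by
            rw [Finset.mul_sum]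
            exact Finset.sum_congr rfl fun u' _ => by ring
          rw [this]
          push_cast
          rw [hsq]
          simp only [smul_eq_mul, Complex.ofReal_mul, Complex.ofReal_div]
          ring
        · rw [if_neg (by tauto), transport_eq_zero_right]
          · simp
          · rw [List.isChain_append_cons_cons]
            tauto
      · rw [if_neg hca, if_neg (fun h => hca h.1.symm), mul_zero]
    have e2 : ∀ a y', ∑ b, ((((√(μ b) / √(μ a)) • transport G β μ N (x ++ v :: u :: w :: y)
          (x' ++ a :: b :: a :: y')) a₀ b₀ : ℝ) : ℂ) = if v = w ∧ G.Adj v u then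
        (√(μ u) / √(μ v) : ℂ) * (transport G β μ N (x ++ v :: y) (x' ++ a :: y') a₀ b₀ : ℂ)
        else 0 := by
      intro a y'
      rw [← Complex.ofReal_sum, ← Matrix.sum_apply, hN.sum_transport_right hμ hx'.symm]
      split_ifs
      · simp
      · simp
    simp only [e1]
    have e3 : ∀ a, ∑ b, ∑ c, ∑ y' ∈ words V y.length,
        (if c = a then ((((√(μ b) / √(μ a)) • transport G β μ N (x ++ v :: u :: w :: y)
          (x' ++ a :: b :: a :: y')) a₀ b₀ : ℝ) : ℂ) * ((1 / β : ℂ) *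
          ∑ u', (√(μ u') / √(μ a) : ℂ) * hat f (x' ++ a :: u' :: a :: y')) else 0) =
        if v = w ∧ G.Adj v u then (1 / β : ℂ) * (√(μ u) / √(μ v)) *
        ∑ y' ∈ words V y.length, ∑ b,
          (transport G β μ N (x ++ v :: y) (x' ++ a :: y') a₀ b₀ : ℂ) *
            (√(μ b) / √(μ a) * hat f (x' ++ a :: b :: a :: y')) else 0 := by
      intro a
      have : ∀ b, ∑ c, ∑ y' ∈ words V y.length,
        (if c = a then ((((√(μ b) / √(μ a)) • transport G β μ N (x ++ v :: u :: w :: y)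
          (x' ++ a :: b :: a :: y')) a₀ b₀ : ℝ) : ℂ) * ((1 / β : ℂ) *
          ∑ u', (√(μ u') / √(μ a) : ℂ) * hat f (x' ++ a :: u' :: a :: y')) else 0) =
          ∑ y' ∈ words V y.length,
        ((((√(μ b) / √(μ a)) • transport G β μ N (x ++ v :: u :: w :: y)
          (x' ++ a :: b :: a :: y')) a₀ b₀ : ℝ) : ℂ) * ((1 / β : ℂ) *
          ∑ u', (√(μ u') / √(μ a) : ℂ) * hat f (x' ++ a :: u' :: a :: y')) := by
        intro b
        rw [Finset.sum_comm]
        refine Finset.sum_congr rfl fun y' _ => ?_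
        rw [Finset.sum_ite_eq' Finset.univ a, if_pos (Finset.mem_univ _)]
      simp only [this]
      rw [Finset.sum_comm]
      simp only [← Finset.sum_mul, e2]
      split_ifs
      · rw [Finset.mul_sum]
        refine Finset.sum_congr rfl fun y' _ => ?_
        simp only [Finset.mul_sum]
        refine Finset.sum_congr rfl fun b _ => ?_
        ring
      · simp
    simp only [e3]
    split_ifs
    · rw [← Finset.mul_sum]
    · simp
  rw [Finset.sum_congr rfl hleft]
  by_cases hvw : v = w ∧ G.Adj v u
  swap
  · simp [if_neg hvw]
  simp only [if_pos hvw]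
  rw [← Finset.mul_sum, ← hS]
  have hright : ∑ u', (√(μ u') : ℂ) * ∑ x' ∈ words V x.length, ∑ a, ∑ b, ∑ c,
      ∑ y' ∈ words V y.length,
        (transport G β μ N (x ++ v :: u' :: v :: y) (x' ++ a :: b :: c :: y') a₀ b₀ : ℂ) *
          hat f (x' ++ a :: b :: c :: y') = √(μ v) * S := by
    have e4 : ∀ x' ∈ words V x.length, ∀ a b c y',
        ∑ u', (√(μ u') : ℂ) * ((transport G β μ N (x ++ v :: u' :: v :: y)
          (x' ++ a :: b :: c :: y') a₀ b₀ : ℂ) * hat f (x' ++ a :: b :: c :: y')) =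
        if c = a then √(μ v) * ((transport G β μ N (x ++ v :: y) (x' ++ a :: y') a₀ b₀ : ℂ) *
            (√(μ b) / √(μ a) * hat f (x' ++ a :: b :: a :: y'))) else 0 := by
      intro x' hx' a b c y'
      rw [mem_words] at hx'
      have h := congrArg (fun A => ((A a₀ b₀ : ℝ) : ℂ))
        (hN.sum_transport_left hμ hx'.symm v a b c y y')
      simp only [Matrix.sum_apply, Matrix.smul_apply, Complex.ofReal_sum, smul_eq_mul,
        Complex.ofReal_mul, Complex.ofReal_div] at h
      have h2 : ∑ u', (√(μ u') : ℂ) * ((transport G β μ N (x ++ v :: u' :: v :: y)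
          (x' ++ a :: b :: c :: y') a₀ b₀ : ℂ) * hat f (x' ++ a :: b :: c :: y')) =
          √(μ v) * (∑ u', (√(μ u') / √(μ v) : ℂ) * (transport G β μ N
            (x ++ v :: u' :: v :: y) (x' ++ a :: b :: c :: y') a₀ b₀ : ℂ)) *
            hat f (x' ++ a :: b :: c :: y') := by
        rw [Finset.mul_sum, Finset.sum_mul]
        refine Finset.sum_congr rfl fun u' _ => ?_
        have := hne v
        field_simp
      rw [h2, h]
      by_cases hca : c = a
      · subst hca
        rw [if_pos rfl]
        by_cases hab : G.Adj c b
        · rw [if_pos ⟨rfl, hab⟩]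
          simp only [Matrix.smul_apply, smul_eq_mul, Complex.ofReal_mul, Complex.ofReal_div]
          ring
        · rw [hat_eq_zero_of_not_isChain f]
          · simp
          · rw [List.isChain_append_cons_cons]
            tauto
      · rw [if_neg hca, if_neg (fun h => hca h.1.symm)]
        simp
    simp only [Finset.mul_sum]
    rw [Finset.sum_comm, hS, Finset.mul_sum]
    refine Finset.sum_congr rfl fun x' hx' => ?_
    rw [Finset.sum_comm, Finset.mul_sum]
    refine Finset.sum_congr rfl fun a _ => ?_
    rw [Finset.sum_comm, Finset.mul_sum]
    have e5 : ∀ b, ∑ u', ∑ c, ∑ y' ∈ words V y.length,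
        (√(μ u') : ℂ) * ((transport G β μ N (x ++ v :: u' :: v :: y)
          (x' ++ a :: b :: c :: y') a₀ b₀ : ℂ) * hat f (x' ++ a :: b :: c :: y')) =
        ∑ y' ∈ words V y.length, √(μ v) *
          ((transport G β μ N (x ++ v :: y) (x' ++ a :: y') a₀ b₀ : ℂ) *
            (√(μ b) / √(μ a) * hat f (x' ++ a :: b :: a :: y'))) := by
      intro b
      rw [Finset.sum_comm]
      have : ∀ c, ∑ u', ∑ y' ∈ words V y.length,
        (√(μ u') : ℂ) * ((transport G β μ N (x ++ v :: u' :: v :: y)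
          (x' ++ a :: b :: c :: y') a₀ b₀ : ℂ) * hat f (x' ++ a :: b :: c :: y')) =
          ∑ y' ∈ words V y.length, if c = a then √(μ v) *
          ((transport G β μ N (x ++ v :: y) (x' ++ a :: y') a₀ b₀ : ℂ) *
            (√(μ b) / √(μ a) * hat f (x' ++ a :: b :: a :: y'))) else 0 := by
        intro c
        rw [Finset.sum_comm]
        exact Finset.sum_congr rfl fun y' _ => e4 x' hx' a b c y'
      simp only [this]
      rw [Finset.sum_comm]
      refine Finset.sum_congr rfl fun y' _ => ?_
      rw [Finset.sum_ite_eq' Finset.univ a, if_pos (Finset.mem_univ _)]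
    simp only [e5]
    rw [Finset.sum_comm]
    simp only [Finset.mul_sum]
  rw [hright]
  push_cast
  rw [hsq v]
  have := hne v
  field_simp

theorem creation_eq (hμ : IsPerronFrobenius G β μ) (v : V) (l : List V) :
    hat (creation G μ v) l =
      ∑ u, if G.Adj v u ∧ l = [v, u, v] then (√(μ u) / √(μ v) : ℂ) else 0 := by
  rw [creation, map_sum, Finsupp.finsetSum_apply]
  refine Finset.sum_congr rfl fun u _ => ?_
  split_ifs with h h' h'
  · rw [map_smul, Finsupp.smul_apply, hat_basisPath, pathList_backForth, if_pos h'.2.symm,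
      Real.sqrt_div (hμ.pos u).le]
    simp
  · rw [map_smul, Finsupp.smul_apply, hat_basisPath, pathList_backForth, if_neg, smul_zero]
    exact fun h'' => h' ⟨h, h''.symm⟩
  · exact absurd h'.1 h
  · simp

/-- On words of three letters this is the first exchange relation itself, the corners being the
action on paths of length zero. -/
theorem transportOp_creation (hN : IsTop G β μ N) (hμ : IsPerronFrobenius G β μ)
    (a b : Label V N) (v : V) :
    transportOp G β μ N a b (creation G μ v) =
      ∑ w, (transportOp G β μ N a b (basisPath (ElemPath.vertex G v))) (ElemPath.vertex G w) •
        creation G μ w := by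
  refine ext_hat fun l => ?_
  simp only [map_sum, map_smul, Finsupp.finsetSum_apply, Finsupp.smul_apply, creation_eq hμ,
    hat_transportOp]
  have e : ∀ w, transportOp G β μ N a b (basisPath (ElemPath.vertex G v))
      (ElemPath.vertex G w) = (corner G β μ N w v a b : ℂ) := by
    intro w
    rw [← hat_pathList, hat_transportOp_basisPath, pathList_vertex, pathList_vertex,
      transport_singleton]
  simp only [e]
  by_cases hl : l.length = 3
  swap
  · rw [Finset.sum_eq_zero, Finset.sum_eq_zero]
    · intro w _
      rw [Finset.sum_eq_zero, smul_zero]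
      intro u _
      rw [if_neg]
      rintro ⟨-, rfl⟩
      simp at hl
    · intro k hk
      rw [Finset.sum_eq_zero, mul_zero]
      intro u _
      rw [if_neg]
      rintro ⟨-, rfl⟩
      rw [mem_words] at hk
      exact hl hk.symm
  obtain ⟨w₁, u₁, w₂, rfl⟩ := List.length_eq_three.1 hl
  rw [hl]
  simp only [sum_words_succ, sum_words_zero]
  have h := congrArg (fun A => ((A a b : ℝ) : ℂ)) (hN.sum_cell_mul_cell hμ w₂ u₁ w₁ v)
  simp only [Matrix.sum_apply, Matrix.smul_apply, Complex.ofReal_sum, smul_eq_mul,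
        Complex.ofReal_mul, Complex.ofReal_div] at h
  have e1 : ∀ x y z, (transport G β μ N [w₁, u₁, w₂] [x, y, z] a b : ℂ) *
      ∑ u, (if G.Adj v u ∧ [x, y, z] = [v, u, v] then (√(μ u) / √(μ v) : ℂ) else 0) =
      if z = v then if x = v then (√(μ y) / √(μ v) : ℂ) *
        ((cell G β μ N w₁ u₁ v y * cell G β μ N u₁ w₂ y v) a b : ℝ) else 0 else 0 := by
    intro x y z
    split_ifs with h1 h2
    · subst h1
      subst h2
      rw [Finset.sum_eq_single y]
      · rw [transport_cons_cons, transport_cons_cons, transport_singleton,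
          hN.cell_mul_corner hμ]
        by_cases hy : G.Adj x y
        · rw [if_pos ⟨hy, rfl⟩, mul_comm]
        · rw [cell_eq_zero_right _ _ hy, zero_mul]
          simp
      · intro u _ hu
        rw [if_neg]
        rintro ⟨-, h⟩
        simp only [List.cons.injEq] at h
        exact hu h.2.1.symm
      · simp
    · rw [Finset.sum_eq_zero, mul_zero]
      intro u _
      rw [if_neg]
      rintro ⟨-, h⟩
      simp only [List.cons.injEq] at h
      exact h2 h.1
    · rw [Finset.sum_eq_zero, mul_zero]
      intro u _
      rw [if_neg]
      rintro ⟨-, h⟩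
      simp only [List.cons.injEq] at h
      exact h1 h.2.2.1
  simp only [e1, Finset.sum_ite_eq', Finset.mem_univ, if_true]
  rw [Finset.sum_comm]
  simp only [Finset.sum_ite_eq', Finset.mem_univ, if_true]
  rw [h, Finset.sum_eq_single w₂]
  · rw [Finset.sum_eq_single u₁]
    · by_cases hw : w₁ = w₂ ∧ G.Adj w₂ u₁
      · rw [if_pos hw, if_pos ⟨hw.2, by rw [hw.1]⟩]
        simp [mul_comm]
      · rw [if_neg hw, if_neg]
        · simp
        · rintro ⟨h1, h2⟩
          simp only [List.cons.injEq] at h2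
          exact hw ⟨h2.1, h1⟩
    · intro u _ hu
      rw [if_neg]
      rintro ⟨-, h⟩
      simp only [List.cons.injEq] at h
      exact hu h.2.1.symm
    · simp
  · intro w _ hw
    rw [Finset.sum_eq_zero, smul_zero]
    intro u _
    rw [if_neg]
    rintro ⟨-, h⟩
    simp only [List.cons.injEq] at h
    exact hw h.2.2.1.symm
  · simp

/-- The family of symmetry operators given by the transport matrices. -/
def transportFamily (hN : IsTop G β μ N) (hμ : IsPerronFrobenius G β μ) :
    SymmetryFamily G β μ (Fin (Fintype.card (Label V N))) where
  -- The label set of a family must lie in `Type`, whereas `Label V N` lives in the universe of V;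
  -- hence the detour through `Fin`.
  init a := ((Fintype.equivFin (Label V N)).symm a).initial
  fin a := ((Fintype.equivFin (Label V N)).symm a).final
  flip a := Fintype.equivFin (Label V N) ((Fintype.equivFin (Label V N)).symm a).swap
  flip_flip a := by simp [Label.swap_swap]
  init_flip a := by
    rw [Equiv.symm_apply_apply]
    rfl
  fin_flip a := by
    rw [Equiv.symm_apply_apply]
    rfl
  T a b := transportOp G β μ N ((Fintype.equivFin (Label V N)).symm a)
    ((Fintype.equivFin (Label V N)).symm b)
  mapsTo a b f _ := transportOp_mem_endpointSpace hN hμ _ _ f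
  eq_zero a b v w h f hf := transportOp_eq_zero hN hμ _ _ h hf
  length a b n f hf := transportOp_mem_lengthSpace _ _ hf
  continuity a b f g := by
    rw [transportOp_concat hN hμ]
    exact (Equiv.sum_comp (Fintype.equivFin (Label V N)).symm fun c =>
      concat G (transportOp G β μ N _ c f) (transportOp G β μ N c _ g)).symm
  hermitian a b f g := by
    rw [Equiv.symm_apply_apply, Equiv.symm_apply_apply]
    exact pathInner_transportOp _ _ f g
  involution a b f := transportOp_pathStar hN hμ _ _ f
  evolution a b i f := transportOp_jones hN hμ _ _ i f
  normalised a b v := transportOp_creation hN hμ _ _ v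

theorem transportOp_mem_symmetrySpan (hN : IsTop G β μ N) (hμ : IsPerronFrobenius G β μ)
    (a b : Label V N) : transportOp G β μ N a b ∈ symmetrySpan G β μ := by
  refine Submodule.subset_span ⟨_, inferInstance, transportFamily hN hμ,
    Fintype.equivFin (Label V N) a, Fintype.equivFin (Label V N) b, ?_⟩
  simp [transportFamily]

end Evolution

/-! ### Transport applied to a vector of length zero -/

section Cyclic

variable {V : Type*} [Fintype V] [DecidableEq V] {G : SimpleGraph V} [DecidableRel G.Adj]
  {β : ℝ} {μ : V → ℝ} {N : ℕ} {E : Type*} [AddCommGroup E] [Module ℝ E]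

/-- The fourth root of the component of `μ` at the first letter of a word. -/
def headWeight (μ : V → ℝ) (l : List V) : ℝ := (l.head?.map fun w => √√(μ w)).getD 0

theorem headWeight_cons (w : V) (l : List V) : headWeight μ (w :: l) = √√(μ w) := rfl

theorem headWeight_pos (hμ : IsPerronFrobenius G β μ) {l : List V} (h : l ≠ []) :
    0 < headWeight μ l := by
  obtain ⟨w, l, rfl⟩ := List.exists_cons_of_ne_nil h
  exact Real.sqrt_pos.2 (Real.sqrt_pos.2 (hμ.pos w))

theorem headWeight_congr {l k : List V} (h : l.head? = k.head?) :
    headWeight μ l = headWeight μ k := by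
  rw [headWeight, headWeight, h]

/-- The annihilating half of a cell contributes nothing on essential functions. Indeed the squared
head weight is `√(μ u)` for the first letter u of q, and the kernel restores the value of x at `w u
w …`, so the sum over u is a cap. -/
theorem IsEssential.sum_cap {x : List V → E} (h : IsEssential G μ x) (n : ℕ) (w : V)
    (p : List V) : ∑ q ∈ words V (n + 1), (headWeight μ q * headWeight μ q *
      jw G β μ n q (q.take 1 ++ w :: p)) • x (w :: q) = 0 := by
  by_cases hp : (w :: p).length = n
  · rw [sum_words_succ, ← h.cap [] w p]
    refine Finset.sum_congr rfl fun u _ => ?_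
    rw [List.nil_append, ← (h.cons w).sum_jw β n (u :: w :: p) (by simp [← hp]),
      sum_words_succ_of_head _ u, Finset.smul_sum]
    · refine Finset.sum_congr rfl fun q _ => ?_
      rw [headWeight_cons, Real.mul_self_sqrt (Real.sqrt_nonneg _), mul_smul, jw_comm]
      rfl
    · intro a l ha
      rw [jw_eq_zero_of_head G β μ _ _ ha.symm, zero_smul]
  · refine Finset.sum_eq_zero fun q hq => ?_
    rw [jw_comm, jw_eq_zero_of_length, mul_zero, zero_smul]
    rw [mem_words] at hq
    simp only [List.length_append, List.length_take, hq]
    simp only [List.length_cons] at hp ⊢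
    omega

/-- The vector on which the operators with cyclic labels are built. -/
def cyclic (μ : V → ℝ) (N : ℕ) (b : Label V N) : ℝ :=
  if (b.1 : ℕ) = 0 then headWeight μ b.2.1.1 * headWeight μ b.2.2.1 else 0

/-- The sums over the cyclic labels of the entries of the transport matrices. -/
def cyclicTransport (G : SimpleGraph V) [DecidableRel G.Adj] (β : ℝ) (μ : V → ℝ) (N : ℕ)
    (l k : List V) : Label V N → ℝ :=
  (transport G β μ N l k).mulVec (cyclic μ N)

/-- The scalar by which a prolongation of `n` steps is rescaled. -/
def gain (β : ℝ) : ℕ → ℝ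
  | 0 => 1
  | n + 1 => √(ratio β (n + 1))⁻¹ * gain β n

theorem IsTop.gain_ne_zero (hN : IsTop G β μ N) {n : ℕ} (hn : n ≤ N) : gain β n ≠ 0 := by
  induction n with
  | zero => exact one_ne_zero
  | succ n ih =>
    exact mul_ne_zero (Real.sqrt_pos.2 (inv_pos.2 (hN.ratio_pos _ (Nat.succ_pos _) hn))).ne'
      (ih (by omega))

theorem cyclicTransport_singleton (w v : V) (a : Label V N) :
    cyclicTransport G β μ N [w] [v] a =
      if (a.1 : ℕ) = 0 ∧ a.2.1.1 = [w] ∧ a.2.2.1 = [v] then √√(μ w) * √√(μ v) else 0 := by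
  have hf : ∀ b : Label V N, corner G β μ N w v a b * cyclic μ N b =
      if b = a then (if (a.1 : ℕ) = 0 ∧ a.2.1.1 = [w] ∧ a.2.2.1 = [v] then
        √√(μ w) * √√(μ v) else 0) else 0 := by
    rintro ⟨⟨m, hm⟩, ⟨q, hq⟩, ⟨q', hq'⟩⟩
    obtain ⟨⟨n, hn⟩, ⟨p, hp⟩, ⟨p', hp'⟩⟩ := a
    simp only [corner, cyclic]
    rw [mem_words] at hq hq' hp hp'
    dsimp only at hq hq' hp hp'
    by_cases hm0 : m = 0
    · subst hm0
      by_cases hn0 : n = 0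
      · subst hn0
        obtain ⟨s, rfl⟩ := List.length_eq_one_iff.1 hp
        obtain ⟨s', rfl⟩ := List.length_eq_one_iff.1 hp'
        obtain ⟨t, rfl⟩ := List.length_eq_one_iff.1 hq
        obtain ⟨t', rfl⟩ := List.length_eq_one_iff.1 hq'
        by_cases ht : s = t ∧ s' = t'
        · obtain ⟨rfl, rfl⟩ := ht
          by_cases hs : s = w ∧ s' = v
          · simp [jw, headWeight, hs.1, hs.2]
          · simp [hs]
        · rw [if_neg (c := (⟨_, _⟩ : Label V N) = _) fun h => ht ?_]
          swap
          · have h1 := congrArg (fun b : Label V N => b.2.1.1) h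
            have h2 := congrArg (fun b : Label V N => b.2.2.1) h
            simpa [eq_comm] using And.intro h1 h2
          by_cases h1 : s = t
          · have h2 : s' ≠ t' := fun h2 => ht ⟨h1, h2⟩
            simp [jw, h2]
          · simp [jw, h1]
      · rw [jw_comm, jw_eq_zero_of_length (by omega)]
        simp [hn0]
    · rw [if_neg hm0, mul_zero]
      symm
      rw [ite_eq_right_iff]
      intro h
      cases h
      rw [if_neg (by tauto)]
  rw [cyclicTransport, transport_singleton, Matrix.mulVec, dotProduct]
  simp only [hf]
  simp

/-- Where the remaining transport is nonzero, the heads of the label c are those of the remaining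
paths. The cell can thus be written in terms of c alone, so that a later sum over the remaining
paths leaves it untouched. -/
theorem IsTop.cyclicTransport_cons_cons (hN : IsTop G β μ N) (hμ : IsPerronFrobenius G β μ)
    (w v : V) {l k : List V} (hl : l ≠ []) (hk : k ≠ []) (a : Label V N) :
    cyclicTransport G β μ N (w :: l) (v :: k) a = ∑ c : Label V N,
      (√(ratio β a.1)⁻¹ * (√√(μ w) * √√(μ v) / (headWeight μ c.2.1.1 * headWeight μ c.2.2.1)) *
        (jw G β μ a.1 a.2.1.1 (w :: c.2.1.1) * jw G β μ a.1 a.2.2.1 (v :: c.2.2.1)) +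
      if a.2.1.1.head? = some w ∧ a.2.2.1.head? = some v then
        √(ratio β c.1)⁻¹ * (headWeight μ c.2.1.1 * headWeight μ c.2.2.1 / (√√(μ w) * √√(μ v))) *
        (jw G β μ c.1 c.2.1.1 (c.2.1.1.take 1 ++ a.2.1.1) *
          jw G β μ c.1 c.2.2.1 (c.2.2.1.take 1 ++ a.2.2.1)) else 0) *
        cyclicTransport G β μ N l k c := by
  obtain ⟨w', l, rfl⟩ := List.exists_cons_of_ne_nil hl
  obtain ⟨v', k, rfl⟩ := List.exists_cons_of_ne_nil hk
  rw [cyclicTransport, transport_cons_cons, ← Matrix.mulVec_mulVec, Matrix.mulVec, dotProduct]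
  refine Finset.sum_congr rfl fun c _ => ?_
  change _ * cyclicTransport G β μ N (w' :: l) (v' :: k) c = _
  by_cases h : cyclicTransport G β μ N (w' :: l) (v' :: k) c = 0
  · rw [h, mul_zero, mul_zero]
  · obtain ⟨b, -, hb⟩ := Finset.exists_ne_zero_of_sum_ne_zero h
    obtain ⟨h1, h2⟩ := hN.transport_ne_zero_head hμ (left_ne_zero_of_mul hb)
    obtain ⟨q, hq⟩ : ∃ q, c.2.1.1 = w' :: q :=
      ⟨_, (List.cons_head?_tail h1.symm).symm⟩
    obtain ⟨q', hq'⟩ : ∃ q, c.2.2.1 = v' :: q :=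
      ⟨_, (List.cons_head?_tail h2.symm).symm⟩
    congr 1
    simp only [cell, rise, hq, hq', headWeight_cons]
    simp

/-- Summed against a function which is essential in both arguments, the transport matrices with
cyclic labels give back the values of that function. -/
theorem IsTop.sum_cyclicTransport (hN : IsTop G β μ N) (hμ : IsPerronFrobenius G β μ)
    {n : ℕ} (hn : n ≤ N) (z : List V → List V → E) (h₁ : ∀ k, IsEssential G μ fun l => z l k)
    (h₂ : ∀ l, IsEssential G μ (z l)) (a : Label V N) :
    ∑ l ∈ words V (n + 1), ∑ k ∈ words V (n + 1),
        cyclicTransport G β μ N l k a • z l k =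
      if (a.1 : ℕ) = n then (gain β n * (headWeight μ a.2.1.1 * headWeight μ a.2.2.1)) •
        z a.2.1.1 a.2.2.1 else 0 := by
  induction n generalizing z a with
  | zero =>
    simp only [sum_words_succ, sum_words_zero, cyclicTransport_singleton]
    by_cases ha : (a.1 : ℕ) = 0
    · obtain ⟨s, hs⟩ := List.length_eq_one_iff.1 (a.length_fst.trans (by rw [ha]))
      obtain ⟨t, ht⟩ := List.length_eq_one_iff.1 (a.length_snd.trans (by rw [ha]))
      rw [Finset.sum_eq_single s, Finset.sum_eq_single t]
      · simp [ha, hs, ht, gain, headWeight_cons]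
      · intro b _ hb
        simp [ht, hb.symm]
      · simp
      · intro b _ hb
        simp [hs, hb.symm]
      · simp
    · simp [ha]
  | succ n ih =>
    have hne : ∀ l ∈ words V (n + 1), l ≠ [] := by
      rintro l hl rfl
      simp [mem_words] at hl
    set p := a.2.1.1 with hp
    set p' := a.2.2.1 with hp'
    -- With the first letters fixed, the induction hypothesis evaluates the sum over the tails. The
    -- head weights it yields cancel the denominators of the prolongation.
    have step : ∀ w v, ∑ l ∈ words V (n + 1), ∑ k ∈ words V (n + 1),
        cyclicTransport G β μ N (w :: l) (v :: k) a • z (w :: l) (v :: k) =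
        ∑ q ∈ words V (n + 1), ∑ q' ∈ words V (n + 1),
          (√(ratio β a.1)⁻¹ * (√√(μ w) * √√(μ v)) * gain β n *
            (jw G β μ a.1 p (w :: q) * jw G β μ a.1 p' (v :: q'))) • z (w :: q) (v :: q') := by
      intro w v
      set κ := √√(μ w) * √√(μ v) with hκ
      have hκ0 : κ ≠ 0 := (mul_pos (Real.sqrt_pos.2 (Real.sqrt_pos.2 (hμ.pos w)))
        (Real.sqrt_pos.2 (Real.sqrt_pos.2 (hμ.pos v)))).ne'
      have e1 : ∀ l ∈ words V (n + 1), ∀ k ∈ words V (n + 1),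
          cyclicTransport G β μ N (w :: l) (v :: k) a • z (w :: l) (v :: k) =
          ∑ c : Label V N,
            (√(ratio β a.1)⁻¹ * (κ / (headWeight μ c.2.1.1 * headWeight μ c.2.2.1)) *
              (jw G β μ a.1 p (w :: c.2.1.1) * jw G β μ a.1 p' (v :: c.2.2.1)) +
            if p.head? = some w ∧ p'.head? = some v then
              √(ratio β c.1)⁻¹ * (headWeight μ c.2.1.1 * headWeight μ c.2.2.1 / κ) *
              (jw G β μ c.1 c.2.1.1 (c.2.1.1.take 1 ++ p) *
                jw G β μ c.1 c.2.2.1 (c.2.2.1.take 1 ++ p')) else 0) •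
            cyclicTransport G β μ N l k c • z (w :: l) (v :: k) := by
        intro l hl k hk
        rw [hN.cyclicTransport_cons_cons hμ w v (hne l hl) (hne k hk), Finset.sum_smul]
        simp only [mul_smul, hκ, hp, hp']
      rw [Finset.sum_congr rfl fun l hl => Finset.sum_congr rfl fun k hk => e1 l hl k hk]
      simp only [Finset.sum_comm (s := words V (n + 1)) (t := (Finset.univ : Finset (Label V N)))]
      simp only [← Finset.smul_sum]
      simp only [ih (by omega) (fun l k => z (w :: l) (v :: k)) (fun k => (h₁ (v :: k)).cons w)
        (fun l => (h₂ (w :: l)).cons v)]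
      -- D is the contribution of the annihilating half of the cell and U that of the prolonging
      -- half.
      set D : List V → List V → E := fun q q' => if p.head? = some w ∧ p'.head? = some v then
        (√(ratio β n)⁻¹ * gain β n / κ) • (headWeight μ q' * headWeight μ q' *
          jw G β μ n q' (q'.take 1 ++ p')) • (headWeight μ q * headWeight μ q *
          jw G β μ n q (q.take 1 ++ p)) • z (w :: q) (v :: q') else 0 with hD
      set U : List V → List V → E := fun q q' => (√(ratio β a.1)⁻¹ * κ * gain β n *
        (jw G β μ a.1 p (w :: q) * jw G β μ a.1 p' (v :: q'))) • z (w :: q) (v :: q') with hU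
      have e2 := sum_label_words (N := N) (m := n) (by omega)
        (fun q q' => if q.length = n + 1 then U q q' + D q q' else 0)
        fun q q' hq => if_neg hq
      -- Essentiality of z in its first argument is already enough to kill the annihilations.
      have e3 : ∑ q ∈ words V (n + 1), ∑ q' ∈ words V (n + 1), D q q' = 0 := by
        by_cases hc : p.head? = some w ∧ p'.head? = some v
        · simp only [hD, if_pos hc]
          rw [Finset.sum_comm]
          refine Finset.sum_eq_zero fun q' _ => ?_
          obtain ⟨r, hr⟩ : ∃ r, p = w :: r := ⟨_, (List.cons_head?_tail hc.1).symm⟩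
          simp only [← Finset.smul_sum]
          rw [hr, (h₁ (v :: q')).sum_cap (β := β) n w r, smul_zero, smul_zero]
        · simp [hD, hc]
      trans ∑ c : Label V N, if c.2.1.1.length = n + 1 then
        U c.2.1.1 c.2.2.1 + D c.2.1.1 c.2.2.1 else 0
      · refine Finset.sum_congr rfl fun c _ => ?_
        by_cases hc : (c.1 : ℕ) = n
        · rw [if_pos hc, if_pos (c.length_fst.trans (by rw [hc]))]
          have hq := (headWeight_pos hμ (hne c.2.1.1 (hc ▸ c.2.1.2))).ne'
          have hq' := (headWeight_pos hμ (hne c.2.2.1 (hc ▸ c.2.2.2))).ne'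
          rw [add_smul]
          congr 1
          · rw [hU, smul_smul]
            congr 1
            field_simp
          · simp only [hD, hc]
            split_ifs
            · simp only [smul_smul]
              congr 1
              field_simp
            · rw [zero_smul]
        · have hc' : c.2.1.1.length ≠ n + 1 := by
            rw [c.length_fst]
            omega
          rw [if_neg hc, if_neg hc', smul_zero]
      · rw [e2, ← add_zero (∑ q ∈ words V (n + 1), ∑ q' ∈ words V (n + 1), U q q'), ← e3,
          ← Finset.sum_add_distrib]
        refine Finset.sum_congr rfl fun q hq => ?_
        rw [← Finset.sum_add_distrib]
        exact Finset.sum_congr rfl fun q' _ => if_pos (mem_words.1 hq)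
    have e4 : ∑ l ∈ words V (n + 1 + 1), ∑ k ∈ words V (n + 1 + 1),
        cyclicTransport G β μ N l k a • z l k = ∑ l ∈ words V (n + 1 + 1),
          ∑ k ∈ words V (n + 1 + 1), (√(ratio β a.1)⁻¹ * (headWeight μ l * headWeight μ k) *
            gain β n * (jw G β μ a.1 p l * jw G β μ a.1 p' k)) • z l k := by
      simp only [sum_words_succ (n + 1)]
      simp only [Finset.sum_comm (s := words V (n + 1)) (t := (Finset.univ : Finset V))]
      exact Finset.sum_congr rfl fun w _ => Finset.sum_congr rfl fun v _ => step w v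
    rw [e4]
    by_cases ha : (a.1 : ℕ) = n + 1
    · rw [if_pos ha, ha]
      have hlp : p.length = n + 1 + 1 := by rw [hp, a.length_fst, ha]
      have hlp' : p'.length = n + 1 + 1 := by rw [hp', a.length_snd, ha]
      -- What is left applies P_{n+1} to both arguments of z, which fixes z.
      have e5 := (h₁ p').sum_jw β (n + 1) p hlp
      rw [← e5, Finset.smul_sum]
      refine Finset.sum_congr rfl fun l _ => ?_
      rw [← (h₂ l).sum_jw β (n + 1) p' hlp', Finset.smul_sum, Finset.smul_sum]
      refine Finset.sum_congr rfl fun k _ => ?_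
      simp only [smul_smul]
      by_cases hl : jw G β μ (n + 1) p l = 0
      · simp [hl]
      by_cases hk : jw G β μ (n + 1) p' k = 0
      · simp [hk]
      rw [headWeight_congr (jw_ne_zero G β μ hl).2.2, headWeight_congr (jw_ne_zero G β μ hk).2.2,
        gain]
      congr 1
      ring
    · rw [if_neg ha]
      refine Finset.sum_eq_zero fun l hl => Finset.sum_eq_zero fun k _ => ?_
      rw [jw_comm G β μ _ p, jw_eq_zero_of_length (p := l)]
      · simp
      · rw [mem_words.1 hl]
        omega

end Cyclic

/-! ### Essential paths and surjectivity of the restriction -/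

section Essential

variable {V : Type*} [Fintype V] [DecidableEq V] {G : SimpleGraph V} [DecidableRel G.Adj]
  {β : ℝ} {μ : V → ℝ} {N : ℕ}

theorem IsPerronFrobenius.ne_zero_of_adj (hμ : IsPerronFrobenius G β μ) {v u : V}
    (h : G.Adj v u) : β ≠ 0 := by
  rintro rfl
  have h1 := hμ.sum_adj v
  rw [zero_mul, Finset.sum_eq_zero_iff_of_nonneg] at h1
  · have := h1 u (Finset.mem_univ _)
    rw [if_pos h] at this
    exact (hμ.pos u).ne' this
  · intro w _
    split_ifs
    · exact (hμ.pos w).le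
    · exact le_rfl

/-- If v has a neighbour then β ≠ 0, and the cup in the Jones projection has a nonzero coefficient,
so the cap itself must vanish. If v has no neighbour, no path passes through the corner. -/
theorem mem_essential (hμ : IsPerronFrobenius G β μ) {f : PathSpace G} :
    f ∈ essential G β μ ↔ IsEssential G μ (hat f) := by
  rw [essential, Submodule.mem_iInf]
  simp only [LinearMap.mem_ker]
  constructor
  · intro h
    refine ⟨fun l hl => hat_eq_zero_of_not_isChain f hl, fun k v l => ?_⟩
    by_cases hv : ∃ u, G.Adj v u
    · obtain ⟨u, hu⟩ := hv
      have h1 := hat_jones hμ f k v u v l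
      rw [h k.length, if_pos ⟨rfl, hu⟩, map_zero, Finsupp.zero_apply] at h1
      simp only [Complex.real_smul]
      refine (mul_eq_zero.1 h1.symm).resolve_left ?_
      refine Complex.ofReal_ne_zero.2 ?_
      exact mul_ne_zero (one_div_ne_zero (hμ.ne_zero_of_adj hu))
        (div_pos (Real.sqrt_pos.2 (hμ.pos u)) (hμ.pos v)).ne'
    · refine Finset.sum_eq_zero fun u _ => ?_
      rw [hat_eq_zero_of_not_isChain, smul_zero]
      rw [List.isChain_append_cons_cons]
      exact fun h => hv ⟨u, h.2.1⟩
  · intro h i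
    refine ext_hat fun l => ?_
    rw [map_zero, Finsupp.zero_apply]
    by_cases hl : l.length < i + 3
    · exact hat_jones_eq_zero _ hl
    · obtain ⟨x, v, u, w, y, rfl, rfl⟩ := exists_append_three (not_lt.1 hl)
      rw [hat_jones hμ]
      split_ifs
      · have := h.cap x v y
        simp only [Complex.real_smul] at this
        rw [this, mul_zero]
      · rfl

/-- Essential functions vanish on long words. -/
theorem IsTop.eq_zero_of_isEssential (hN : IsTop G β μ N) {E : Type*} [AddCommGroup E]
    [Module ℝ E] {x : List V → E} (h : IsEssential G μ x) {l : List V} (hl : N + 2 ≤ l.length) :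
    x l = 0 := by
  induction l generalizing x with
  | nil => simp at hl
  | cons a l ih =>
    rcases hl.eq_or_lt with hl | hl
    · rw [← h.sum_jw β (N + 1) _ hl.symm]
      exact Finset.sum_eq_zero fun q _ => by rw [hN.jw_eq_zero, zero_smul]
    · exact ih (h.cons a) (by simpa using hl)

theorem IsEssential.smul {E : Type*} [AddCommGroup E] [Module ℝ E] {x : List V → ℝ}
    (h : IsEssential G μ x) (e : E) : IsEssential G μ fun l => x l • e where
  chain l hl := by rw [h.chain l hl, zero_smul]
  cap k v l := by
    simp only [smul_smul, ← Finset.sum_smul]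
    have := h.cap k v l
    simp only [smul_eq_mul] at this
    rw [this, zero_smul]

theorem IsEssential.const_smul {E : Type*} [AddCommGroup E] [Module ℝ E] {x : List V → E}
    (h : IsEssential G μ x) (c : ℝ) : IsEssential G μ fun l => c • x l where
  chain l hl := by rw [h.chain l hl, smul_zero]
  cap k v l := by
    simp only [smul_comm _ c, ← Finset.smul_sum]
    rw [h.cap k v l, smul_zero]

theorem hat_filter (f : PathSpace G) (n : ℕ) (l : List V) :
    hat (f.filter fun ξ => ξ.len = n) l = if l.length = n + 1 then hat f l else 0 := by
  by_cases hc : l.IsChain G.Adj ∧ l ≠ []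
  · obtain ⟨ξ, rfl⟩ := exists_pathList hc.1 hc.2
    rw [hat_pathList, hat_pathList, length_pathList, Finsupp.filter_apply]
    refine if_congr ?_ rfl rfl
    rw [ElemPath.len, add_left_inj]
  · have : ∀ g : PathSpace G, hat g l = 0 := fun g => by
      by_cases h : l = []
      · rw [h, hat_nil]
      · exact hat_eq_zero_of_not_isChain _ fun h' => hc ⟨h', h⟩
    rw [this, this, ite_self]

theorem filter_mem_lengthSpace (f : PathSpace G) (n : ℕ) :
    (f.filter fun ξ => ξ.len = n) ∈ lengthSpace G n :=
  mem_lengthSpace.2 fun l hl => by rw [hat_filter, if_neg hl]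

theorem filter_mem_essential (hμ : IsPerronFrobenius G β μ) {f : PathSpace G}
    (hf : f ∈ essential G β μ) (n : ℕ) :
    (f.filter fun ξ => ξ.len = n) ∈ essential G β μ := by
  rw [mem_essential hμ] at hf ⊢
  refine ⟨fun l hl => hat_eq_zero_of_not_isChain _ hl, fun k v l => ?_⟩
  simp only [hat_filter, List.length_append, List.length_cons]
  split_ifs
  · exact hf.cap k v l
  · simp

/-- Homogeneous components of length above N vanish because P_{N+1} = 0. -/
theorem IsTop.sum_filter (hN : IsTop G β μ N) (hμ : IsPerronFrobenius G β μ) {f : PathSpace G}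
    (hf : f ∈ essential G β μ) :
    ∑ n ∈ Finset.range (N + 1), (f.filter fun ξ => ξ.len = n) = f := by
  refine ext_hat fun l => ?_
  rw [map_sum, Finsupp.finsetSum_apply]
  simp only [hat_filter]
  by_cases hl : l = []
  · simp [hl, hat_nil]
  obtain ⟨n, hn⟩ : ∃ n, l.length = n + 1 :=
    ⟨l.length - 1, by have := List.length_pos_iff.2 hl; omega⟩
  simp only [hn, add_left_inj]
  rw [Finset.sum_ite_eq]
  split_ifs with h
  · rfl
  · rw [hN.eq_zero_of_isEssential ((mem_essential hμ).1 hf)]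
    rw [Finset.mem_range] at h
    omega

variable (G β μ) in
/-- The columns of the Jones-Wenzl projection, as elements of the space of paths. -/
def jwPath (n : ℕ) (q : List V) : PathSpace G :=
  ∑ η : PathN G n, (jw G β μ n (pathList ⟨n, η⟩) q : ℂ) • basisPath ⟨n, η⟩

theorem hat_jwPath (n : ℕ) (q l : List V) : hat (jwPath G β μ n q) l = jw G β μ n l q := by
  rw [jwPath, map_sum, Finsupp.finsetSum_apply]
  simp only [map_smul, Finsupp.smul_apply, hat_basisPath, smul_eq_mul]
  rw [sum_pathN n fun k => (jw G β μ n k q : ℂ) * if k = l then 1 else 0]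
  · simp only [mul_ite, mul_one, mul_zero]
    rw [Finset.sum_ite_eq']
    split_ifs with h
    · rfl
    · rw [jw_eq_zero_of_length fun h' => h (mem_words.2 h'), Complex.ofReal_zero]
  · intro k hk
    by_cases h : jw G β μ n k q = 0
    · simp [h]
    · exact absurd (jw_ne_zero G β μ h).2.1 hk

theorem IsTop.jwPath_mem_essential (hN : IsTop G β μ N) (hμ : IsPerronFrobenius G β μ) {n : ℕ}
    (hn : n ≤ N) (q : List V) : jwPath G β μ n q ∈ essential G β μ := by
  rw [mem_essential hμ]
  have := (hN.isEssential hμ (hn.trans (Nat.le_succ N)) q).smul (1 : ℂ)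
  convert this using 2 with l
  rw [hat_jwPath, Complex.real_smul, mul_one]

/-- An essential path of length `n` is a combination of the columns of the Jones-Wenzl
projection. -/
theorem sum_smul_jwPath (hμ : IsPerronFrobenius G β μ) {n : ℕ} {f : PathSpace G}
    (hf : f ∈ essential G β μ) (hfn : f ∈ lengthSpace G n) :
    ∑ q ∈ words V (n + 1), hat f q • jwPath G β μ n q = f := by
  refine ext_hat fun l => ?_
  rw [map_sum, Finsupp.finsetSum_apply]
  by_cases hl : l.length = n + 1
  · rw [← ((mem_essential hμ).1 hf).sum_jw β n l hl]
    refine Finset.sum_congr rfl fun q _ => ?_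
    rw [map_smul, Finsupp.smul_apply, hat_jwPath, Complex.real_smul, smul_eq_mul, mul_comm]
  · rw [mem_lengthSpace.1 hfn l hl]
    refine Finset.sum_eq_zero fun q _ => ?_
    rw [map_smul, Finsupp.smul_apply, hat_jwPath, jw_eq_zero_of_length hl, Complex.ofReal_zero,
      smul_zero]

variable (G β μ N) in
/-- The operators with cyclic second label. -/
def cyclicOp (a : Label V N) : Module.End ℂ (PathSpace G) :=
  ∑ b, (cyclic μ N b : ℂ) • transportOp G β μ N a b

theorem IsTop.cyclicOp_mem_symmetrySpan (hN : IsTop G β μ N) (hμ : IsPerronFrobenius G β μ)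
    (a : Label V N) : cyclicOp G β μ N a ∈ symmetrySpan G β μ :=
  Submodule.sum_mem _ fun b _ => Submodule.smul_mem _ _ (transportOp_mem_symmetrySpan hN hμ a b)

theorem hat_cyclicOp (a : Label V N) (f : PathSpace G) (l : List V) :
    hat (cyclicOp G β μ N a f) l =
      ∑ k ∈ words V l.length, (cyclicTransport G β μ N l k a : ℂ) * hat f k := by
  rw [cyclicOp, LinearMap.sum_apply, map_sum, Finsupp.finsetSum_apply]
  simp only [LinearMap.smul_apply, map_smul, Finsupp.smul_apply, hat_transportOp,
    cyclicTransport, Matrix.mulVec, dotProduct, Complex.ofReal_sum, Complex.ofReal_mul,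
    Finset.sum_mul, smul_eq_mul, Finset.mul_sum]
  rw [Finset.sum_comm]
  refine Finset.sum_congr rfl fun k _ => Finset.sum_congr rfl fun b _ => ?_
  ring

theorem IsTop.cyclicOp_mem_essential (hN : IsTop G β μ N) (hμ : IsPerronFrobenius G β μ)
    (a : Label V N) {f : PathSpace G} (hf : f ∈ essential G β μ) :
    cyclicOp G β μ N a f ∈ essential G β μ := by
  rw [cyclicOp, LinearMap.sum_apply]
  refine Submodule.sum_mem _ fun b _ => Submodule.smul_mem _ _ ?_
  rw [essential, Submodule.mem_iInf] at hf ⊢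
  intro i
  rw [LinearMap.mem_ker, ← transportOp_jones hN hμ, LinearMap.mem_ker.1 (hf i), map_zero]

/-- The action of the operators with cyclic second label on essential paths. -/
theorem IsTop.cyclicOp_apply (hN : IsTop G β μ N) (hμ : IsPerronFrobenius G β μ)
    (a : Label V N) {n : ℕ} (hn : n ≤ N) {f : PathSpace G} (hf : f ∈ essential G β μ)
    {l : List V} (hl : l.length = n + 1) :
    hat (cyclicOp G β μ N a f) l = if (a.1 : ℕ) = n then
      ((gain β n * (headWeight μ a.2.1.1 * headWeight μ a.2.2.1) : ℝ) : ℂ) *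
        (jw G β μ n l a.2.1.1 * hat f a.2.2.1) else 0 := by
  have h1 := (mem_essential hμ).1 (hN.cyclicOp_mem_essential hμ a hf)
  -- The image of f is essential, so projecting it changes nothing. The projected sum pairs the
  -- cyclic transport with a function that is essential in both arguments: a kernel column in the
  -- output and f in the input.
  have h2 := hN.sum_cyclicTransport hμ hn (fun q k => jw G β μ n q l • hat f k)
    (fun k => (hN.isEssential hμ (hn.trans (Nat.le_succ N)) l).smul _)
    (fun q => ((mem_essential hμ).1 hf).const_smul _) a
  simp only [Complex.real_smul] at h2
  rw [jw_comm G β μ n l, ← h2, ← h1.sum_jw β n l hl]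
  refine Finset.sum_congr rfl fun q hq => ?_
  rw [hat_cyclicOp, mem_words.1 hq, Complex.real_smul, Finset.mul_sum, jw_comm G β μ n l]
  exact Finset.sum_congr rfl fun k _ => by ring

/-- Every length preserving endomorphism of the essential paths is the restriction of an element
of the span of the symmetry operators. -/
theorem IsTop.exists_restriction (hN : IsTop G β μ N) (hμ : IsPerronFrobenius G β μ)
    (F : Module.End ℂ (essential G β μ)) (hF : F ∈ gradedEnd (essential G β μ)) :
    ∃ S ∈ symmetrySpan G β μ, ∀ f : essential G β μ, S f = F f := by
  -- The images under F of the projected words; the default value above N is never reached.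
  set φ : ℕ → List V → PathSpace G := fun n q =>
    if hn : n ≤ N then F ⟨jwPath G β μ n q, hN.jwPath_mem_essential hμ hn q⟩ else 0 with hφ
  set g : Label V N → ℝ := fun a =>
    gain β a.1 * (headWeight μ a.2.1.1 * headWeight μ a.2.2.1) with hg
  have hg0 : ∀ a, (g a : ℂ) ≠ 0 := fun a => by
    have h1 : ∀ l : List V, l.length = a.1 + 1 → headWeight μ l ≠ 0 := fun l hl =>
      (headWeight_pos hμ fun h => by simp [h] at hl).ne'
    rw [Complex.ofReal_ne_zero]
    exact mul_ne_zero (hN.gain_ne_zero a.le)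
      (mul_ne_zero (h1 _ a.length_fst) (h1 _ a.length_snd))
  -- On essential paths `cyclicOp` at a is `g a` times the rank-one operator that reads the
  -- coefficient at the second word and returns the projection of the first. Dividing by `g a` and
  -- weighting by the corresponding coefficient of F recovers F.
  refine ⟨∑ a, ((g a : ℂ)⁻¹ * hat (φ a.1 a.2.2.1) a.2.1.1) • cyclicOp G β μ N a,
    Submodule.sum_mem _ fun a _ => Submodule.smul_mem _ _ (hN.cyclicOp_mem_symmetrySpan hμ a),
    ?_⟩
  set S := ∑ a, ((g a : ℂ)⁻¹ * hat (φ a.1 a.2.2.1) a.2.1.1) • cyclicOp G β μ N a with hS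
  have key : ∀ n ≤ N, ∀ f : essential G β μ, (f : PathSpace G) ∈ lengthSpace G n →
      S f = F f := by
    intro n hn f hfn
    have hφ' : ∀ q, φ n q = F ⟨jwPath G β μ n q, hN.jwPath_mem_essential hμ hn q⟩ :=
      fun q => dif_pos hn
    refine ext_hat fun l => ?_
    rw [hS, LinearMap.sum_apply, map_sum, Finsupp.finsetSum_apply]
    simp only [LinearMap.smul_apply, map_smul, Finsupp.smul_apply, smul_eq_mul]
    by_cases hl : l.length = n + 1
    · have e1 : ∀ a : Label V N, (g a : ℂ)⁻¹ * hat (φ a.1 a.2.2.1) a.2.1.1 *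
          hat (cyclicOp G β μ N a f) l = if (a.1 : ℕ) = n then
            hat (f : PathSpace G) a.2.2.1 * (jw G β μ n l a.2.1.1 * hat (φ n a.2.2.1) a.2.1.1)
            else 0 := by
        intro a
        rw [hN.cyclicOp_apply hμ a hn f.2 hl]
        by_cases ha : (a.1 : ℕ) = n
        · have h1 : gain β n * (headWeight μ a.2.1.1 * headWeight μ a.2.2.1) = g a := by
            rw [hg, ← ha]
          have h2 : φ a.1 = φ n := by rw [ha]
          rw [if_pos ha, if_pos ha, h1, h2, mul_comm (g a : ℂ)⁻¹, mul_assoc,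
            inv_mul_cancel_left₀ (hg0 a)]
          ring
        · rw [if_neg ha, if_neg ha, mul_zero]
      simp only [e1]
      rw [sum_label_eq hn (fun m p q => if m = n then
        hat (f : PathSpace G) q * (jw G β μ n l p * hat (φ n q) p) else 0)
        fun m p q hm => if_neg hm]
      -- The kernel columns span the essential paths of length n but are in general linearly
      -- dependent. The expansion used is f = P_n f, whose coefficients are those of f itself.
      have e2 : f = ∑ q ∈ words V (n + 1), hat (f : PathSpace G) q •
          (⟨jwPath G β μ n q, hN.jwPath_mem_essential hμ hn q⟩ : essential G β μ) := by
        apply Subtype.ext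
        rw [AddSubmonoidClass.coe_finsetSum]
        exact (sum_smul_jwPath hμ f.2 hfn).symm
      have e3 : (F f : PathSpace G) = ∑ q ∈ words V (n + 1),
          hat (f : PathSpace G) q • φ n q := by
        conv_lhs => rw [e2]
        rw [map_sum, AddSubmonoidClass.coe_finsetSum]
        refine Finset.sum_congr rfl fun q _ => ?_
        rw [map_smul, hφ']
        rfl
      rw [e3, map_sum, Finsupp.finsetSum_apply, Finset.sum_comm]
      refine Finset.sum_congr rfl fun q _ => ?_
      simp only [if_true]
      rw [← Finset.mul_sum, map_smul, Finsupp.smul_apply, smul_eq_mul, hφ',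
        ← ((mem_essential hμ).1 (F _).2).sum_jw β n l hl]
      simp only [Complex.real_smul]
    · rw [mem_lengthSpace.1 (hF n f hfn) l hl]
      refine Finset.sum_eq_zero fun a _ => ?_
      rw [hat_cyclicOp, Finset.sum_eq_zero, mul_zero]
      intro k hk
      rw [mem_lengthSpace.1 hfn k (by rwa [mem_words.1 hk]), mul_zero]
  intro f
  set fn : ℕ → essential G β μ := fun n => ⟨_, filter_mem_essential hμ f.2 n⟩
  have hf : f = ∑ n ∈ Finset.range (N + 1), fn n := by
    apply Subtype.ext
    rw [AddSubmonoidClass.coe_finsetSum, hN.sum_filter hμ f.2]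
  rw [hf, map_sum, AddSubmonoidClass.coe_finsetSum, AddSubmonoidClass.coe_finsetSum, map_sum]
  exact Finset.sum_congr rfl fun n hn => key n (by rw [Finset.mem_range] at hn; omega) _
    (filter_mem_lengthSpace _ n)

end Essential

/-! ### Creation elements, positivity and injectivity of the restriction -/

section Restriction

variable {V : Type*} [Fintype V] [DecidableEq V] {G : SimpleGraph V} [DecidableRel G.Adj]
  {β : ℝ} {μ : V → ℝ} {N : ℕ}

theorem hat_concat_of_mem {i : ℕ} {f : PathSpace G} (hf : f ∈ lengthSpace G i) (g : PathSpace G)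
    (l : List V) : hat (concat G f g) l =
      if i < l.length then hat f (l.take (i + 1)) * hat g (l.drop i) else 0 := by
  rw [hat_concat]
  split_ifs with hi
  · refine Finset.sum_eq_single i ?_ fun h => absurd (Finset.mem_range.2 hi) h
    intro j hj hji
    rw [Finset.mem_range] at hj
    rw [mem_lengthSpace.1 hf, zero_mul]
    rw [List.length_take]
    omega
  · refine Finset.sum_eq_zero fun j hj => ?_
    rw [Finset.mem_range] at hj
    rw [mem_lengthSpace.1 hf, zero_mul]
    rw [List.length_take]
    omega

theorem creation_mem_lengthSpace (hμ : IsPerronFrobenius G β μ) (v : V) :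
    creation G μ v ∈ lengthSpace G 2 := by
  refine mem_lengthSpace.2 fun l hl => ?_
  rw [creation_eq hμ]
  refine Finset.sum_eq_zero fun u _ => if_neg ?_
  rintro ⟨-, rfl⟩
  simp at hl

theorem hat_creation (hμ : IsPerronFrobenius G β μ) (v a b c : V) :
    hat (creation G μ v) [a, b, c] =
      if a = v ∧ c = v ∧ G.Adj v b then (√(μ b) / √(μ v) : ℂ) else 0 := by
  rw [creation_eq hμ, Finset.sum_eq_single b]
  · refine if_congr ?_ rfl rfl
    simp only [List.cons.injEq]
    tauto
  · intro u _ hu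
    rw [if_neg]
    simp [hu.symm]
  · simp

variable (G μ) in
/-- The sum over all vertices of the creation operators applied to paths of length zero. -/
def totalCreation : PathSpace G := ∑ v, creation G μ v

theorem totalCreation_mem_lengthSpace (hμ : IsPerronFrobenius G β μ) :
    totalCreation G μ ∈ lengthSpace G 2 :=
  Submodule.sum_mem _ fun v _ => creation_mem_lengthSpace hμ v

theorem hat_totalCreation (hμ : IsPerronFrobenius G β μ) (a b c : V) :
    hat (totalCreation G μ) [a, b, c] =
      if a = c ∧ G.Adj a b then (√(μ b) / √(μ a) : ℂ) else 0 := by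
  rw [totalCreation, map_sum, Finsupp.finsetSum_apply, Finset.sum_eq_single a]
  · rw [hat_creation hμ]
    refine if_congr ?_ rfl rfl
    simp [eq_comm]
  · intro v _ hv
    rw [hat_creation hμ, if_neg]
    exact fun h => hv h.1.symm
  · simp

theorem hat_vertex (v : V) (l : List V) :
    hat (basisPath (ElemPath.vertex G v)) l = if l = [v] then 1 else 0 := by
  rw [hat_basisPath, pathList_vertex]
  exact if_congr eq_comm rfl rfl

theorem sum_vertex_concat (g : PathSpace G) :
    concat G (∑ v, basisPath (ElemPath.vertex G v)) g = g := by
  refine ext_hat fun l => ?_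
  rw [hat_concat_of_mem (Submodule.sum_mem _ fun v _ =>
    basisPath_mem_lengthSpace (ElemPath.vertex G v))]
  rcases l with _ | ⟨a, l⟩
  · rw [hat_nil]
    rfl
  · rw [map_sum, Finsupp.finsetSum_apply]
    simp only [hat_vertex]
    simp

/-- Multiplying the total creation element by a vertex on the right selects the creation at that
vertex. The whole normalisation axiom can thus be phrased with one element. -/
theorem totalCreation_concat_vertex (hμ : IsPerronFrobenius G β μ) (w : V) (g : PathSpace G) :
    concat G (totalCreation G μ) (concat G (basisPath (ElemPath.vertex G w)) g) =
      concat G (creation G μ w) g := by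
  refine ext_hat fun l => ?_
  rw [hat_concat_of_mem (totalCreation_mem_lengthSpace hμ),
    hat_concat_of_mem (creation_mem_lengthSpace hμ w)]
  split_ifs with hl
  · obtain ⟨x, a, b, c, y, rfl, hx⟩ := exists_append_three (i := 0) hl
    rw [List.length_eq_zero_iff.1 hx]
    simp only [List.nil_append, List.take_succ_cons, List.take_zero, List.drop_succ_cons,
      List.drop_zero]
    rw [hat_concat_of_mem (basisPath_mem_lengthSpace (ElemPath.vertex G w)),
      hat_totalCreation hμ, hat_creation hμ]
    simp only [ElemPath.vertex, List.length_cons, Nat.zero_lt_succ, if_true, zero_add,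
      List.take_succ_cons, List.take_zero, List.drop_zero]
    change _ * (hat (basisPath (ElemPath.vertex G w)) [c] * _) = _
    rw [hat_vertex]
    by_cases hc : c = w
    · subst hc
      by_cases ha : a = c
      · subst ha
        simp
      · simp [ha]
    · simp [hc]
  · rfl

variable {ι : Type} [Fintype ι]

theorem SymmetryFamily.apply_vertex (F : SymmetryFamily G β μ ι) (a b : ι) (v : V) :
    F.T a b (basisPath (ElemPath.vertex G v)) =
      ∑ w, (F.T a b (basisPath (ElemPath.vertex G v))) (ElemPath.vertex G w) •
        basisPath (ElemPath.vertex G w) := by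
  refine ext_hat fun l => ?_
  simp only [map_sum, map_smul, Finsupp.finsetSum_apply, Finsupp.smul_apply, hat_vertex]
  by_cases hl : l.length = 1
  · obtain ⟨w, rfl⟩ := List.length_eq_one_iff.1 hl
    rw [← pathList_vertex, hat_pathList, pathList_vertex]
    simp
  · have h0 := F.length a b 0 _ (basisPath_mem_lengthSpace (ElemPath.vertex G v))
    rw [mem_lengthSpace.1 h0 l hl, Finset.sum_eq_zero]
    intro w _
    rw [if_neg, smul_zero]
    rintro rfl
    exact hl rfl

/-- Symmetry operators commute with multiplication by the sum of the creation operators. -/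
theorem SymmetryFamily.totalCreation_concat (hμ : IsPerronFrobenius G β μ)
    (F : SymmetryFamily G β μ ι) (a b : ι) (g : PathSpace G) :
    F.T a b (concat G (totalCreation G μ) g) = concat G (totalCreation G μ) (F.T a b g) := by
  -- The coefficients in the normalisation axiom are those of the image of a vertex, so the total
  -- creation element can be factored out of the image of each `creation G μ v`.
  have key : ∀ (t : V → ℂ) (k : PathSpace G), concat G (∑ w, t w • creation G μ w) k =
      concat G (totalCreation G μ)
        (concat G (∑ w, t w • basisPath (ElemPath.vertex G w)) k) := by
    intro t k
    simp only [map_sum, map_smul, LinearMap.sum_apply, LinearMap.smul_apply,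
      totalCreation_concat_vertex hμ]
  have h : F.T a b g = ∑ v, ∑ c, concat G (F.T a c (basisPath (ElemPath.vertex G v)))
      (F.T c b g) := by
    conv_lhs => rw [← sum_vertex_concat g]
    simp only [map_sum, LinearMap.sum_apply, F.continuity]
  have h' : concat G (totalCreation G μ) g = ∑ v, concat G (creation G μ v) g := by
    rw [totalCreation, map_sum, LinearMap.sum_apply]
  rw [h, h', map_sum, map_sum]
  refine Finset.sum_congr rfl fun v _ => ?_
  rw [F.continuity, map_sum]
  refine Finset.sum_congr rfl fun c _ => ?_
  rw [F.normalised, key, ← F.apply_vertex a c v]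

/-- The right-hand side depends on f and g only through their product and the position i. This is
what allows the insertion to be compared across different factorisations. -/
theorem hat_concat_totalCreation (hμ : IsPerronFrobenius G β μ) {i : ℕ} {f : PathSpace G}
    (hf : f ∈ lengthSpace G i) (g : PathSpace G) (l : List V) :
    hat (concat G f (concat G (totalCreation G μ) g)) l =
      hat (totalCreation G μ) ((l.drop i).take 3) *
        hat (concat G f g) (l.take (i + 1) ++ l.drop (i + 3)) := by
  by_cases hl : l.length < i + 3
  · rw [mem_lengthSpace.1 (totalCreation_mem_lengthSpace hμ) ((l.drop i).take 3), zero_mul,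
      hat_concat_of_mem hf, hat_concat_of_mem (totalCreation_mem_lengthSpace hμ)]
    · rw [if_neg (c := 2 < _), mul_zero, ite_self]
      rw [List.length_drop]
      omega
    · simp only [List.length_take, List.length_drop]
      omega
  · obtain ⟨x, v, u, w, y, rfl, rfl⟩ := exists_append_three (not_lt.1 hl)
    rw [hat_concat_of_mem hf, hat_concat_of_mem hf,
      hat_concat_of_mem (totalCreation_mem_lengthSpace hμ)]
    have e1 : (x ++ v :: u :: w :: y).take (x.length + 1) = x ++ [v] := by
      rw [List.take_length_add_append]
      rfl
    have e2 : (x ++ v :: u :: w :: y).drop x.length = v :: u :: w :: y :=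
      List.drop_left
    have e3 : (x ++ v :: u :: w :: y).drop (x.length + 3) = y := by
      rw [← List.drop_drop, e2]
      rfl
    have e4 : (x ++ [v] ++ y).take (x.length + 1) = x ++ [v] :=
      List.take_left' (by simp)
    have e5 : (x ++ [v] ++ y).drop x.length = v :: y := by simp
    rw [e1, e2, e3, e4, e5, if_pos (by simp), if_pos (by simp), if_pos (by simp)]
    simp only [List.take_succ_cons, List.take_zero, List.drop_succ_cons, List.drop_zero]
    rw [hat_totalCreation hμ]
    split_ifs with h
    · rw [h.1]
      ring
    · ring

/-- Continuity splits off f, the total creation element passes through the second factor, and the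
sum over the middle label is reassembled. As the formula is linear in S it extends to all of A; in
particular S vanishes on f ⋆ C ⋆ g as soon as it vanishes on f ⋆ g. -/
theorem hat_symmetry_concat_totalCreation (hμ : IsPerronFrobenius G β μ)
    {S : Module.End ℂ (PathSpace G)} (hS : S ∈ symmetrySpan G β μ) {i : ℕ} {f : PathSpace G}
    (hf : f ∈ lengthSpace G i) (g : PathSpace G) (l : List V) :
    hat (S (concat G f (concat G (totalCreation G μ) g))) l =
      hat (totalCreation G μ) ((l.drop i).take 3) *
        hat (S (concat G f g)) (l.take (i + 1) ++ l.drop (i + 3)) := by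
  induction hS using Submodule.span_induction with
  | mem S hS =>
    obtain ⟨ι, _, F, a, b, rfl⟩ := hS
    rw [F.continuity, F.continuity]
    simp only [F.totalCreation_concat hμ, map_sum, Finsupp.finsetSum_apply,
      hat_concat_totalCreation hμ (F.length _ _ _ f hf), Finset.mul_sum]
  | zero => simp
  | add S T _ _ hS hT =>
    simp only [LinearMap.add_apply, map_add, Finsupp.add_apply, hS, hT, mul_add]
  | smul c S _ hS =>
    simp only [LinearMap.smul_apply, map_smul, Finsupp.smul_apply, hS, smul_eq_mul]
    ring

theorem symmetry_mem_lengthSpace {S : Module.End ℂ (PathSpace G)} (hS : S ∈ symmetrySpan G β μ)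
    {n : ℕ} {f : PathSpace G} (hf : f ∈ lengthSpace G n) : S f ∈ lengthSpace G n := by
  induction hS using Submodule.span_induction with
  | mem S hS =>
    obtain ⟨ι, _, F, a, b, rfl⟩ := hS
    exact F.length a b n f hf
  | zero => exact Submodule.zero_mem _
  | add S T _ _ hS hT => exact Submodule.add_mem _ hS hT
  | smul c S _ hS => exact Submodule.smul_mem _ c hS

theorem symmetry_jones {S : Module.End ℂ (PathSpace G)} (hS : S ∈ symmetrySpan G β μ) (i : ℕ)
    (f : PathSpace G) : S (jones G β μ i f) = jones G β μ i (S f) := by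
  induction hS using Submodule.span_induction with
  | mem S hS =>
    obtain ⟨ι, _, F, a, b, rfl⟩ := hS
    exact F.evolution a b i f
  | zero => simp
  | add S T _ _ hS hT => rw [LinearMap.add_apply, LinearMap.add_apply, map_add, hS, hT]
  | smul c S _ hS => rw [LinearMap.smul_apply, LinearMap.smul_apply, map_smul, hS]

theorem symmetry_mem_essential {S : Module.End ℂ (PathSpace G)} (hS : S ∈ symmetrySpan G β μ)
    {f : PathSpace G} (hf : f ∈ essential G β μ) : S f ∈ essential G β μ := by
  rw [essential, Submodule.mem_iInf] at hf ⊢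
  intro i
  rw [LinearMap.mem_ker, ← symmetry_jones hS, LinearMap.mem_ker.1 (hf i), map_zero]

theorem pathInner_add_right (f g g' : PathSpace G) :
    pathInner f (g + g') = pathInner f g + pathInner f g' := by
  simp only [pathInner, Finsupp.add_apply, mul_add, Finsupp.sum_add]

theorem pathInner_smul_right (c : ℂ) (f g : PathSpace G) :
    pathInner f (c • g) = c * pathInner f g := by
  simp only [pathInner, Finsupp.sum, Finsupp.smul_apply, smul_eq_mul, Finset.mul_sum]
  exact Finset.sum_congr rfl fun ξ _ => by ring

theorem pathInner_zero_right (f : PathSpace G) : pathInner f 0 = 0 := by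
  simp [pathInner]

theorem eq_zero_of_pathInner_self {f : PathSpace G} (h : pathInner f f = 0) : f = 0 := by
  have h1 : pathInner f f = ((∑ ξ ∈ f.support, Complex.normSq (f ξ) : ℝ) : ℂ) := by
    rw [pathInner, Finsupp.sum, Complex.ofReal_sum]
    exact Finset.sum_congr rfl fun ξ _ => (Complex.normSq_eq_conj_mul_self).symm
  rw [h1, Complex.ofReal_eq_zero,
    Finset.sum_eq_zero_iff_of_nonneg fun ξ _ => Complex.normSq_nonneg _] at h
  ext ξ
  by_cases hξ : ξ ∈ f.support
  · exact Complex.normSq_eq_zero.1 (h ξ hξ)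
  · exact Finsupp.notMem_support_iff.1 hξ

/-- Hermiticity supplies an adjoint within the same family for each generator, and adjoints pass to
linear combinations with conjugated scalars. -/
theorem exists_adjoint {S : Module.End ℂ (PathSpace G)} (hS : S ∈ symmetrySpan G β μ) :
    ∃ S' ∈ symmetrySpan G β μ, ∀ f g, pathInner (S f) g = pathInner f (S' g) := by
  induction hS using Submodule.span_induction with
  | mem S hS =>
    obtain ⟨ι, _, F, a, b, rfl⟩ := hS
    exact ⟨_, Submodule.subset_span ⟨ι, _, F, _, _, rfl⟩, F.hermitian a b⟩
  | zero => exact ⟨0, Submodule.zero_mem _, by simp [pathInner_zero_left, pathInner_zero_right]⟩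
  | add S T _ _ hS hT =>
    obtain ⟨S', hS', h1⟩ := hS
    obtain ⟨T', hT', h2⟩ := hT
    refine ⟨S' + T', Submodule.add_mem _ hS' hT', fun f g => ?_⟩
    rw [LinearMap.add_apply, LinearMap.add_apply, pathInner_add_left, pathInner_add_right, h1, h2]
  | smul c S _ hS =>
    obtain ⟨S', hS', h1⟩ := hS
    refine ⟨conj c • S', Submodule.smul_mem _ _ hS', fun f g => ?_⟩
    rw [LinearMap.smul_apply, LinearMap.smul_apply, pathInner_smul_left, pathInner_smul_right, h1]

/-- The Jones projections applied to elementary paths, in terms of the creation operators. -/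
theorem jones_basisPath (hμ : IsPerronFrobenius G β μ) (i : ℕ) (ξ : ElemPath G) :
    jones G β μ i (basisPath ξ) = 0 ∨ ∃ (c : ℂ) (f g : PathSpace G) (ζ : ElemPath G),
      jones G β μ i (basisPath ξ) = c • concat G f (concat G (totalCreation G μ) g) ∧
        f ∈ lengthSpace G i ∧ concat G f g = basisPath ζ ∧ ζ.1 < ξ.1 := by
  have hj : ∀ x v u w y, x.length = i →
      hat (jones G β μ i (basisPath ξ)) (x ++ v :: u :: w :: y) =
        if v = w ∧ G.Adj v u then ((1 / β * (√(μ u) / μ v) : ℝ) : ℂ) *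
          ∑ u', (√(μ u') : ℂ) * if pathList ξ = x ++ v :: u' :: v :: y then 1 else 0 else 0 := by
    rintro x v u w y rfl
    rw [hat_jones hμ]
    simp only [hat_basisPath]
  by_cases hlen : ∃ x v u y, pathList ξ = x ++ v :: u :: v :: y ∧ x.length = i
  · right
    obtain ⟨x, v, u, y, hξ, rfl⟩ := hlen
    have hc := isChain_pathList ξ
    have hlen := length_pathList ξ
    rw [hξ, List.isChain_append_cons_cons, List.isChain_cons_cons] at hc
    rw [hξ] at hlen
    simp only [List.length_append, List.length_cons] at hlen
    obtain ⟨ζ₁, h₁⟩ := exists_pathList hc.1 (by simp)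
    obtain ⟨ζ₂, h₂⟩ := exists_pathList hc.2.2.2 (by simp)
    have hend : ζ₁.target = ζ₂.source := by
      have e1 := getLast?_pathList ζ₁
      have e2 := head?_pathList ζ₂
      rw [h₁, List.getLast?_concat] at e1
      rw [h₂, List.head?_cons] at e2
      exact Option.some_injective _ (e1.symm.trans e2)
    have h₃ := pathList_append_of_eq ζ₁ ζ₂ hend h₁ h₂
    have hl₁ : ζ₁.1 = x.length := by
      have := length_pathList ζ₁
      simp only [h₁, List.length_append, List.length_singleton] at this
      omega
    have hf : basisPath ζ₁ ∈ lengthSpace G x.length := hl₁ ▸ basisPath_mem_lengthSpace ζ₁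
    have hcat : concat G (basisPath ζ₁) (basisPath ζ₂) = basisPath (ζ₁.append ζ₂ hend) := by
      rw [concat_basisPath, dif_pos hend]
    -- The Jones coefficient is `√(μ u) * √(μ u') / (β * μ v)`. The inserted creation element
    -- carries `√(μ u') / √(μ v)`, and the rest is this constant.
    refine ⟨((1 / β * (√(μ u) / √(μ v)) : ℝ) : ℂ), basisPath ζ₁, basisPath ζ₂, _, ?_, hf, hcat, ?_⟩
    · refine ext_hat fun l => ?_
      rw [map_smul, Finsupp.smul_apply, hat_concat_totalCreation hμ hf, hcat, hat_basisPath, h₃]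
      by_cases hl : l.length < x.length + 3
      · rw [hat_jones_eq_zero _ hl, mem_lengthSpace.1 (totalCreation_mem_lengthSpace hμ),
          zero_mul, smul_zero]
        rw [List.length_take, List.length_drop]
        omega
      · obtain ⟨x', v', u', w', y', rfl, hx'⟩ := exists_append_three (not_lt.1 hl)
        rw [hj _ _ _ _ _ hx', ← hx', hξ]
        have e1 : (x' ++ v' :: u' :: w' :: y').take (x'.length + 1) = x' ++ [v'] := by
          rw [List.take_length_add_append]
          rfl
        have e2 : (x' ++ v' :: u' :: w' :: y').drop x'.length = v' :: u' :: w' :: y' :=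
          List.drop_left
        have e3 : (x' ++ v' :: u' :: w' :: y').drop (x'.length + 3) = y' := by
          rw [← List.drop_drop, e2]
          rfl
        rw [e1, e2, e3]
        simp only [List.take_succ_cons, List.take_zero, List.append_assoc, List.singleton_append]
        rw [hat_totalCreation hμ]
        have e4 : (x ++ v :: y = x' ++ v' :: y') ↔ x = x' ∧ v = v' ∧ y = y' := by
          rw [List.append_eq_append_iff_of_size_eq_left hx'.symm, List.cons.injEq]
        have e5 : ∀ u'', (x ++ v :: u :: v :: y = x' ++ v' :: u'' :: v' :: y') ↔
            u = u'' ∧ x = x' ∧ v = v' ∧ y = y' := by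
          intro u''
          rw [List.append_eq_append_iff_of_size_eq_left hx'.symm]
          simp only [List.cons.injEq]
          tauto
        simp only [e4, e5]
        by_cases h : v' = w' ∧ G.Adj v' u'
        · rw [if_pos h, if_pos h]
          by_cases h' : x = x' ∧ v = v' ∧ y = y'
          · obtain ⟨rfl, rfl, rfl⟩ := h'
            have hv : (√(μ v) : ℂ) ≠ 0 :=
              Complex.ofReal_ne_zero.2 (Real.sqrt_pos.2 (hμ.pos v)).ne'
            have hsq : (μ v : ℂ) = √(μ v) * √(μ v) := by
              rw [← Complex.ofReal_mul, Real.mul_self_sqrt (hμ.pos v).le]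
            simp only [and_self, and_true, if_true, mul_ite, mul_one, mul_zero,
              Finset.sum_ite_eq, Finset.mem_univ, smul_eq_mul]
            push_cast
            rw [hsq]
            field_simp
          · simp [h']
        · simp [h]
    · change ζ₁.1 + ζ₂.1 < ξ.1
      have := length_pathList ζ₂
      simp only [h₂, List.length_cons] at this
      omega
  · left
    refine ext_hat fun l => ?_
    rw [map_zero, Finsupp.zero_apply]
    by_cases hl : l.length < i + 3
    · exact hat_jones_eq_zero _ hl
    · obtain ⟨x, v, u, w, y, rfl, hx⟩ := exists_append_three (not_lt.1 hl)
      rw [hj _ _ _ _ _ hx]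
      split_ifs
      · rw [Finset.sum_eq_zero, mul_zero]
        intro u' _
        rw [if_neg fun h => hlen ⟨x, v, u', y, h, hx⟩, mul_zero]
      · rfl

/-- A combination of symmetry operators that vanishes on the essential paths is zero. -/
theorem symmetry_eq_zero (hμ : IsPerronFrobenius G β μ) {S : Module.End ℂ (PathSpace G)}
    (hS : S ∈ symmetrySpan G β μ) (h : ∀ f ∈ essential G β μ, S f = 0) : S = 0 := by
  have key : ∀ n, ∀ ξ : ElemPath G, ξ.1 = n → S (basisPath ξ) = 0 := by
    intro n
    induction n using Nat.strong_induction_on with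
    | _ n ih =>
    rintro ξ rfl
    -- A Jones projection of ξ is either zero or a creation inserted into a shorter elementary path,
    -- on which S vanishes by induction.
    have hE : S (basisPath ξ) ∈ essential G β μ := by
      rw [essential, Submodule.mem_iInf]
      intro i
      rw [LinearMap.mem_ker, ← symmetry_jones hS]
      rcases jones_basisPath hμ i ξ with h0 | ⟨c, f, g, ζ, h1, hf, h2, hζ⟩
      · rw [h0, map_zero]
      · rw [h1, map_smul]
        have : S (concat G f (concat G (totalCreation G μ) g)) = 0 := ext_hat fun l => by
          rw [hat_symmetry_concat_totalCreation hμ hS hf, h2, ih _ hζ ζ rfl]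
          simp
        rw [this, smul_zero]
    -- S' maps the essential vector S ξ into the essential space, where S vanishes. Hence ‖S' S ξ‖²
    -- = ⟨S S' S ξ, S ξ⟩ = 0, and then ‖S ξ‖² = ⟨ξ, S' S ξ⟩ = 0.
    obtain ⟨S', hS', hadj⟩ := exists_adjoint hS
    have h1 : S' (S (basisPath ξ)) = 0 := by
      apply eq_zero_of_pathInner_self
      rw [← hadj, h _ (symmetry_mem_essential hS' hE), pathInner_zero_left]
    apply eq_zero_of_pathInner_self
    rw [hadj, h1, pathInner_zero_right]
  refine Finsupp.lhom_ext fun ξ c => ?_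
  rw [single_eq_smul_basisPath, map_smul, key _ ξ rfl, smul_zero, LinearMap.zero_apply]

variable (G β μ) in
/-- The restriction of symmetry operators to the essential paths. -/
def restriction : symmetrySpan G β μ →ₗ[ℂ] gradedEnd (essential G β μ) where
  toFun S := ⟨S.1.restrict fun _ hf => symmetry_mem_essential S.2 hf,
    fun _ _ hf => symmetry_mem_lengthSpace S.2 hf⟩
  map_add' _ _ := rfl
  map_smul' _ _ := rfl

theorem restriction_bijective (hμ : IsPerronFrobenius G β μ) (hβ : β < 2) :
    Function.Bijective (restriction G β μ) := by
  constructor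
  · intro S T h
    have h0 : (S : Module.End ℂ (PathSpace G)) + (-1 : ℂ) • T = 0 := by
      refine symmetry_eq_zero hμ (Submodule.add_mem _ S.2 (Submodule.smul_mem _ _ T.2))
        fun f hf => ?_
      rw [LinearMap.add_apply, LinearMap.smul_apply, neg_one_smul, add_neg_eq_zero]
      exact congrArg (fun F : gradedEnd (essential G β μ) => ((F.1 ⟨f, hf⟩ : PathSpace G))) h
    refine Subtype.ext (LinearMap.ext fun f => ?_)
    have := LinearMap.congr_fun h0 f
    rwa [LinearMap.add_apply, LinearMap.smul_apply, neg_one_smul, LinearMap.zero_apply,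
      add_neg_eq_zero] at this
  · intro F
    obtain ⟨N, hN⟩ := hμ.exists_isTop hβ
    obtain ⟨S, hS, h⟩ := hN.exists_restriction hμ F.1 F.2
    exact ⟨⟨S, hS⟩, Subtype.ext (LinearMap.ext fun f => Subtype.ext (h f))⟩

end Restriction

end FaceModel

end

theorem mainTheorem3 {V : Type*} [Fintype V] [DecidableEq V]
    (G : SimpleGraph V) [DecidableRel G.Adj] (hG : G.IsTree)
    (β : ℝ) (μ : V → ℝ) (hμ : FaceModel.IsPerronFrobenius G β μ) (hβ : β < 2) :
    ∃ Φ : FaceModel.symmetrySpan G β μ ≃ₗ[ℂ]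
        FaceModel.gradedEnd (FaceModel.essential G β μ),
      ∀ (S : FaceModel.symmetrySpan G β μ) (ξ : FaceModel.essential G β μ),
        (((Φ S : Module.End ℂ (FaceModel.essential G β μ)) ξ :
            FaceModel.essential G β μ) : FaceModel.PathSpace G) =
          (S : Module.End ℂ (FaceModel.PathSpace G)) (ξ : FaceModel.PathSpace G) := by
  exact ⟨LinearEquiv.ofBijective (FaceModel.restriction G β μ)
    (FaceModel.restriction_bijective hμ hβ), fun _ _ => rfl⟩
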